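/- Let $m,n,L\ge 0$ be integers, $\hbar\in\mathbb{C}$, and let $V=(\mathbb{C}^{m|n})^{\otimes L}$, where $\mathbb{C}^{m|n}$ has basis $\mathbf e_A$, $A\in\{1,\dots,m,\hat 1,\dots,\hat n\}$, with parity $\bar A=0$ for $A\in\{1,\dots,m\}$ and $\bar A=1$ for $A\in\{\hat 1,\dots,\hat n\}$. The Lie superalgebra $\mathfrak{gl}_{m|n}$ acts on $V$ by the operators $\mathcal{E}_{AB}$ induced from $\mathsf{E}_{AB}\mathbf e_C=\delta_{BC}\mathbf e_A$ by the graded product rule $$\mathcal{E}_{AB}\,\mathbf e_{I_1}\otimes\cdots\otimes\mathbf e_{I_L}=\sum_{\ell=1}^L\delta_{B I_\ell}(-1)^{(\bar A+\bar B)(\bar I_1+\cdots+\bar I_{\ell-1})}\,\mathbf e_{I_1}\otimes\cdots\otimes\mathbf e_{I_{\ell-1}}\otimes\mathbf e_A\otimes\mathbf e_{I_{\ell+1}}\otimes\cdots\otimes\mathbf e_{I_L}.$$ For $\Lambda=[\lambda_1,\dots,\lambda_m|\nu_1,\dots,\nu_n]\in\mathbb{Z}_{\ge0}^{m+n}$ let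 $V_\Lambda\subset V$ be the space of vectors $v$ with $\mathcal{E}_{aa}v=\lambda_a v$ and $\mathcal{E}_{\hat i\hat i}v=\nu_i v$ for all $a,i$. For a Young diagram $\Lambda^+$ with row lengths $\underline\lambda_1\ge\underline\lambda_2\ge\cdots$ and column heights $\underline\lambda'_1\ge\underline\lambda'_2\ge\cdots$, put $\Lambda=[\underline\lambda_1,\dots,\underline\lambda_m|\max(0,\underline\lambda'_1-m),\dots,\max(0,\underline\lambda'_n-m)]$ and let $V^+_\Lambda\subset V_\Lambda$ be the space of highest-weight vectors: those $v\in V_\Lambda$ with $\mathcal{E}_{AB}v=0$ for all $A<B$, in the order $1<\dots<m<\hat 1<\dots<\hat n$. Let $\mathbb{C}[\theta]=\mathbb{C}[\theta_1,\dots,\theta_L]$, let $\mathbb{C}[\chi]\subset\mathbb{C}[\theta]$ be the subalgebra of symmetric polynomials, and for $1\le\ell\le L-1$ define on $V\otimes\mathbb{C}[\theta]$ the operator $$S_\ell=\mathcal{P}_{\ell,\ell+1}\Pi_{\ell,\ell+1}-\frac{\hbar}{\theta_\ell-\theta_{\ell+1}}\left(\Pi_{\ell,\ell+1}-1\right),$$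 where $\mathcal{P}_{\ell,\ell+1}$ is the graded permutation of the $\ell$-th and $(\ell+1)$-st tensor factors of $V$ ($\mathbf e_A\otimes\mathbf e_B\mapsto(-1)^{\bar A\bar B}\mathbf e_B\otimes\mathbf e_A$) and $\Pi_{\ell,\ell+1}$ exchanges the variables $\theta_\ell$ and $\theta_{\ell+1}$. Let $\mathcal{V}^{\mathsf S}\subset V\otimes\mathbb{C}[\theta]$ be the $\mathbb{C}[\chi]$-submodule of vectors fixed by all $S_\ell$, and set $$\mathcal{V}^{\mathsf S}_\Lambda=\mathcal{V}^{\mathsf S}\cap(V_\Lambda\otimes\mathbb{C}[\theta]),\qquad \mathcal{V}^{\mathsf S+}_\Lambda=\mathcal{V}^{\mathsf S}\cap(V^+_\Lambda\otimes\mathbb{C}[\theta]).$$ For a $\mathbb{C}[\chi]$-submodule $M\subset V\otimes\mathbb{C}[\theta]$ let $\mathcal F_kM$ be the subspace of vectors of $M$ all of whose monomials in the $\theta$'s have degree at most $k$ (so $\mathcal F_{-1}M=0$), and let $\mathrm{ch}(M)=\sum_{k\ge0}\dim_{\mathbb{C}}(\mathcal F_kM/\mathcal F_{k-1}M)\,t^k$.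 (1) If $\sum_a\lambda_a+\sum_i\nu_i=L$, then $\mathcal{V}^{\mathsf S}_\Lambda$ is a free $\mathbb{C}[\chi]$-module of finite rank $\dfrac{L!}{\prod_a\lambda_a!\,\prod_i\nu_i!}$, and $$\mathrm{ch}(\mathcal{V}^{\mathsf S}_\Lambda)=t^{\Upsilon_\Lambda}\prod_{a=1}^m\prod_{k=1}^{\lambda_a}\frac1{1-t^k}\prod_{i=1}^n\prod_{k=1}^{\nu_i}\frac1{1-t^k},\qquad \Upsilon_\Lambda=\sum_{i=1}^n\frac{\nu_i(\nu_i-1)}2 .$$ (2) If $\Lambda^+$ has $L$ boxes and fits into the $(m|n)$-hook, i.e. $\underline\lambda_{m+1}\le n$, then $\mathcal{V}^{\mathsf S+}_\Lambda$ is a free $\mathbb{C}[\chi]$-module of finite rank $\dfrac{L!}{\prod_{(a,s)\in\Lambda^+}h_{a,s}}=\dim_{\mathbb{C}} V^+_\Lambda$, where $h_{a,s}$ is the hook length of the box $(a,s)$, and $$\mathrm{ch}(\mathcal{V}^{\mathsf S+}_\Lambda)=t^{\Upsilon^+_\Lambda}\prod_{(a,s)\in\Lambda^+}\frac1{1-t^{h_{a,s}}},\qquad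 \Upsilon^+_\Lambda=\sum_{s=1}^{\underline\lambda_1}\frac{h_s(h_s-1)}2,$$ where $h_s=\underline\lambda'_s$ is the height of the $s$-th column of $\Lambda^+$. -/

import Mathlib

open scoped TensorProduct

namespace SuperSpinChain

/-- The index set `{1, …, m, 1̂, …, n̂}`: `Sum.inl a` is bosonic, `Sum.inr i` is fermionic. -/
abbrev Idx (m n : ℕ) : Type := Fin m ⊕ Fin n

/-- The parity of an index: `0` for bosonic, `1` for fermionic. -/
def parity {m n : ℕ} : Idx m n → ℕ := Sum.elim (fun _ => 0) (fun _ => 1)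

/-- Words `I = (I_1, …, I_L)`, which label the standard basis `e_I = e_{I_1} ⊗ ⋯ ⊗ e_{I_L}` of
`(ℂ^{m|n})^{⊗ L}`. -/
abbrev Word (m n L : ℕ) : Type := Fin L → Idx m n

/-- The Hilbert space `V = (ℂ^{m|n})^{⊗ L}` of the spin chain, in coordinates with respect to the
basis `e_I`: the vector `v` is `∑_I v(I) e_I`. -/
abbrev Chain (m n L : ℕ) : Type := Word m n L → ℂ

/-- The standard basis `e_I` of `V`. -/
noncomputable abbrev spinBasis (m n L : ℕ) : Module.Basis (Word m n L) ℂ (Chain m n L) :=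
  Pi.basisFun ℂ (Word m n L)

/-- The identification of `V` with the `L`-fold tensor power of `ℂ^{m|n}`, which sends `e_I` to
`e_{I_1} ⊗ ⋯ ⊗ e_{I_L}`. -/
noncomputable def chainEquivTensor (m n L : ℕ) :
    Chain m n L ≃ₗ[ℂ] ⨂[ℂ] _ : Fin L, (Idx m n → ℂ) :=
  (spinBasis m n L).equiv (Basis.piTensorProduct fun _ => Pi.basisFun ℂ (Idx m n))
    (Equiv.refl _)

theorem chainEquivTensor_basis (m n L : ℕ) (I : Word m n L) :
    chainEquivTensor m n L (spinBasis m n L I) =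
      ⨂ₜ[ℂ] k, (Pi.single (I k) 1 : Idx m n → ℂ) := by
  rw [chainEquivTensor, Module.Basis.equiv_apply]
  simp

/-- The global action of the generator `E_{AB}` of `gl(m|n)` on `V`, induced from
`E_{AB} e_C = δ_{BC} e_A` by the graded product rule:
`E_{AB} e_I = ∑_ℓ δ_{B, I_ℓ} (-1)^{(Ā + B̄)(Ī_1 + ⋯ + Ī_{ℓ-1})} e_{I with I_ℓ replaced by A}`. -/
noncomputable def glAction {m n L : ℕ} (A B : Idx m n) : Chain m n L →ₗ[ℂ] Chain m n L :=
  (spinBasis m n L).constr ℂ fun I =>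
    ∑ l : Fin L, if I l = B then
      ((-1 : ℂ) ^ ((parity A + parity B) * ∑ k ∈ Finset.univ.filter (· < l), parity (I k))) •
        spinBasis m n L (Function.update I l A)
    else 0

/-- The weight subspace `V_Λ`, `Λ = [λ_1, …, λ_m | ν_1, …, ν_n]`: all vectors `v` with
`E_{aa} v = λ_a v` and `E_{ii} v = ν_i v`. -/
noncomputable def weightSpace {m n : ℕ} (L : ℕ) (lam : Fin m → ℕ) (nu : Fin n → ℕ) :
    Submodule ℂ (Chain m n L) :=
  ⨅ A : Idx m n, LinearMap.ker
    (glAction (L := L) A A - ((Sum.elim lam nu A : ℕ) : ℂ) • LinearMap.id)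

/-- Vectors annihilated by all `E_{AB}` with `A < B`, for the order `1 < … < m < 1̂ < … < n̂`. -/
noncomputable def singularSpace (m n L : ℕ) : Submodule ℂ (Chain m n L) :=
  ⨅ (A : Idx m n) (B : Idx m n) (_ : toLex A < toLex B), LinearMap.ker (glAction (L := L) A B)

/-- The bosonic part of the fundamental weight of a Young diagram: `λ_a` is the length of the
`a`-th row. -/
def weightBos (m : ℕ) (μ : YoungDiagram) (a : Fin m) : ℕ := μ.rowLen a

/-- The fermionic part of the fundamental weight of a Young diagram:
`ν_i = max(0, height of the i-th column - m)` (truncated subtraction). -/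
def weightFer (m n : ℕ) (μ : YoungDiagram) (i : Fin n) : ℕ := μ.colLen i - m

/-- The space `V_Λ^+` of the `gl(m|n)` highest-weight vectors in `V` of all irreps with Young
diagram `μ`. -/
noncomputable def highestWeightSpace (m n L : ℕ) (μ : YoungDiagram) :
    Submodule ℂ (Chain m n L) :=
  weightSpace L (weightBos m μ) (weightFer m n μ) ⊓ singularSpace m n L

/-- `ℂ[θ] = ℂ[θ_1, …, θ_L]`. -/
abbrev PolyTheta (L : ℕ) : Type := MvPolynomial (Fin L) ℂ

/-- `ℂ[χ]`, the algebra of symmetric polynomials in `θ_1, …, θ_L`. -/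
abbrev PolyChi (L : ℕ) : Subalgebra ℂ (PolyTheta L) :=
  MvPolynomial.symmetricSubalgebra (Fin L) ℂ

/-- `V ⊗ ℂ[θ]`, in coordinates: `v` is `∑_I e_I ⊗ v(I)` with `v(I) ∈ ℂ[θ]`. -/
abbrev ThetaChain (m n L : ℕ) : Type := Word m n L → PolyTheta L

/-- A shortcut to Mathlib's instance, which type class search finds only slowly. -/
noncomputable instance chiModule {m n L : ℕ}
    (M : Submodule (PolyChi L) (ThetaChain m n L)) : Module (PolyChi L) M :=
  Submodule.module M

/-- The subspace `U ⊗ ℂ[θ]` of `V ⊗ ℂ[θ]` for a subspace `U` of `V`: the `ℂ[θ]`-span of the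
vectors `u ⊗ 1`, `u ∈ U`. -/
noncomputable def extendTheta {m n L : ℕ} (U : Submodule ℂ (Chain m n L)) :
    Submodule (PolyTheta L) (ThetaChain m n L) :=
  Submodule.span (PolyTheta L) {w | ∃ u ∈ U, w = fun I => MvPolynomial.C (u I)}

section Operators

variable {L : ℕ}

/-- The site `ℓ`, for `ℓ + 1 < L` (sites are numbered from `0`). -/
abbrev siteL (l : ℕ) (h : l + 1 < L) : Fin L := ⟨l, Nat.lt_of_succ_lt h⟩

/-- The site `ℓ + 1`. -/
abbrev siteR (l : ℕ) (h : l + 1 < L) : Fin L := ⟨l + 1, h⟩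

/-- The transposition of the sites `ℓ` and `ℓ + 1`. -/
def siteSwap (l : ℕ) (h : l + 1 < L) : Equiv.Perm (Fin L) := Equiv.swap (siteL l h) (siteR l h)

/-- `Π_{ℓ,ℓ+1}`: exchange of the variables `θ_ℓ` and `θ_{ℓ+1}` in polynomials. -/
noncomputable def varSwap (l : ℕ) (h : l + 1 < L) : PolyTheta L →ₐ[ℂ] PolyTheta L :=
  MvPolynomial.rename (siteSwap l h)

/-- The graded permutation `P_{ℓ,ℓ+1}` of neighbouring tensor factors,
`⋯ e_A ⊗ e_B ⋯ ↦ (-1)^{Ā B̄} ⋯ e_B ⊗ e_A ⋯`, in coordinates. -/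
noncomputable def gradedSwap (m n : ℕ) (l : ℕ) (h : l + 1 < L) :
    ThetaChain m n L →ₗ[PolyTheta L] ThetaChain m n L where
  toFun v J := (-1) ^ (parity (J (siteL l h)) * parity (J (siteR l h))) * v (J ∘ siteSwap l h)
  map_add' v w := by
    funext J
    simp only [Pi.add_apply, mul_add]
  map_smul' p v := by
    funext J
    simp only [Pi.smul_apply, smul_eq_mul, RingHom.id_apply]
    ring

theorem theta_sub_ne_zero (l : ℕ) (h : l + 1 < L) :
    (MvPolynomial.X (siteL l h) - MvPolynomial.X (siteR l h) : PolyTheta L) ≠ 0 := by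
  rw [sub_ne_zero]
  intro e
  have := MvPolynomial.X_injective e
  simp [siteL, siteR] at this

theorem theta_sub_dvd (l : ℕ) (h : l + 1 < L) (f : PolyTheta L) :
    (MvPolynomial.X (siteL l h) - MvPolynomial.X (siteR l h) : PolyTheta L) ∣
      varSwap l h f - f := by
  induction f using MvPolynomial.induction_on with
  | C a => simp [varSwap]
  | add p q hp hq =>
    rw [map_add, add_sub_add_comm]
    exact dvd_add hp hq
  | mul_X p i hp =>
    have hX : (MvPolynomial.X (siteL l h) - MvPolynomial.X (siteR l h) : PolyTheta L) ∣
        varSwap l h (MvPolynomial.X i) - MvPolynomial.X i := by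
      simp only [varSwap, siteSwap, MvPolynomial.rename_X]
      by_cases h1 : i = siteL l h
      · subst h1
        rw [Equiv.swap_apply_left]
        exact ⟨-1, by ring⟩
      · by_cases h2 : i = siteR l h
        · subst h2
          rw [Equiv.swap_apply_right]
        · rw [Equiv.swap_apply_of_ne_of_ne h1 h2, sub_self]
          exact dvd_zero _
    have e : varSwap l h (p * MvPolynomial.X i) - p * MvPolynomial.X i =
        (varSwap l h p - p) * varSwap l h (MvPolynomial.X i) +
          p * (varSwap l h (MvPolynomial.X i) - MvPolynomial.X i) := by
      rw [map_mul]; ring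
    rw [e]
    exact dvd_add (hp.mul_right _) (hX.mul_left _)

/-- The polynomial `(Π_{ℓ,ℓ+1} f - f) / (θ_ℓ - θ_{ℓ+1})`. -/
noncomputable def divDiffFun (l : ℕ) (h : l + 1 < L) (f : PolyTheta L) : PolyTheta L :=
  (theta_sub_dvd l h f).choose

theorem theta_sub_mul_divDiffFun (l : ℕ) (h : l + 1 < L) (f : PolyTheta L) :
    (MvPolynomial.X (siteL l h) - MvPolynomial.X (siteR l h)) * divDiffFun l h f =
      varSwap l h f - f :=
  (theta_sub_dvd l h f).choose_spec.symm

/-- The linear operator `(θ_ℓ - θ_{ℓ+1})⁻¹ (Π_{ℓ,ℓ+1} - 1)` on `ℂ[θ]`. -/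
noncomputable def divDiff (l : ℕ) (h : l + 1 < L) : PolyTheta L →ₗ[ℂ] PolyTheta L where
  toFun := divDiffFun l h
  map_add' f g := by
    apply mul_left_cancel₀ (theta_sub_ne_zero l h)
    rw [mul_add]
    simp only [theta_sub_mul_divDiffFun, map_add]
    ring
  map_smul' c f := by
    apply mul_left_cancel₀ (theta_sub_ne_zero l h)
    rw [RingHom.id_apply, mul_smul_comm]
    simp only [theta_sub_mul_divDiffFun, map_smul, smul_sub]

theorem theta_sub_mul_divDiff (l : ℕ) (h : l + 1 < L) (f : PolyTheta L) :
    (MvPolynomial.X (siteL l h) - MvPolynomial.X (siteR l h)) * divDiff l h f =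
      varSwap l h f - f :=
  theta_sub_mul_divDiffFun l h f

theorem varSwap_chi (l : ℕ) (h : l + 1 < L) (c : PolyChi L) :
    varSwap l h (c : PolyTheta L) = c :=
  (MvPolynomial.mem_symmetricSubalgebra _).1 c.2 _

theorem divDiff_chi_mul (l : ℕ) (h : l + 1 < L) (c : PolyChi L) (f : PolyTheta L) :
    divDiff l h ((c : PolyTheta L) * f) = c * divDiff l h f := by
  apply mul_left_cancel₀ (theta_sub_ne_zero l h)
  rw [mul_left_comm]
  simp only [theta_sub_mul_divDiff, map_mul, varSwap_chi]
  ring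

/-- The operator
`S_ℓ = P_{ℓ,ℓ+1} Π_{ℓ,ℓ+1} - ℏ (θ_ℓ - θ_{ℓ+1})⁻¹ (Π_{ℓ,ℓ+1} - 1)` on `V ⊗ ℂ[θ]`. -/
noncomputable def symOp (m n : ℕ) (hbar : ℂ) (l : ℕ) (h : l + 1 < L) :
    ThetaChain m n L →ₗ[ℂ] ThetaChain m n L :=
  (gradedSwap m n l h).restrictScalars ℂ ∘ₗ (varSwap l h).toLinearMap.compLeft (Word m n L) -
    hbar • (divDiff l h).compLeft (Word m n L)

theorem symOp_apply (m n : ℕ) (hbar : ℂ) (l : ℕ) (h : l + 1 < L) (v : ThetaChain m n L)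
    (J : Word m n L) :
    symOp m n hbar l h v J =
      (-1) ^ (parity (J (siteL l h)) * parity (J (siteR l h))) *
        varSwap l h (v (J ∘ siteSwap l h)) - hbar • divDiff l h (v J) :=
  rfl

theorem symOp_chi_smul (m n : ℕ) (hbar : ℂ) (l : ℕ) (h : l + 1 < L) (c : PolyChi L)
    (v : ThetaChain m n L) : symOp m n hbar l h (c • v) = c • symOp m n hbar l h v := by
  funext J
  have e : ∀ g : PolyTheta L, c • g = (c : PolyTheta L) * g := fun g => rfl
  simp only [symOp_apply, Pi.smul_apply, e, map_mul, varSwap_chi, divDiff_chi_mul, mul_sub,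
    mul_smul_comm]
  ring

end Operators

/-- `𝒱^S`: the `ℂ[χ]`-submodule of `V ⊗ ℂ[θ]` of vectors invariant under all `S_ℓ`. -/
noncomputable def symModule (m n L : ℕ) (hbar : ℂ) :
    Submodule (PolyChi L) (ThetaChain m n L) where
  carrier := {v | ∀ (l : ℕ) (h : l + 1 < L), symOp m n hbar l h v = v}
  zero_mem' := fun l h => map_zero _
  add_mem' := fun hx hy l h => by rw [map_add, hx l h, hy l h]
  smul_mem' := fun c v hv l h => by rw [symOp_chi_smul, hv l h]

/-- `𝒱^S ∩ (U ⊗ ℂ[θ])` for a subspace `U` of `V`, as a `ℂ[χ]`-module. -/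
noncomputable def symSubmodule {m n L : ℕ} (hbar : ℂ) (U : Submodule ℂ (Chain m n L)) :
    Submodule (PolyChi L) (ThetaChain m n L) :=
  symModule m n L hbar ⊓ (extendTheta U).restrictScalars (PolyChi L)

/-- `𝒱^S_Λ = 𝒱^S ∩ (V_Λ ⊗ ℂ[θ])`. -/
noncomputable def symWeightModule {m n : ℕ} (L : ℕ) (hbar : ℂ) (lam : Fin m → ℕ)
    (nu : Fin n → ℕ) : Submodule (PolyChi L) (ThetaChain m n L) :=
  symSubmodule hbar (weightSpace L lam nu)

/-- `𝒱^{S+}_Λ = 𝒱^S ∩ (V_Λ^+ ⊗ ℂ[θ])`. -/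
noncomputable def symHighestWeightModule (m n L : ℕ) (hbar : ℂ) (μ : YoungDiagram) :
    Submodule (PolyChi L) (ThetaChain m n L) :=
  symSubmodule hbar (highestWeightSpace m n L μ)

/-- The vectors of `V ⊗ ℂ[θ]` of degree at most `k`: every monomial in `θ` which occurs in `v`
has total degree at most `k`. This is `0` for `k < 0`. -/
noncomputable def degreeLE (m n L : ℕ) (k : ℤ) : Submodule ℂ (ThetaChain m n L) :=
  Submodule.pi Set.univ fun _ : Word m n L =>
    MvPolynomial.restrictSupport ℂ {d : Fin L →₀ ℕ | (d.degree : ℤ) ≤ k}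

/-- `F_k M`: the vectors of `M` of degree at most `k`. -/
noncomputable def filtration {m n L : ℕ} (M : Submodule (PolyChi L) (ThetaChain m n L)) (k : ℤ) :
    Submodule ℂ (ThetaChain m n L) :=
  M.restrictScalars ℂ ⊓ degreeLE m n L k

/-- The character `ch(M) = ∑_{k ≥ 0} dim (F_k M / F_{k-1} M) t^k`. -/
noncomputable def character {m n L : ℕ} (M : Submodule (PolyChi L) (ThetaChain m n L)) :
    PowerSeries ℚ :=
  PowerSeries.mk fun k =>
    (Module.finrank ℂ
      (filtration M k ⧸ (filtration M ((k : ℤ) - 1)).submoduleOf (filtration M k)) : ℚ)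

/-- The hook length of the box `c` (row `c.1`, column `c.2`, counted from `0`): the number of
boxes to its right in its row, plus the number of boxes below it in its column, plus one. -/
def hookLength (μ : YoungDiagram) (c : ℕ × ℕ) : ℕ :=
  (μ.rowLen c.1 - c.2 - 1) + (μ.colLen c.2 - c.1 - 1) + 1

end SuperSpinChain

namespace SuperSpinChain

set_option linter.unusedSectionVars false

section GradedOperators

variable {ι : Type*} [DecidableEq ι] (p : ι → ℕ) {L : ℕ} {M : Type*} [AddCommGroup M] [Module ℂ M]

/-- The sign picked up when `E_{AB}` passes a tensor factor `e_X`. -/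
def crossSign (A B X : ι) : ℂ := (-1) ^ ((p A + p B) * p X)

theorem crossSign_mul_self (A B X : ι) : crossSign p A B X * crossSign p A B X = 1 := by
  rw [crossSign, ← pow_add, ← two_mul, pow_mul]; simp

theorem crossSign_mul (A B C X : ι) :
    crossSign p A B X * crossSign p B C X = crossSign p A C X := by
  simp only [crossSign, ← pow_add]
  rw [show (p A + p B) * p X + (p B + p C) * p X = (p A + p C) * p X + 2 * (p B * p X) by ring,
    pow_add, pow_mul]
  simp

/-- The sign picked up by `E_{AB}` on its way to the site `l`. -/
def stringSign (A B : ι) (J : Fin L → ι) (l : Fin L) : ℂ :=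
  ∏ k ∈ Finset.univ.filter (· < l), crossSign p A B (J k)

theorem stringSign_mul (A B C : ι) (J : Fin L → ι) (l : Fin L) :
    stringSign p A B J l * stringSign p B C J l = stringSign p A C J l := by
  simp only [stringSign, ← Finset.prod_mul_distrib, crossSign_mul]

theorem stringSign_update (A B : ι) (J : Fin L → ι) (l l' : Fin L) (X : ι) :
    stringSign p A B (Function.update J l X) l' =
      stringSign p A B J l' *
        if l < l' then crossSign p A B X * crossSign p A B (J l) else 1 := by
  unfold stringSign
  split_ifs with h
  · have hl : l ∈ Finset.univ.filter (· < l') := by simpa using h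
    rw [← Finset.mul_prod_erase _ _ hl,
      ← Finset.mul_prod_erase _ (fun k => crossSign p A B (J k)) hl,
      Function.update_self]
    have : ∏ k ∈ (Finset.univ.filter (· < l')).erase l, crossSign p A B (Function.update J l X k) =
        ∏ k ∈ (Finset.univ.filter (· < l')).erase l, crossSign p A B (J k) :=
      Finset.prod_congr rfl fun k hk => by
        rw [Function.update_of_ne (Finset.ne_of_mem_erase hk)]
    rw [this]
    linear_combination (-crossSign p A B X * ∏ k ∈ (Finset.univ.filter (· < l')).erase l,
      crossSign p A B (J k)) * crossSign_mul_self p A B (J l)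
  · rw [mul_one]
    refine Finset.prod_congr rfl fun k hk => ?_
    rw [Function.update_of_ne]
    rintro rfl
    exact h (by simpa using hk)

/-- The action of `E_{AB}` on tensors with coefficients in `M`, in coordinates. -/
noncomputable def rootOp (A B : ι) : ((Fin L → ι) → M) →ₗ[ℂ] ((Fin L → ι) → M) where
  toFun v J := ∑ l, if J l = A then stringSign p A B J l • v (Function.update J l B) else 0
  map_add' v w := by
    funext J
    simp only [Pi.add_apply, ← Finset.sum_add_distrib]
    refine Finset.sum_congr rfl fun l _ => ?_
    split_ifs <;> simp
  map_smul' c v := by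
    funext J
    simp only [Pi.smul_apply, Finset.smul_sum, RingHom.id_apply]
    refine Finset.sum_congr rfl fun l _ => ?_
    split_ifs
    · rw [smul_comm]
    · simp

theorem rootOp_apply (A B : ι) (v : (Fin L → ι) → M) (J : Fin L → ι) :
    rootOp p A B v J =
      ∑ l, if J l = A then stringSign p A B J l • v (Function.update J l B) else 0 := rfl

theorem rootOp_comp_linearMap {M' : Type*} [AddCommGroup M'] [Module ℂ M'] (f : M →ₗ[ℂ] M')
    (A B : ι) (v : (Fin L → ι) → M) (J : Fin L → ι) :
    rootOp p A B (fun I => f (v I)) J = f (rootOp p A B v J) := by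
  simp only [rootOp_apply, map_sum]
  refine Finset.sum_congr rfl fun l _ => ?_
  split_ifs <;> simp

/-- The sign in the supercommutator of `E_{AB}` and `E_{CD}`. -/
def commSign (A B C D : ι) : ℂ := (-1) ^ ((p A + p B) * (p C + p D))

theorem rootOp_commutator (A B C D : ι) (v : (Fin L → ι) → M) :
    rootOp p A B (rootOp p C D v) =
      commSign p A B C D • rootOp p C D (rootOp p A B v) +
        ((if B = C then rootOp p A D v else 0) -
          commSign p A B C D • if D = A then rootOp p C B v else 0) := by
  rw [← sub_eq_iff_eq_add']
  funext J
  have h1 : rootOp p A B (rootOp p C D v) J = ∑ l, ∑ l', if J l = A then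
      (if Function.update J l B l' = C then (stringSign p A B J l *
        stringSign p C D (Function.update J l B) l') •
          v (Function.update (Function.update J l B) l' D) else 0) else 0 := by
    rw [rootOp_apply]
    refine Finset.sum_congr rfl fun l _ => ?_
    split_ifs
    · rw [rootOp_apply, Finset.smul_sum]
      refine Finset.sum_congr rfl fun l' _ => ?_
      split_ifs
      · rw [mul_smul]
      · simp
    · simp
  have h2 : rootOp p C D (rootOp p A B v) J = ∑ l, ∑ l', if J l' = C then
      (if Function.update J l' D l = A then (stringSign p C D J l' *
        stringSign p A B (Function.update J l' D) l) •
          v (Function.update (Function.update J l' D) l B) else 0) else 0 := by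
    rw [rootOp_apply, Finset.sum_comm]
    refine Finset.sum_congr rfl fun l _ => ?_
    split_ifs
    · rw [rootOp_apply, Finset.smul_sum]
      refine Finset.sum_congr rfl fun l' _ => ?_
      split_ifs
      · rw [mul_smul]
      · simp
    · simp
  have h3 : ((if B = C then rootOp p A D v else 0) -
      commSign p A B C D • if D = A then rootOp p C B v else 0) J =
      ∑ l, ((if B = C then (if J l = A then stringSign p A D J l • v (Function.update J l D)
        else 0) else 0) - commSign p A B C D • if D = A then (if J l = C then
          stringSign p C B J l • v (Function.update J l B) else 0) else 0) := by
    rw [Finset.sum_sub_distrib, ← Finset.smul_sum, Pi.sub_apply, Pi.smul_apply]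
    congr 1
    · split_ifs <;> simp [rootOp_apply]
    · congr 1
      split_ifs <;> simp [rootOp_apply]
  rw [Pi.sub_apply, Pi.smul_apply, h1, h2, h3, Finset.smul_sum, ← Finset.sum_sub_distrib]
  refine Finset.sum_congr rfl fun l _ => ?_
  rw [Finset.smul_sum, ← Finset.sum_sub_distrib, Finset.sum_eq_single l]
  · simp only [Function.update_self, Function.update_idem]
    congr 1
    · by_cases hA : J l = A <;> by_cases hB : B = C <;> simp [hA, hB]
      subst hB
      rw [stringSign_update, if_neg (lt_irrefl _), mul_one, stringSign_mul]
    · congr 1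
      by_cases hA : J l = C <;> by_cases hB : D = A <;> simp [hA, hB]
      subst hB
      rw [stringSign_update, if_neg (lt_irrefl _), mul_one, stringSign_mul]
  · intro l' _ hne
    rw [Function.update_of_ne hne, Function.update_of_ne hne.symm, Function.update_comm hne]
    by_cases hA : J l = A <;> by_cases hC : J l' = C <;> simp only [hA, hC, if_true, if_false,
      smul_zero, sub_zero]
    rw [smul_smul, ← sub_smul, stringSign_update, stringSign_update, hA, hC]
    convert zero_smul ℂ _
    have e : ∀ a b c d : ℕ, (-1 : ℂ) ^ (a * b + c * d) = (-1) ^ (a * b) * (-1) ^ (c * d) :=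
      fun a b c d => pow_add _ _ _
    have key : crossSign p C D B * crossSign p C D A = commSign p A B C D := by
      simp only [crossSign, commSign, ← pow_add]; congr 1; ring
    have key' : crossSign p A B D * crossSign p A B C = commSign p A B C D := by
      simp only [crossSign, commSign, ← pow_add]; congr 1; ring
    have sq : commSign p A B C D * commSign p A B C D = 1 := by
      rw [commSign, ← pow_add, ← two_mul, pow_mul]; simp
    rw [key, key']
    rcases lt_or_gt_of_ne hne with h | h
    · rw [if_neg (not_lt_of_gt h), if_pos h]
      linear_combination (-stringSign p A B J l * stringSign p C D J l') * sq
    · rw [if_neg (not_lt_of_gt h), if_pos h]; ring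
  · simp

end GradedOperators

section Invariants

variable {ι : Type*} [DecidableEq ι] (p : ι → ℕ) {L : ℕ} {M : Type*} [AddCommGroup M] [Module ℂ M]

theorem siteSwap_apply_of_ne (l : ℕ) (h : l + 1 < L) {k : Fin L} (h1 : k ≠ siteL l h)
    (h2 : k ≠ siteR l h) : siteSwap l h k = k :=
  Equiv.swap_apply_of_ne_of_ne h1 h2

@[simp] theorem siteSwap_siteL (l : ℕ) (h : l + 1 < L) : siteSwap l h (siteL l h) = siteR l h :=
  Equiv.swap_apply_left _ _

@[simp] theorem siteSwap_siteR (l : ℕ) (h : l + 1 < L) : siteSwap l h (siteR l h) = siteL l h :=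
  Equiv.swap_apply_right _ _

@[simp] theorem siteSwap_siteSwap (l : ℕ) (h : l + 1 < L) (k : Fin L) :
    siteSwap l h (siteSwap l h k) = k :=
  Equiv.swap_apply_self _ _ _

theorem comp_siteSwap_siteSwap {α : Type*} (l : ℕ) (h : l + 1 < L) (J : Fin L → α) :
    (J ∘ siteSwap l h) ∘ siteSwap l h = J := by
  funext k; simp

theorem siteL_ne_siteR (l : ℕ) (h : l + 1 < L) : siteL l h ≠ siteR l h := by
  simp [siteL, siteR]

/-- The sign of the graded exchange of neighbouring tensor factors. -/
def swapSign (l : ℕ) (h : l + 1 < L) (J : Fin L → ι) : ℂ :=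
  (-1) ^ (p (J (siteL l h)) * p (J (siteR l h)))

theorem swapSign_mul_self (l : ℕ) (h : l + 1 < L) (J : Fin L → ι) :
    swapSign p l h J * swapSign p l h J = 1 := by
  rw [swapSign, ← pow_add, ← two_mul, pow_mul]; simp

theorem stringSign_siteR (A B : ι) (J : Fin L → ι) (l : ℕ) (h : l + 1 < L) :
    stringSign p A B J (siteR l h) = crossSign p A B (J (siteL l h)) *
      stringSign p A B J (siteL l h) := by
  have : (Finset.univ.filter (· < siteR l h)) =
      insert (siteL l h) (Finset.univ.filter (· < siteL l h)) := by
    ext k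
    simp only [Finset.mem_filter, Finset.mem_univ, true_and, Finset.mem_insert, Fin.lt_def,
      Fin.ext_iff]
    omega
  rw [stringSign, this, Finset.prod_insert (by simp), stringSign]

theorem stringSign_comp_siteSwap (A B : ι) (J : Fin L → ι) (l : ℕ) (h : l + 1 < L) (k : Fin L)
    (hk : k ≠ siteR l h) :
    stringSign p A B (J ∘ siteSwap l h) k = stringSign p A B J k := by
  refine Finset.prod_equiv (siteSwap l h) (fun i => ?_) fun i _ => rfl
  simp only [Finset.mem_filter, Finset.mem_univ, true_and]
  by_cases h1 : i = siteL l h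
  · subst h1
    rw [siteSwap_siteL]
    simp only [ne_eq, Fin.ext_iff, Fin.lt_def] at *
    omega
  by_cases h2 : i = siteR l h
  · subst h2
    rw [siteSwap_siteR]
    simp only [ne_eq, Fin.ext_iff, Fin.lt_def] at *
    omega
  rw [siteSwap_apply_of_ne l h h1 h2]

theorem rootOp_swap (A B : ι) (l : ℕ) (h : l + 1 < L) (v : (Fin L → ι) → M) (J : Fin L → ι) :
    swapSign p l h J • rootOp p A B v (J ∘ siteSwap l h) =
      rootOp p A B (fun I => swapSign p l h I • v (I ∘ siteSwap l h)) J := by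
  rw [rootOp_apply, rootOp_apply, Finset.smul_sum]
  refine Fintype.sum_equiv (siteSwap l h) _ _ fun k => ?_
  simp only [Function.comp_apply]
  have hu : Function.update J (siteSwap l h k) B ∘ siteSwap l h =
      Function.update (J ∘ siteSwap l h) k B := by
    funext i
    by_cases hi : i = k
    · subst hi; simp
    · rw [Function.comp_apply, Function.update_of_ne hi,
        Function.update_of_ne fun e => hi ((siteSwap l h).injective e), Function.comp_apply]
  rw [hu]
  split_ifs with hA
  swap
  · simp
  rw [smul_smul, smul_smul]
  congr 1
  have e1 : ∀ X : ι, crossSign p A B X = (-1) ^ (p A * p X) * (-1) ^ (p B * p X) := fun X => by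
    rw [crossSign, add_mul, pow_add]
  have sq : ∀ Y X : ι, ((-1 : ℂ) ^ (p Y * p X)) * (-1) ^ (p Y * p X) = 1 := fun Y X => by
    rw [← pow_add, ← two_mul, pow_mul]; simp
  by_cases h1 : k = siteL l h
  · subst h1
    rw [siteSwap_siteL] at hA ⊢
    rw [stringSign_comp_siteSwap _ _ _ _ _ _ _ (siteL_ne_siteR l h), stringSign_siteR, swapSign,
      swapSign, Function.update_self, Function.update_of_ne (siteL_ne_siteR l h), hA, e1,
      mul_comm (p (J (siteL l h))), mul_comm (p (J (siteL l h)))]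
    linear_combination (-stringSign p A B J (siteL l h) * (-1) ^ (p A * p (J (siteL l h)))) *
      sq B (J (siteL l h))
  by_cases h2 : k = siteR l h
  · subst h2
    rw [siteSwap_siteR] at hA ⊢
    rw [stringSign_siteR, stringSign_comp_siteSwap _ _ _ _ _ _ _ (siteL_ne_siteR l h), swapSign,
      swapSign, Function.update_self, Function.update_of_ne (siteL_ne_siteR l h).symm, hA, e1,
      Function.comp_apply, siteSwap_siteL]
    linear_combination (stringSign p A B J (siteL l h) * (-1) ^ (p B * p (J (siteR l h)))) *
      sq A (J (siteR l h))
  rw [siteSwap_apply_of_ne l h h1 h2] at hA ⊢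
  rw [stringSign_comp_siteSwap _ _ _ _ _ _ _ h2, mul_comm, swapSign, swapSign,
    Function.update_of_ne (Ne.symm h1), Function.update_of_ne (Ne.symm h2)]

/-- Tensors on which the graded exchange of the sites `l`, `l + 1` agrees with every operator
in `T l` on the coefficients. -/
def superInv (T : ∀ l, l + 1 < L → Set (M →ₗ[ℂ] M)) : Submodule ℂ ((Fin L → ι) → M) where
  carrier := {v | ∀ l h, ∀ t ∈ T l h, ∀ J, swapSign p l h J • v (J ∘ siteSwap l h) = t (v J)}
  zero_mem' := fun l h t _ J => by simp
  add_mem' := fun hv hw l h t ht J => by simp [hv l h t ht J, hw l h t ht J]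
  smul_mem' := fun c v hv l h t ht J => by
    simp only [Pi.smul_apply, map_smul, ← hv l h t ht J]; rw [smul_comm]

variable {p} in
theorem rootOp_mem_superInv {T : ∀ l, l + 1 < L → Set (M →ₗ[ℂ] M)} {v : (Fin L → ι) → M}
    (hv : v ∈ superInv p T) (A B : ι) : rootOp p A B v ∈ superInv p T := by
  intro l h t ht J
  rw [rootOp_swap, ← rootOp_comp_linearMap]
  exact congrArg (fun f => rootOp p A B f J) (funext fun I => hv l h t ht I)

/-- The number of occurrences of a letter in a word. -/
def content (J : Fin L → ι) (A : ι) : ℕ := (Finset.univ.filter fun l => J l = A).card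

/-- Tensors supported on the words with content `w`. -/
def wtSpace (M : Type*) [AddCommGroup M] [Module ℂ M] (L : ℕ) (w : ι → ℕ) :
    Submodule ℂ ((Fin L → ι) → M) where
  carrier := {v | ∀ J, v J ≠ 0 → content J = w}
  zero_mem' := fun J h => absurd rfl h
  add_mem' := fun {v v'} hv hw J h => by
    by_contra hc
    exact h (by rw [Pi.add_apply, not_not.1 (mt (hv J) hc), not_not.1 (mt (hw J) hc), add_zero])
  smul_mem' := fun c v hv J h => hv J fun h0 => h (by rw [Pi.smul_apply, h0, smul_zero])

theorem rootOp_self_apply (A : ι) (v : (Fin L → ι) → M) (J : Fin L → ι) :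
    rootOp p A A v J = (content J A : ℂ) • v J := by
  rw [rootOp_apply, content, Finset.card_eq_sum_ones, Nat.cast_sum, Finset.sum_smul,
    Finset.sum_filter]
  refine Finset.sum_congr rfl fun l _ => ?_
  split_ifs with h
  · rw [← h, Function.update_eq_self]
    have : stringSign p (J l) (J l) J l = 1 :=
      Finset.prod_eq_one fun k _ => by
        rw [crossSign, ← two_mul, mul_assoc, pow_mul]; simp
    simp [this]
  · rfl

theorem mem_wtSpace_iff_rootOp {w : ι → ℕ} {v : (Fin L → ι) → M} :
    v ∈ wtSpace M L w ↔ ∀ A, rootOp p A A v = (w A : ℂ) • v := by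
  constructor
  · intro hv A
    funext J
    rw [rootOp_self_apply, Pi.smul_apply]
    by_cases h : v J = 0
    · simp [h]
    · rw [hv J h]
  · intro hv J hJ
    funext A
    have := congrFun (hv A) J
    rw [rootOp_self_apply, Pi.smul_apply, ← sub_eq_zero, ← sub_smul, smul_eq_zero] at this
    exact_mod_cast sub_eq_zero.1 (this.resolve_right hJ)

theorem rootOp_self_of_mem {w : ι → ℕ} {v : (Fin L → ι) → M} (hv : v ∈ wtSpace M L w) (A : ι) :
    rootOp p A A v = (w A : ℂ) • v := (mem_wtSpace_iff_rootOp p).1 hv A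

theorem content_update (J : Fin L → ι) (l : Fin L) (A B C : ι) (h : J l = A) :
    content (Function.update J l B) C + (if A = C then 1 else 0) =
      content J C + if B = C then 1 else 0 := by
  simp only [content, Finset.card_filter]
  rw [← Finset.add_sum_erase _ _ (Finset.mem_univ l),
    ← Finset.add_sum_erase _ (fun i => if J i = C then 1 else 0) (Finset.mem_univ l),
    Function.update_self, h]
  have : ∑ x ∈ Finset.univ.erase l, (if Function.update J l B x = C then 1 else 0) =
      ∑ x ∈ Finset.univ.erase l, if J x = C then 1 else 0 :=
    Finset.sum_congr rfl fun x hx => by rw [Function.update_of_ne (Finset.ne_of_mem_erase hx)]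
  rw [this]; ring

theorem rootOp_mem_wtSpace {w w' : ι → ℕ} {v : (Fin L → ι) → M} (hv : v ∈ wtSpace M L w) {A B : ι}
    (hw : w' + Pi.single B 1 = w + Pi.single A 1) : rootOp p A B v ∈ wtSpace M L w' := by
  intro J hJ
  rw [rootOp_apply] at hJ
  obtain ⟨l, -, hl⟩ := Finset.exists_ne_zero_of_sum_ne_zero hJ
  split_ifs at hl with hA
  · have h2 := hv _ fun h0 => hl (by rw [h0, smul_zero])
    funext C
    have h3 := content_update J l A B C hA
    have h4 := congrFun hw C
    simp only [Pi.add_apply, Pi.single_apply, eq_comm (a := C)] at h4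
    rw [congrFun h2 C] at h3
    omega
  · exact absurd rfl hl

theorem rootOp_eq_zero_of_not_mem {w : ι → ℕ} {v : (Fin L → ι) → M} (hv : v ∈ wtSpace M L w)
    {A B : ι} (hw : w B = 0) : A ≠ B → rootOp p A B v = 0 := by
  intro hAB
  funext J
  rw [rootOp_apply]
  refine Finset.sum_eq_zero fun l _ => ?_
  split_ifs with hA
  · by_cases h0 : v (Function.update J l B) = 0
    · rw [h0, smul_zero]
    · have h2 := congrFun (hv _ h0) B
      have h3 := content_update J l A B B hA
      simp only [hAB, if_false, if_true] at h3
      omega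
  · rfl

/-- Tensors annihilated by `E_{AB}` for all `(A, B)` in the positive system `S`. -/
def singSpace (M : Type*) [AddCommGroup M] [Module ℂ M] (L : ℕ) (S : ι → ι → Prop) :
    Submodule ℂ ((Fin L → ι) → M) where
  carrier := {v | ∀ A B, S A B → rootOp p A B v = 0}
  zero_mem' := fun A B _ => map_zero _
  add_mem' := fun hv hw A B h => by rw [map_add, hv A B h, hw A B h, add_zero]
  smul_mem' := fun c v hv A B h => by rw [map_smul, hv A B h, smul_zero]

/-- Invariant highest-weight vectors of weight `w` for the positive system `S`. -/
def hwSpace (T : ∀ l, l + 1 < L → Set (M →ₗ[ℂ] M)) (S : ι → ι → Prop) (w : ι → ℕ) :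
    Submodule ℂ ((Fin L → ι) → M) :=
  superInv p T ⊓ wtSpace M L w ⊓ singSpace p M L S

end Invariants

section OddReflection

variable {ι : Type*} [DecidableEq ι] (p : ι → ℕ) {L : ℕ} {M : Type*} [AddCommGroup M] [Module ℂ M]
  (T : ∀ l, l + 1 < L → Set (M →ₗ[ℂ] M))

/-- Two positive systems which differ by the reflection in the odd simple root `(A, B)`. -/
structure IsOddReflection (S S' : ι → ι → Prop) (A B : ι) : Prop where
  odd : Odd (p A + p B)
  ne : A ≠ B
  mem : S A B
  iff_of_ne : ∀ C D, (C, D) ≠ (A, B) → (C, D) ≠ (B, A) → (S C D ↔ S' C D)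
  not_mem : ¬ S B A
  mem' : S' B A
  not_mem' : ¬ S' A B
  left : ∀ C, C ≠ A → C ≠ B → (S C B ↔ S C A)
  right : ∀ D, D ≠ A → D ≠ B → (S A D ↔ S B D)
  irrefl : ∀ C, ¬ S C C

variable {p} in
theorem IsOddReflection.symm {S S' : ι → ι → Prop} {A B : ι} (h : IsOddReflection p S S' A B) :
    IsOddReflection p S' S B A where
  odd := by rw [add_comm]; exact h.odd
  ne := h.ne.symm
  mem := h.mem'
  iff_of_ne C D h1 h2 := (h.iff_of_ne C D h2 h1).symm
  not_mem := h.not_mem'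
  mem' := h.mem
  not_mem' := h.not_mem
  left C h1 h2 := by
    have := h.left C h2 h1
    have h3 := h.iff_of_ne C A (by simp [h.ne]) (by simp [h1])
    have h4 := h.iff_of_ne C B (by simp [h2]) (by simp [h.ne.symm])
    tauto
  right D h1 h2 := by
    have := h.right D h2 h1
    have h3 := h.iff_of_ne A D (by simp [h1]) (by simp [h.ne])
    have h4 := h.iff_of_ne B D (by simp [h.ne.symm]) (by simp [h2])
    tauto
  irrefl C hC := by
    refine h.irrefl C ((h.iff_of_ne C C ?_ ?_).2 hC)
    · simp only [ne_eq, Prod.mk.injEq, not_and]; rintro rfl; exact h.ne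
    · simp only [ne_eq, Prod.mk.injEq, not_and]; rintro rfl; exact h.ne.symm

theorem commSign_odd {A B C D : ι} (h : Odd (p A + p B)) (h' : Odd (p C + p D)) :
    commSign p A B C D = -1 := (h.mul h').neg_one_pow

variable {p} in
theorem IsOddReflection.rootOp_mem {S S' : ι → ι → Prop} {A B : ι}
    (h : IsOddReflection p S S' A B) {w w' : ι → ℕ}
    (hw : w' + Pi.single A 1 = w + Pi.single B 1) {v : (Fin L → ι) → M}
    (hv : v ∈ hwSpace p T S w) : rootOp p B A v ∈ hwSpace p T S' w' := by
  refine ⟨⟨rootOp_mem_superInv hv.1.1 _ _, rootOp_mem_wtSpace p hv.1.2 hw⟩, fun C D hCD => ?_⟩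
  by_cases hBA : C = B ∧ D = A
  · obtain ⟨rfl, rfl⟩ := hBA
    have h1 := rootOp_commutator p C D C D v
    rw [commSign_odd p (by rw [add_comm]; exact h.odd) (by rw [add_comm]; exact h.odd),
      if_neg h.ne, smul_zero, sub_zero, add_zero, neg_one_smul, eq_neg_iff_add_eq_zero,
      ← two_smul ℂ, smul_eq_zero] at h1
    exact h1.resolve_left two_ne_zero
  · have hAB : ¬ (C = A ∧ D = B) := by rintro ⟨rfl, rfl⟩; exact h.not_mem' hCD
    have hS : S C D := (h.iff_of_ne C D (by simpa using hAB) (by simpa using hBA)).2 hCD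
    rw [rootOp_commutator, hv.2 C D hS, map_zero, smul_zero, zero_add]
    by_cases hD : D = B
    · subst hD
      have hCA : C ≠ A := fun e => hAB ⟨e, rfl⟩
      have hCD : C ≠ D := by rintro rfl; exact h.irrefl _ hS
      rw [if_pos rfl, if_neg hCA.symm, smul_zero, sub_zero]
      exact hv.2 C A ((h.left C hCA hCD).1 hS)
    · rw [if_neg hD]
      split_ifs with hC
      · subst hC
        have hDA : D ≠ A := by rintro rfl; exact h.irrefl _ hS
        rw [hv.2 B D ((h.right D hDA hD).1 hS), smul_zero, sub_zero]
      · simp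

variable {p} in
theorem IsOddReflection.rootOp_rootOp {S S' : ι → ι → Prop} {A B : ι}
    (h : IsOddReflection p S S' A B) {w : ι → ℕ} {v : (Fin L → ι) → M}
    (hv : v ∈ hwSpace p T S w) : rootOp p A B (rootOp p B A v) = ((w A + w B : ℕ) : ℂ) • v := by
  rw [rootOp_commutator, hv.2 A B h.mem, map_zero, smul_zero, zero_add, if_pos rfl, if_pos rfl,
    rootOp_self_of_mem p hv.1.2, rootOp_self_of_mem p hv.1.2,
    commSign_odd p h.odd (by rw [add_comm]; exact h.odd)]
  push_cast
  rw [add_smul]; simp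

variable {p} in
/-- Odd reflections preserve the dimensions of the spaces of highest-weight vectors. -/
theorem IsOddReflection.finrank_eq {S S' : ι → ι → Prop} {A B : ι}
    (h : IsOddReflection p S S' A B) {w w' : ι → ℕ}
    (hw : w' + Pi.single A 1 = w + Pi.single B 1) :
    Module.finrank ℂ (hwSpace p T S w) = Module.finrank ℂ (hwSpace p T S' w') := by
  have hne : ((w A + w B : ℕ) : ℂ) ≠ 0 := by
    have := congrFun hw A
    simp only [Pi.add_apply, Pi.single_eq_same, Pi.single_apply, h.ne, if_false] at this
    exact_mod_cast (by omega : w A + w B ≠ 0)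
  have hs : w' A + w' B = w A + w B := by
    have h1 := congrFun hw A
    have h2 := congrFun hw B
    simp only [Pi.add_apply, Pi.single_eq_same, Pi.single_apply, h.ne, h.ne.symm, if_false] at h1 h2
    omega
  refine LinearEquiv.finrank_eq (LinearEquiv.ofLinearMap
    ((rootOp p B A).restrict fun v hv => h.rootOp_mem T hw hv)
    (((w A + w B : ℕ) : ℂ)⁻¹ • (rootOp p A B).restrict
      fun v hv => h.symm.rootOp_mem T (w := w') (w' := w) hw.symm hv) ?_ ?_)
  · ext1 ⟨v, hv⟩
    apply Subtype.ext
    have := h.symm.rootOp_rootOp T hv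
    simp only [LinearMap.comp_apply, LinearMap.smul_apply, map_smul, LinearMap.id_apply]
    rw [Submodule.coe_smul, LinearMap.coe_restrict_apply, LinearMap.coe_restrict_apply, this,
      smul_smul, add_comm (w' B), hs, inv_mul_cancel₀ hne, one_smul]
  · ext1 ⟨v, hv⟩
    apply Subtype.ext
    have := h.rootOp_rootOp T hv
    simp only [LinearMap.comp_apply, LinearMap.smul_apply, LinearMap.id_apply]
    rw [Submodule.coe_smul, LinearMap.coe_restrict_apply, LinearMap.coe_restrict_apply, this,
      smul_smul, inv_mul_cancel₀ hne, one_smul]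

variable {p} in
theorem IsOddReflection.hwSpace_eq_of_eq_zero {S S' : ι → ι → Prop} {A B : ι}
    (h : IsOddReflection p S S' A B) {w : ι → ℕ} (hA : w A = 0) (hB : w B = 0) :
    hwSpace p T S w = hwSpace p T S' w := by
  have key : ∀ v ∈ wtSpace M L w, v ∈ singSpace p M L S ↔ v ∈ singSpace p M L S' := by
    intro v hv
    refine forall₂_congr fun C D => ?_
    by_cases h1 : (C, D) = (A, B)
    · obtain ⟨rfl, rfl⟩ := Prod.mk.inj h1
      simp [rootOp_eq_zero_of_not_mem p hv hB h.ne]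
    by_cases h2 : (C, D) = (B, A)
    · obtain ⟨rfl, rfl⟩ := Prod.mk.inj h2
      simp [rootOp_eq_zero_of_not_mem p hv hA h.ne.symm]
    rw [h.iff_of_ne C D h1 h2]
  ext v
  constructor
  · rintro ⟨⟨h1, h2⟩, h3⟩; exact ⟨⟨h1, h2⟩, (key v h2).1 h3⟩
  · rintro ⟨⟨h1, h2⟩, h3⟩; exact ⟨⟨h1, h2⟩, (key v h2).2 h3⟩

end OddReflection

section Embedding

variable {ι ι' : Type*} [DecidableEq ι] [DecidableEq ι'] (p : ι → ℕ) (p' : ι' → ℕ) {L : ℕ}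
  {M : Type*} [AddCommGroup M] [Module ℂ M] (T : ∀ l, l + 1 < L → Set (M →ₗ[ℂ] M)) (f : ι → ι')

/-- Restriction of a tensor to the words in a smaller alphabet. -/
def restrictWords (M : Type*) [AddCommGroup M] [Module ℂ M] (L : ℕ) (f : ι → ι') :
    ((Fin L → ι') → M) →ₗ[ℂ] ((Fin L → ι) → M) :=
  LinearMap.funLeft ℂ M fun J => f ∘ J

variable {p p' f}

theorem restrictWords_rootOp (hf : f.Injective) (hp : ∀ A, p' (f A) = p A) (A B : ι)
    (v : (Fin L → ι') → M) :
    restrictWords M L f (rootOp p' (f A) (f B) v) = rootOp p A B (restrictWords M L f v) := by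
  funext J
  simp only [restrictWords, LinearMap.funLeft_apply, rootOp_apply, Function.comp_apply, hf.eq_iff]
  refine Finset.sum_congr rfl fun l _ => ?_
  split_ifs
  · congr 1
    · simp [stringSign, crossSign, hp]
    · rw [Function.comp_update]
  · rfl

theorem content_comp (hf : f.Injective) (J : Fin L → ι) (A : ι) :
    content (f ∘ J) (f A) = content J A := by
  simp [content, hf.eq_iff]

theorem content_comp_of_notMem {C : ι'} (hC : C ∉ Set.range f) (J : Fin L → ι) :
    content (f ∘ J) C = 0 := by
  rw [content, Finset.card_eq_zero, Finset.filter_eq_empty_iff]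
  exact fun l _ e => hC ⟨J l, e⟩

theorem exists_word_of_content {w' : ι' → ℕ} (hw0 : ∀ C, C ∉ Set.range f → w' C = 0)
    {J' : Fin L → ι'} (h : content J' = w') : ∃ J : Fin L → ι, J' = f ∘ J := by
  have : ∀ l, J' l ∈ Set.range f := by
    intro l
    by_contra hl
    have h0 := hw0 _ hl
    rw [← h, content, Finset.card_eq_zero, Finset.filter_eq_empty_iff] at h0
    exact h0 (Finset.mem_univ l) rfl
  choose J hJ using this
  exact ⟨J, funext fun l => (hJ l).symm⟩

/-- Letters which do not occur in the weight and come last do not affect the dimension of the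
space of highest-weight vectors. -/
theorem finrank_hwSpace_of_embedding (hf : f.Injective) (hp : ∀ A, p' (f A) = p A)
    {S : ι → ι → Prop} {S' : ι' → ι' → Prop} (hS : ∀ A B, S' (f A) (f B) ↔ S A B)
    (hS' : ∀ C, C ∉ Set.range f → ∀ B, ¬ S' C (f B)) (hirr : ∀ C, ¬ S' C C)
    {w : ι → ℕ} {w' : ι' → ℕ} (hw : ∀ A, w' (f A) = w A)
    (hw0 : ∀ C, C ∉ Set.range f → w' C = 0) :
    Module.finrank ℂ (hwSpace p T S w) = Module.finrank ℂ (hwSpace p' T S' w') := by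
  have hzero : ∀ v ∈ wtSpace M L w', ∀ J', (¬ ∃ J : Fin L → ι, J' = f ∘ J) → v J' = 0 := by
    intro v hv J' hJ'
    by_contra h0
    exact hJ' (exists_word_of_content hw0 (hv J' h0))
  have hcontent : ∀ J : Fin L → ι, content (f ∘ J) = w' ↔ content J = w := by
    intro J
    constructor
    · intro h; funext A; rw [← content_comp hf, h, hw]
    · intro h; funext C
      by_cases hC : C ∈ Set.range f
      · obtain ⟨A, rfl⟩ := hC; rw [content_comp hf, h, hw]
      · rw [content_comp_of_notMem hC, hw0 C hC]
  have hinj : Function.Injective fun J : Fin L → ι => f ∘ J := hf.comp_left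
  have key : ∀ v ∈ wtSpace M L w', (v ∈ hwSpace p' T S' w' ↔
      restrictWords M L f v ∈ hwSpace p T S w) := by
    intro v hv
    constructor
    · rintro ⟨⟨h1, h2⟩, h3⟩
      refine ⟨⟨fun l h t ht J => ?_, fun J hJ => (hcontent J).1 (h2 _ hJ)⟩, fun A B hAB => ?_⟩
      · have := h1 l h t ht (f ∘ J)
        simpa [swapSign, hp, restrictWords, LinearMap.funLeft_apply, Function.comp_assoc] using this
      · rw [← restrictWords_rootOp hf hp, h3 _ _ ((hS A B).2 hAB), map_zero]
    · rintro ⟨⟨h1, h2⟩, h3⟩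
      refine ⟨⟨fun l h t ht J' => ?_, hv⟩, fun C D hCD => ?_⟩
      · by_cases hJ : ∃ J : Fin L → ι, J' = f ∘ J
        · obtain ⟨J, rfl⟩ := hJ
          have := h1 l h t ht J
          simpa [swapSign, hp, restrictWords, LinearMap.funLeft_apply, Function.comp_assoc]
            using this
        · rw [hzero v hv J' hJ, hzero v hv (J' ∘ siteSwap l h), map_zero, smul_zero]
          rintro ⟨J, e⟩
          exact hJ ⟨J ∘ siteSwap l h, by
            rw [← Function.comp_assoc, ← e, comp_siteSwap_siteSwap]⟩
      · by_cases hD : D ∈ Set.range f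
        swap
        · refine rootOp_eq_zero_of_not_mem p' hv (hw0 D hD) ?_
          rintro rfl
          exact hirr _ hCD
        obtain ⟨B, rfl⟩ := hD
        by_cases hC : C ∈ Set.range f
        swap
        · exact absurd hCD (hS' C hC B)
        obtain ⟨A, rfl⟩ := hC
        funext J'
        by_cases hJ : ∃ J : Fin L → ι, J' = f ∘ J
        · obtain ⟨J, rfl⟩ := hJ
          have := congrFun (h3 A B ((hS A B).1 hCD)) J
          rw [← restrictWords_rootOp hf hp] at this
          exact this
        · rw [rootOp_apply]
          refine Finset.sum_eq_zero fun l _ => ?_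
          split_ifs with hA
          · rw [hzero v hv, smul_zero]
            rintro ⟨J, e⟩
            refine hJ ⟨Function.update J l A, ?_⟩
            rw [Function.comp_update, ← e, ← hA, Function.update_idem, Function.update_eq_self]
          · rfl
  symm
  refine LinearEquiv.finrank_eq (LinearEquiv.ofBijective
    ((restrictWords M L f).restrict (p := hwSpace p' T S' w') (q := hwSpace p T S w)
      fun v hv => (key v hv.1.2).1 hv) ⟨?_, ?_⟩)
  · rw [injective_iff_map_eq_zero]
    rintro ⟨v, hv⟩ h0
    apply Subtype.ext
    funext J'
    by_cases hJ : ∃ J : Fin L → ι, J' = f ∘ J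
    · obtain ⟨J, rfl⟩ := hJ
      exact congrFun (congrArg Subtype.val h0) J
    · exact hzero v hv.1.2 J' hJ
  · rintro ⟨v, hv⟩
    have hres : restrictWords M L f (Function.extend (fun J : Fin L → ι => f ∘ J) v 0) = v :=
      funext fun J => hinj.extend_apply v 0 J
    have hwt : Function.extend (fun J : Fin L → ι => f ∘ J) v 0 ∈ wtSpace M L w' := by
      intro J' hJ'
      by_cases hJ : ∃ J : Fin L → ι, f ∘ J = J'
      · obtain ⟨J, rfl⟩ := hJ
        rw [hinj.extend_apply v 0 J] at hJ'
        exact (hcontent J).2 (hv.1.2 J hJ')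
      · rw [Function.extend_apply' _ _ _ hJ] at hJ'
        exact absurd rfl hJ'
    refine ⟨⟨_, (key _ hwt).2 (by rwa [hres])⟩, Subtype.ext hres⟩

end Embedding

section ReflectionPath

variable (N n : ℕ)

/-- The position of a letter in the order `1 < … < k < 1̂ < … < ĵ < k + 1 < (j + 1)^ < … < n̂ <
k + 2 < …`, with letters numbered from `1`. -/
def pathRank (k j : ℕ) : Idx N n → ℕ :=
  Sum.elim (fun a => if (a : ℕ) < k then a else if (a : ℕ) = k then N + 2 * j + 1
    else N + 2 * n + 2 + a) fun i => N + 2 * i + 2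

/-- The highest weight for the order `pathRank`. -/
def pathWeight (μ : YoungDiagram) (k j : ℕ) : Idx N n → ℕ :=
  Sum.elim (fun a => if (a : ℕ) < k then μ.rowLen a else if (a : ℕ) = k then μ.rowLen k - j else 0)
    fun i => if (i : ℕ) < j then μ.colLen i - k else μ.colLen i - (k + 1)

variable {N n}

theorem isOddReflection_path {k j : ℕ} (hk : k < N) (hj : j < n) :
    IsOddReflection (parity (m := N) (n := n))
      (fun A B => pathRank N n k (j + 1) A < pathRank N n k (j + 1) B)
      (fun A B => pathRank N n k j A < pathRank N n k j B) (Sum.inr ⟨j, hj⟩) (Sum.inl ⟨k, hk⟩) := by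
  constructor
  · simp [parity]
  · simp
  · simp [pathRank]; omega
  · rintro (a | a) (b | b) h1 h2 <;>
      simp only [pathRank, Sum.elim_inl, Sum.elim_inr, ne_eq, Prod.mk.injEq, Sum.inr.injEq,
        Sum.inl.injEq, Fin.ext_iff, reduceCtorEq, false_and, and_false, not_false_eq_true] at * <;>
      split_ifs <;> omega
  · simp [pathRank]
  · simp [pathRank]
  · simp [pathRank]
  · rintro (a | a) h1 h2 <;>
      simp only [pathRank, Sum.elim_inl, Sum.elim_inr, ne_eq, Sum.inr.injEq,
        Sum.inl.injEq, Fin.ext_iff, reduceCtorEq, not_false_eq_true] at * <;>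
      split_ifs <;> omega
  · rintro (a | a) h1 h2 <;>
      simp only [pathRank, Sum.elim_inl, Sum.elim_inr, ne_eq, Sum.inr.injEq,
        Sum.inl.injEq, Fin.ext_iff, reduceCtorEq, not_false_eq_true] at * <;>
      split_ifs <;> omega
  · simp

theorem lt_colLen_iff_lt_rowLen (μ : YoungDiagram) (i j : ℕ) : i < μ.colLen j ↔ j < μ.rowLen i := by
  rw [← YoungDiagram.mem_iff_lt_colLen, YoungDiagram.mem_iff_lt_rowLen]

variable {L : ℕ} {M : Type*} [AddCommGroup M] [Module ℂ M]
  (T : ∀ l, l + 1 < L → Set (M →ₗ[ℂ] M)) (μ : YoungDiagram)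

/-- The dimension of the space of highest-weight vectors for the order `pathRank`. -/
noncomputable def pathDim (N n k j : ℕ) : ℕ :=
  Module.finrank ℂ (hwSpace (parity (m := N) (n := n)) T
    (fun A B => pathRank N n k j A < pathRank N n k j B) (pathWeight N n μ k j))

theorem pathDim_succ_eq {k j : ℕ} (hk : k < N) (hj : j < n) :
    pathDim T μ N n k (j + 1) = pathDim T μ N n k j := by
  have hb := lt_colLen_iff_lt_rowLen μ k j
  by_cases h : k < μ.colLen j
  · refine (isOddReflection_path hk hj).finrank_eq T ?_
    funext X
    rcases X with a | i <;>
      simp only [pathWeight, Pi.add_apply, Pi.single_apply, Sum.elim_inl, Sum.elim_inr,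
      reduceCtorEq,
        Sum.inr.injEq, Sum.inl.injEq, Fin.ext_iff, if_false]
    · by_cases ha : (a : ℕ) = k
      · simp only [ha, lt_irrefl, if_true, if_false]; omega
      · simp [ha]
    · by_cases ha : (i : ℕ) = j
      · simp only [ha, lt_irrefl, if_true, if_false, Nat.lt_succ_self]; omega
      · have : ((i : ℕ) < j + 1) ↔ ((i : ℕ) < j) := by omega
        simp [ha, this]
  · have hw : pathWeight N n μ k (j + 1) = pathWeight N n μ k j := by
      funext X
      rcases X with a | i <;> simp only [pathWeight, Sum.elim_inl, Sum.elim_inr]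
      · split_ifs <;> omega
      · by_cases ha : (i : ℕ) = j
        · simp only [ha, lt_irrefl, if_false, Nat.lt_succ_self, if_true]; omega
        · have : ((i : ℕ) < j + 1) ↔ ((i : ℕ) < j) := by omega
          simp [this]
    rw [pathDim, pathDim, (isOddReflection_path hk hj).hwSpace_eq_of_eq_zero T, hw]
    · simp [pathWeight]; omega
    · simp [pathWeight]; omega

theorem pathDim_row {k m : ℕ} (hmk : m ≤ k) (hk : k < N) (hn : μ.rowLen m ≤ n) :
    pathDim T μ N n k n = pathDim T μ N n (k + 1) n := by
  have h1 : ∀ j ≤ n, pathDim T μ N n k j = pathDim T μ N n k 0 := by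
    intro j
    induction j with
    | zero => intro _; rfl
    | succ j ih => intro hj; rw [pathDim_succ_eq T μ hk (by omega), ih (by omega)]
  have hr := (μ.rowLen_anti m (k + 1) (by omega)).trans hn
  rw [h1 n le_rfl, pathDim, pathDim]
  have hw : pathWeight N n μ k 0 = pathWeight N n μ (k + 1) n := by
    funext X
    rcases X with a | i <;> simp only [pathWeight, Sum.elim_inl, Sum.elim_inr]
    · by_cases ha : (a : ℕ) = k
      · simp [ha]
      · split_ifs <;> omega
    · simp
  have hS : (fun A B => pathRank N n k 0 A < pathRank N n k 0 B) =
      fun A B => pathRank N n (k + 1) n A < pathRank N n (k + 1) n B := by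
    funext A B
    rcases A with a | a <;> rcases B with b | b <;> rw [eq_iff_iff] <;>
      simp only [pathRank, Sum.elim_inl, Sum.elim_inr] <;> split_ifs <;> omega
  rw [hw, hS]

theorem pathDim_eq {m : ℕ} (hm : m ≤ N) (hn : μ.rowLen m ≤ n) :
    pathDim T μ N n m n = pathDim T μ N n N n := by
  have : ∀ d, m + d ≤ N → pathDim T μ N n m n = pathDim T μ N n (m + d) n := by
    intro d
    induction d with
    | zero => intro _; rfl
    | succ d ih => intro hd; rw [ih (by omega), ← add_assoc,
        pathDim_row T μ (m := m) (by omega) (by omega) hn]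
  have := this (N - m) (by omega)
  rwa [Nat.add_sub_cancel' hm] at this

/-- Highest-weight vectors of `gl(m|n)` correspond to highest-weight vectors of `gl(N)` with the
same Young diagram. -/
theorem finrank_hwSpace_super {m : ℕ} (hm : m ≤ N) (hN : μ.colLen 0 ≤ N) (hn : μ.rowLen m ≤ n) :
    Module.finrank ℂ (hwSpace (parity (m := m) (n := n)) T (fun A B => toLex A < toLex B)
      (Sum.elim (weightBos m μ) (weightFer m n μ))) =
    Module.finrank ℂ (hwSpace (fun _ : Fin N => 0) T (· < ·) fun a => μ.rowLen a) := by
  trans pathDim T μ N n m n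
  · refine finrank_hwSpace_of_embedding T
      (f := Sum.map (Fin.castLE hm) id) ?_ ?_ ?_ ?_ (by simp) ?_ ?_
    · exact (Fin.castLE_injective hm).sumMap Function.injective_id
    · rintro (a | a) <;> simp [parity]
    · rintro (a | a) (b | b) <;> simp [pathRank, Sum.Lex.toLex_lt_toLex] <;> omega
    · rintro (a | a) hC (b | b)
      · have : m ≤ a := by
          by_contra h
          exact hC ⟨Sum.inl ⟨a, by omega⟩, rfl⟩
        simp only [pathRank, Sum.map_inl, Sum.elim_inl, Fin.val_castLE]
        split_ifs <;> omega
      · have : m ≤ a := by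
          by_contra h
          exact hC ⟨Sum.inl ⟨a, by omega⟩, rfl⟩
        simp only [pathRank, Sum.map_inr, Sum.elim_inl, Sum.elim_inr, id]
        split_ifs <;> omega
      · exact absurd ⟨Sum.inr a, rfl⟩ hC
      · exact absurd ⟨Sum.inr a, rfl⟩ hC
    · rintro (a | a) <;> simp [pathWeight, weightBos, weightFer]
    · rintro (a | a) hC
      · have : m ≤ a := by
          by_contra h
          exact hC ⟨Sum.inl ⟨a, by omega⟩, rfl⟩
        simp only [pathWeight, Sum.elim_inl]
        split_ifs <;> omega
      · exact absurd ⟨Sum.inr a, rfl⟩ hC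
  rw [pathDim_eq T μ hm hn]
  symm
  refine finrank_hwSpace_of_embedding T (f := Sum.inl) Sum.inl_injective ?_ ?_ ?_ (by simp) ?_ ?_
  · simp [parity]
  · intro a b; simp [pathRank]
  · rintro (a | a) hC b
    · exact absurd ⟨a, rfl⟩ hC
    · simp [pathRank]; omega
  · intro a; simp [pathWeight]
  · rintro (a | a) hC
    · exact absurd ⟨a, rfl⟩ hC
    · have := μ.colLen_anti 0 a (Nat.zero_le _)
      simp [pathWeight]; omega

end ReflectionPath

section GeneralizedEigenspaces

variable {K V : Type*} [Field K] [AddCommGroup V] [Module K V] [FiniteDimensional K V]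

theorem trace_restrict_of_le_maxGenEigenspace (F : Module.End K V) (W : Submodule K V) (c : K)
    (hW : ∀ v ∈ W, F v ∈ W) (hc : W ≤ F.maxGenEigenspace c) :
    LinearMap.trace K W (F.restrict hW) = c * (Module.finrank K W : K) := by
  let f : Module.End K W := F.restrict hW
  have h3 : ∀ k : ℕ, ∀ w : W, (((f - c • 1) ^ k) w : V) = ((F - c • 1) ^ k) (w : V) := by
    intro k
    induction k with
    | zero => intro w; rfl
    | succ k ih =>
      intro w
      rw [pow_succ, pow_succ, Module.End.mul_apply, Module.End.mul_apply, ih]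
      rfl
  have h2 : IsNilpotent (f - c • 1) := by
    refine ⟨Module.finrank K V, ?_⟩
    ext1 w
    apply Subtype.ext
    rw [h3]
    have h4 := hc w.2
    rw [Module.End.maxGenEigenspace_eq_genEigenspace_finrank,
      Module.End.mem_genEigenspace_nat] at h4
    exact h4
  have h5 : LinearMap.trace K W (f - c • 1) = 0 :=
    (LinearMap.isNilpotent_trace_of_isNilpotent h2).eq_zero
  rw [map_sub, map_smul, LinearMap.trace_one, sub_eq_zero] at h5
  exact h5

theorem finrank_eq_sum_inf_maxGenEigenspace [IsAlgClosed K] (F : Module.End K V) (W : Submodule K V)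
    (hW : ∀ v ∈ W, F v ∈ W) (s : Finset K) (hs : ∀ c, F.maxGenEigenspace c ≠ ⊥ → c ∈ s)
    [CharZero K] :
    Module.finrank K W = ∑ c ∈ s, Module.finrank K ↥(W ⊓ F.maxGenEigenspace c) := by
  classical
  let f : Module.End K W := F.restrict hW
  have hint : DirectSum.IsInternal f.maxGenEigenspace :=
    DirectSum.isInternal_submodule_of_iSupIndep_of_iSup_eq_top f.independent_maxGenEigenspace
      (Module.End.iSup_maxGenEigenspace_eq_top f)
  have hmap : ∀ c, (f.maxGenEigenspace c).map W.subtype = W ⊓ F.maxGenEigenspace c := by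
    intro c
    rw [Module.End.maxGenEigenspace, Module.End.genEigenspace_restrict,
      Submodule.map_comap_subtype]
  have hfin : ∀ c, Module.finrank K (f.maxGenEigenspace c) =
      Module.finrank K ↥(W ⊓ F.maxGenEigenspace c) := by
    intro c
    rw [← hmap, Submodule.finrank_map_subtype_eq]
  have hsub : ∀ c, f.maxGenEigenspace c ≠ ⊥ → c ∈ s := by
    intro c hc
    refine hs c fun h0 => hc ?_
    have := hmap c
    rw [h0, inf_bot_eq] at this
    exact Submodule.map_injective_of_injective (Submodule.injective_subtype _)
      (this.trans (Submodule.map_bot _).symm)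
  have hne : {c | f.maxGenEigenspace c ≠ ⊥}.Finite := s.finite_toSet.subset fun c hc => hsub c hc
  have htr := LinearMap.trace_eq_sum_trace_restrict' hint hne (f := LinearMap.id)
    fun c => fun x hx => hx
  rw [LinearMap.trace_id] at htr
  have h1 : ∀ c, LinearMap.trace K (f.maxGenEigenspace c)
      ((LinearMap.id : Module.End K W).restrict fun x hx => hx) =
      (Module.finrank K ↥(W ⊓ F.maxGenEigenspace c) : K) := by
    intro c
    rw [← hfin]
    exact LinearMap.trace_id K (f.maxGenEigenspace c)
  rw [Finset.sum_congr rfl fun c _ => h1 c] at htr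
  have h2 : ∑ c ∈ hne.toFinset, (Module.finrank K ↥(W ⊓ F.maxGenEigenspace c) : K) =
      ∑ c ∈ s, (Module.finrank K ↥(W ⊓ F.maxGenEigenspace c) : K) := by
    refine Finset.sum_subset (fun c hc => hsub c (by simpa using hc)) fun c _ hc => ?_
    have : f.maxGenEigenspace c = ⊥ := by simpa using hc
    rw [← hfin, this, finrank_bot, Nat.cast_zero]
  rw [h2] at htr
  exact_mod_cast htr

end GeneralizedEigenspaces

section Casimir

variable {N L : ℕ} {M : Type*} [AddCommGroup M] [Module ℂ M]

/-- The generator `E_{AB}` of `gl(N)` as an endomorphism. -/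
noncomputable def glOp (M : Type*) [AddCommGroup M] [Module ℂ M] (L : ℕ) (A B : Fin N) :
    Module.End ℂ ((Fin L → Fin N) → M) :=
  rootOp (fun _ => 0) A B

theorem glOp_mul (A B C D : Fin N) :
    glOp M L A B * glOp M L C D = glOp M L C D * glOp M L A B +
      ((if B = C then glOp M L A D else 0) - if D = A then glOp M L C B else 0) := by
  refine LinearMap.ext fun v => ?_
  have := rootOp_commutator (fun _ : Fin N => 0) A B C D v
  simp only [commSign, add_zero, mul_zero, pow_zero, one_smul] at this
  simp only [Module.End.mul_apply, LinearMap.add_apply, LinearMap.sub_apply, glOp]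
  rw [this]
  split_ifs <;> simp

/-- The quadratic Casimir operator `∑ E_{AB} E_{BA}`. -/
noncomputable def casimir (M : Type*) [AddCommGroup M] [Module ℂ M] (L N : ℕ) :
    Module.End ℂ ((Fin L → Fin N) → M) :=
  ∑ A, ∑ B, glOp M L A B * glOp M L B A

theorem casimir_commute (C D : Fin N) : Commute (casimir M L N) (glOp M L C D) := by
  have h : ∀ A B : Fin N, glOp M L A B * glOp M L B A * glOp M L C D =
      glOp M L C D * (glOp M L A B * glOp M L B A) +
        (((if B = C then glOp M L A D * glOp M L B A else 0) -
          if D = A then glOp M L C B * glOp M L B A else 0) +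
        ((if A = C then glOp M L A B * glOp M L B D else 0) -
          if D = B then glOp M L A B * glOp M L C A else 0)) := by
    intro A B
    rw [mul_assoc, glOp_mul B A C D, mul_add, ← mul_assoc, glOp_mul A B C D, add_mul, sub_mul,
      mul_sub, mul_assoc]
    simp only [ite_mul, zero_mul, mul_ite, mul_zero]
    abel
  rw [Commute, SemiconjBy, casimir, Finset.sum_mul, Finset.mul_sum]
  simp only [Finset.sum_mul, Finset.mul_sum, h, Finset.sum_add_distrib, Finset.sum_sub_distrib]
  simp

/-- The invariant tensors of weight `κ`. -/
def invWt (T : ∀ l, l + 1 < L → Set (M →ₗ[ℂ] M)) (κ : Fin N → ℕ) :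
    Submodule ℂ ((Fin L → Fin N) → M) :=
  superInv (fun _ => 0) T ⊓ wtSpace M L κ

/-- The invariant tensors of weight `κ` in a generalized eigenspace of the Casimir operator. -/
noncomputable def eigWt (T : ∀ l, l + 1 < L → Set (M →ₗ[ℂ] M)) (c : ℂ) (κ : Fin N → ℕ) :
    Submodule ℂ ((Fin L → Fin N) → M) :=
  invWt T κ ⊓ (casimir M L N).maxGenEigenspace c

variable {T : ∀ l, l + 1 < L → Set (M →ₗ[ℂ] M)}

theorem glOp_mem_invWt {κ κ' : Fin N → ℕ} {A B : Fin N}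
    (h : κ' + Pi.single B 1 = κ + Pi.single A 1) {v : (Fin L → Fin N) → M} (hv : v ∈ invWt T κ) :
    glOp M L A B v ∈ invWt T κ' :=
  ⟨rootOp_mem_superInv hv.1 _ _, rootOp_mem_wtSpace _ hv.2 h⟩

theorem glOp_mem_eigWt {c : ℂ} {κ κ' : Fin N → ℕ} {A B : Fin N}
    (h : κ' + Pi.single B 1 = κ + Pi.single A 1) {v : (Fin L → Fin N) → M} (hv : v ∈ eigWt T c κ) :
    glOp M L A B v ∈ eigWt T c κ' :=
  ⟨glOp_mem_invWt h hv.1,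
    Module.End.mapsTo_maxGenEigenspace_of_comm (casimir_commute A B) c hv.2⟩

theorem glOp_eq_zero {κ : Fin N → ℕ} {A B : Fin N} (hAB : A ≠ B) (h : κ B = 0)
    {v : (Fin L → Fin N) → M} (hv : v ∈ wtSpace M L κ) : glOp M L A B v = 0 :=
  rootOp_eq_zero_of_not_mem _ hv h hAB

theorem glOp_self {κ : Fin N → ℕ} {A : Fin N} {v : (Fin L → Fin N) → M}
    (hv : v ∈ wtSpace M L κ) : glOp M L A A v = (κ A : ℂ) • v :=
  rootOp_self_of_mem _ hv A

theorem exists_weight_shift {κ : Fin N → ℕ} {A B : Fin N} (hB : κ B ≠ 0) :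
    ∃ κ' : Fin N → ℕ, κ' + Pi.single B 1 = κ + Pi.single A 1 := by
  refine ⟨κ + Pi.single A 1 - Pi.single B 1, ?_⟩
  funext C
  simp only [Pi.add_apply, Pi.sub_apply, Pi.single_apply]
  by_cases h : C = B
  · subst h; simp only [if_true]; split_ifs <;> omega
  · simp [h]

theorem glOp_glOp_mem_invWt {κ : Fin N → ℕ} (A B : Fin N) {v : (Fin L → Fin N) → M}
    (hv : v ∈ invWt T κ) : glOp M L A B (glOp M L B A v) ∈ invWt T κ := by
  by_cases hAB : A = B
  · subst hAB
    exact glOp_mem_invWt rfl (glOp_mem_invWt rfl hv)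
  by_cases hA : κ A = 0
  · rw [glOp_eq_zero (Ne.symm hAB) hA hv.2, map_zero]; exact zero_mem _
  · obtain ⟨κ', h⟩ := exists_weight_shift (A := B) hA
    exact glOp_mem_invWt h.symm (glOp_mem_invWt h hv)

theorem glOp_glOp_mem {c : ℂ} {κ : Fin N → ℕ} (A B : Fin N) {v : (Fin L → Fin N) → M}
    (hv : v ∈ eigWt T c κ) : (glOp M L A B * glOp M L B A) v ∈ eigWt T c κ :=
  ⟨glOp_glOp_mem_invWt A B hv.1,
    have h : glOp M L B A v ∈ (casimir M L N).maxGenEigenspace c :=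
      Module.End.mapsTo_maxGenEigenspace_of_comm (casimir_commute B A) c hv.2
    show glOp M L A B (glOp M L B A v) ∈ (casimir M L N).maxGenEigenspace c from
      Module.End.mapsTo_maxGenEigenspace_of_comm (casimir_commute A B) c h⟩

theorem casimir_mem_invWt {κ : Fin N → ℕ} {v : (Fin L → Fin N) → M} (hv : v ∈ invWt T κ) :
    casimir M L N v ∈ invWt T κ := by
  rw [casimir, LinearMap.sum_apply]
  refine sum_mem fun A _ => ?_
  rw [LinearMap.sum_apply]
  exact sum_mem fun B _ => glOp_glOp_mem_invWt A B hv

theorem casimir_mem_eigWt {c : ℂ} {κ : Fin N → ℕ} {v : (Fin L → Fin N) → M}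
    (hv : v ∈ eigWt T c κ) : casimir M L N v ∈ eigWt T c κ :=
  ⟨casimir_mem_invWt hv.1, Module.End.mapsTo_maxGenEigenspace_of_comm (Commute.refl _) c hv.2⟩

/-- The trace of `E_{AB} E_{BA}` on a generalized eigenspace of the Casimir operator. -/
noncomputable def trOp (T : ∀ l, l + 1 < L → Set (M →ₗ[ℂ] M)) (c : ℂ) (A B : Fin N)
    (κ : Fin N → ℕ) : ℂ :=
  LinearMap.trace ℂ (eigWt T c κ) ((glOp M L A B * glOp M L B A).restrict
    fun _ hv => glOp_glOp_mem A B hv)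

theorem trOp_eq_zero {c : ℂ} {A B : Fin N} (hAB : A ≠ B) {κ : Fin N → ℕ} (hA : κ A = 0) :
    trOp T c A B κ = 0 := by
  have : (glOp M L A B * glOp M L B A).restrict (p := eigWt T c κ) (q := eigWt T c κ)
      (fun _ hv => glOp_glOp_mem A B hv) = 0 := by
    ext1 ⟨v, hv⟩
    apply Subtype.ext
    rw [LinearMap.coe_restrict_apply, Module.End.mul_apply, glOp_eq_zero hAB.symm hA hv.1.2,
      map_zero]
    rfl
  rw [trOp, this, map_zero]

variable [FiniteDimensional ℂ M]

theorem trOp_comm {c : ℂ} {A B : Fin N} {κ κ' : Fin N → ℕ}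
    (h : κ' + Pi.single A 1 = κ + Pi.single B 1) : trOp T c A B κ = trOp T c B A κ' := by
  let f : eigWt T c κ →ₗ[ℂ] eigWt T c κ' :=
    (glOp M L B A).restrict fun _ hv => glOp_mem_eigWt h hv
  let g : eigWt T c κ' →ₗ[ℂ] eigWt T c κ :=
    (glOp M L A B).restrict fun _ hv => glOp_mem_eigWt h.symm hv
  exact LinearMap.trace_comp_comm' f g

theorem trOp_sub {c : ℂ} {A B : Fin N} {κ : Fin N → ℕ} :
    trOp T c A B κ = trOp T c B A κ +
      ((κ A : ℂ) - κ B) * (Module.finrank ℂ (eigWt T c κ) : ℂ) := by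
  have : (glOp M L A B * glOp M L B A).restrict (p := eigWt T c κ) (q := eigWt T c κ)
      (fun _ hv => glOp_glOp_mem A B hv) = (glOp M L B A * glOp M L A B).restrict
      (fun _ hv => glOp_glOp_mem B A hv) + ((κ A : ℂ) - κ B) • LinearMap.id := by
    ext1 ⟨v, hv⟩
    apply Subtype.ext
    rw [LinearMap.coe_restrict_apply, LinearMap.add_apply, Submodule.coe_add,
      LinearMap.coe_restrict_apply, glOp_mul, if_pos rfl, if_pos rfl, LinearMap.add_apply,
      LinearMap.sub_apply, glOp_self hv.1.2, glOp_self hv.1.2, ← sub_smul]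
    rfl
  rw [trOp, this, map_add, map_smul, LinearMap.trace_id]
  rfl

theorem trace_casimir (c : ℂ) (κ : Fin N → ℕ) :
    ∑ A, ∑ B, trOp T c A B κ = c * (Module.finrank ℂ (eigWt T c κ) : ℂ) := by
  have h1 : ∑ A, ∑ B, trOp T c A B κ = LinearMap.trace ℂ (eigWt T c κ)
      ((casimir M L N).restrict fun _ hv => casimir_mem_eigWt hv) := by
    simp only [trOp, ← map_sum]
    congr 1
    ext1 ⟨v, hv⟩
    apply Subtype.ext
    simp only [LinearMap.sum_apply, LinearMap.coe_restrict_apply, casimir,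
      AddSubmonoidClass.coe_finsetSum]
  rw [h1]
  exact trace_restrict_of_le_maxGenEigenspace _ _ c _ inf_le_right

theorem finrank_invWt_eq_sum (s : Finset ℂ)
    (hs : ∀ c, (casimir M L N).maxGenEigenspace c ≠ ⊥ → c ∈ s) (κ : Fin N → ℕ) :
    Module.finrank ℂ (invWt T κ) = ∑ c ∈ s, Module.finrank ℂ (eigWt T c κ) :=
  finrank_eq_sum_inf_maxGenEigenspace _ _ (fun _ hv => casimir_mem_invWt hv) s hs

end Casimir

section WeightPolynomials

open MvPolynomial

variable {N : ℕ}

/-- The Euler derivation `x_A ∂/∂x_A`. -/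
noncomputable def eulerD (A : Fin N) :
    Derivation ℂ (MvPolynomial (Fin N) ℂ) (MvPolynomial (Fin N) ℂ) :=
  (X A : MvPolynomial (Fin N) ℂ) • pderiv A

theorem eulerD_X (A B : Fin N) :
    eulerD A (X B : MvPolynomial (Fin N) ℂ) = if B = A then X A else 0 := by
  rw [eulerD, Derivation.smul_apply, pderiv_X, smul_eq_mul, Pi.single_apply]
  split_ifs <;> simp

theorem eulerD_monomial (A : Fin N) (κ : Fin N →₀ ℕ) (r : ℂ) :
    eulerD A (monomial κ r) = monomial κ ((κ A : ℂ) * r) := by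
  rw [eulerD, Derivation.smul_apply, pderiv_monomial, smul_eq_mul, X, monomial_mul, one_mul]
  by_cases h : κ A = 0
  · simp [h]
  · rw [mul_comm r]
    congr 1
    rw [add_comm, Finsupp.sub_add_single_one_cancel h]

theorem coeff_eulerD (A : Fin N) (κ : Fin N →₀ ℕ) (F : MvPolynomial (Fin N) ℂ) :
    coeff κ (eulerD A F) = (κ A : ℂ) * coeff κ F := by
  induction F using MvPolynomial.induction_on' with
  | monomial u a =>
    rw [eulerD_monomial, coeff_monomial, coeff_monomial]
    split_ifs with h
    · rw [h]
    · simp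
  | add p q hp hq => rw [map_add, coeff_add, hp, hq, coeff_add, mul_add]

/-- The homogeneous polynomial of degree `L` with prescribed coefficients. -/
noncomputable def weightPoly (L : ℕ) (g : (Fin N → ℕ) → ℂ) : MvPolynomial (Fin N) ℂ :=
  ∑ κ ∈ Finset.univ.finsuppAntidiag L, monomial κ (g κ)

theorem coeff_weightPoly {L : ℕ} {g : (Fin N → ℕ) → ℂ} (hg : ∀ κ, ∑ A, κ A ≠ L → g κ = 0)
    (κ : Fin N →₀ ℕ) : coeff κ (weightPoly L g) = g κ := by
  rw [weightPoly, coeff_sum]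
  simp only [coeff_monomial]
  rw [Finset.sum_ite_eq']
  split_ifs with h
  · rfl
  · rw [hg]
    intro h'
    exact h (by simp [h'])

variable {L : ℕ} {M : Type*} [AddCommGroup M] [Module ℂ M]
  {T : ∀ l, l + 1 < L → Set (M →ₗ[ℂ] M)}

theorem sum_content {ι : Type*} [Fintype ι] [DecidableEq ι] (J : Fin L → ι) :
    ∑ A, content J A = L := by
  have := Finset.card_eq_sum_card_fiberwise (f := J) (s := Finset.univ) (t := Finset.univ)
    fun _ _ => Finset.mem_univ _
  rw [Finset.card_univ, Fintype.card_fin] at this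
  exact this.symm

theorem wtSpace_eq_bot {ι : Type*} [Fintype ι] [DecidableEq ι] {κ : ι → ℕ}
    (h : ∑ A, κ A ≠ L) : wtSpace M L κ = ⊥ := by
  rw [eq_bot_iff]
  intro v hv
  rw [Submodule.mem_bot]
  funext J
  by_contra hJ
  exact h (by rw [← hv J hJ, sum_content])

theorem eigWt_eq_bot {c : ℂ} {κ : Fin N → ℕ} (h : ∑ A, κ A ≠ L) : eigWt T c κ = ⊥ := by
  rw [eigWt, invWt, wtSpace_eq_bot h, inf_bot_eq, bot_inf_eq]

theorem trOp_of_sum_ne {c : ℂ} {A B : Fin N} {κ : Fin N → ℕ} (h : ∑ A, κ A ≠ L) :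
    trOp T c A B κ = 0 := by
  have : Subsingleton (eigWt T c κ) := by
    rw [eigWt_eq_bot h]; infer_instance
  rw [trOp, Subsingleton.elim ((glOp M L A B * glOp M L B A).restrict (p := eigWt T c κ)
    (q := eigWt T c κ) fun _ hv => glOp_glOp_mem A B hv) 0, map_zero]

/-- The character of a generalized eigenspace of the Casimir operator. -/
noncomputable def eigChar (T : ∀ l, l + 1 < L → Set (M →ₗ[ℂ] M)) (c : ℂ) :
    MvPolynomial (Fin N) ℂ :=
  weightPoly L fun κ => (Module.finrank ℂ (eigWt T c κ) : ℂ)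

/-- The generating function of the traces of `E_{AB} E_{BA}`. -/
noncomputable def trPoly (T : ∀ l, l + 1 < L → Set (M →ₗ[ℂ] M)) (c : ℂ) (A B : Fin N) :
    MvPolynomial (Fin N) ℂ :=
  weightPoly L (trOp T c A B)

theorem coeff_eigChar (c : ℂ) (κ : Fin N →₀ ℕ) :
    coeff κ (eigChar T c) = (Module.finrank ℂ (eigWt T c κ) : ℂ) :=
  coeff_weightPoly (fun κ h => by rw [eigWt_eq_bot h, finrank_bot, Nat.cast_zero]) κ

theorem coeff_trPoly (c : ℂ) (A B : Fin N) (κ : Fin N →₀ ℕ) :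
    coeff κ (trPoly T c A B) = trOp T c A B κ :=
  coeff_weightPoly (fun _ h => trOp_of_sum_ne h) κ

theorem sum_eulerD_eigChar (c : ℂ) :
    ∑ A, eulerD A (eigChar (N := N) T c) = (L : ℂ) • eigChar T c := by
  ext κ
  rw [coeff_sum, coeff_smul, smul_eq_mul]
  simp only [coeff_eulerD, ← Finset.sum_mul]
  by_cases h : ∑ A, κ A = L
  · rw [← Nat.cast_sum, h]
  · rw [coeff_eigChar, eigWt_eq_bot h, finrank_bot]; simp

variable [FiniteDimensional ℂ M]

theorem trPoly_sub (c : ℂ) (A B : Fin N) :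
    trPoly T c A B = trPoly T c B A + (eulerD A (eigChar T c) - eulerD B (eigChar T c)) := by
  ext κ
  rw [coeff_add, coeff_sub, coeff_eulerD, coeff_eulerD, coeff_trPoly, coeff_trPoly, coeff_eigChar,
    trOp_sub]
  ring

theorem X_mul_trPoly (c : ℂ) {A B : Fin N} (hAB : A ≠ B) :
    X A * trPoly T c B A = X B * trPoly T c A B := by
  ext η
  rw [coeff_X_mul', coeff_X_mul']
  simp only [coeff_trPoly, Finsupp.mem_support_iff]
  have hf : ∀ C : Fin N, ((η - Finsupp.single C 1 : Fin N →₀ ℕ) : Fin N → ℕ) =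
      (η : Fin N → ℕ) - Pi.single C 1 := by
    intro C; funext D
    simp [Finsupp.single_apply, Pi.single_apply, eq_comm]
  by_cases hA : η A = 0 <;> by_cases hB : η B = 0
  · simp [hA, hB]
  · rw [if_neg (not_not.2 hA), if_pos hB, trOp_eq_zero hAB]
    simp [hA]
  · rw [if_neg (not_not.2 hB), if_pos hA, trOp_eq_zero hAB.symm]
    simp [hB]
  · rw [if_pos hA, if_pos hB]
    apply trOp_comm
    rw [hf, hf]
    funext D
    simp only [Pi.add_apply, Pi.sub_apply, Pi.single_apply]
    by_cases h1 : D = A <;> by_cases h2 : D = B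
    · exact absurd (h1.symm.trans h2) hAB
    · subst h1; simp [h2]; omega
    · subst h2; simp [h1]; omega
    · simp [h1, h2]

theorem trOp_self (c : ℂ) (A : Fin N) (κ : Fin N → ℕ) :
    trOp T c A A κ = (κ A : ℂ) * κ A * (Module.finrank ℂ (eigWt T c κ) : ℂ) := by
  have : (glOp M L A A * glOp M L A A).restrict (p := eigWt T c κ) (q := eigWt T c κ)
      (fun _ hv => glOp_glOp_mem A A hv) = ((κ A : ℂ) * κ A) • LinearMap.id := by
    ext1 ⟨v, hv⟩
    apply Subtype.ext
    rw [LinearMap.coe_restrict_apply, Module.End.mul_apply, glOp_self hv.1.2, map_smul,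
      glOp_self hv.1.2, smul_smul]
    rfl
  rw [trOp, this, map_smul, LinearMap.trace_id]
  rfl

theorem smul_eigChar (c : ℂ) : c • eigChar (N := N) T c =
    ∑ A, eulerD A (eulerD A (eigChar T c)) + ∑ A, ∑ B ∈ Finset.univ.erase A, trPoly T c A B := by
  ext κ
  rw [coeff_smul, coeff_add, coeff_sum, coeff_sum, coeff_eigChar, smul_eq_mul, ← trace_casimir,
    ← Finset.sum_add_distrib]
  refine Finset.sum_congr rfl fun A _ => ?_
  rw [← Finset.add_sum_erase _ _ (Finset.mem_univ A), coeff_sum, coeff_eulerD, coeff_eulerD,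
    coeff_eigChar, trOp_self, mul_assoc]
  simp only [coeff_trPoly]

end WeightPolynomials

section Vandermonde

open MvPolynomial

variable (N : ℕ)

/-- The pairs `i < j`. -/
def ltPairs : Finset (Fin N × Fin N) := Finset.univ.filter fun q => q.1 < q.2

/-- The Vandermonde polynomial. -/
noncomputable def vdm : MvPolynomial (Fin N) ℂ := ∏ q ∈ ltPairs N, (X q.2 - X q.1)

variable {N}

theorem sum_erase_eq_sum_ltPairs {R : Type*} [AddCommMonoid R] (f : Fin N → Fin N → R) :
    ∑ A, ∑ B ∈ Finset.univ.erase A, f A B = ∑ q ∈ ltPairs N, (f q.1 q.2 + f q.2 q.1) := by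
  have h1 : ∀ A : Fin N, Finset.univ.erase A =
      Finset.univ.filter (A < ·) ∪ Finset.univ.filter (· < A) := by
    intro A; ext B
    simp only [Finset.mem_erase, Finset.mem_univ, and_true, Finset.mem_union, Finset.mem_filter,
      true_and]
    exact ⟨fun h => (lt_or_gt_of_ne h).symm, fun h => h.elim (fun h => h.ne') fun h => h.ne⟩
  have h2 : ∀ A : Fin N, ∑ B ∈ Finset.univ.erase A, f A B =
      (∑ B, if A < B then f A B else 0) + ∑ B, if B < A then f A B else 0 := by
    intro A
    rw [h1, Finset.sum_union, Finset.sum_filter, Finset.sum_filter]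
    rw [Finset.disjoint_filter]
    exact fun B _ h => not_lt_of_gt h
  simp only [h2, Finset.sum_add_distrib, ltPairs, Finset.sum_filter, Fintype.sum_prod_type]
  congr 1
  rw [Finset.sum_comm]

theorem vdm_eq_det :
    vdm N = (Matrix.vandermonde fun i : Fin N => (X i : MvPolynomial _ ℂ)).det := by
  rw [Matrix.det_vandermonde, vdm, ltPairs, Finset.prod_filter, Fintype.prod_prod_type]
  refine Finset.prod_congr rfl fun i _ => ?_
  rw [← Finset.prod_filter]
  refine Finset.prod_congr ?_ fun _ _ => rfl
  ext j; simp

/-- The exponent vector of a permutation. -/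
noncomputable def permExp (σ : Equiv.Perm (Fin N)) : Fin N →₀ ℕ :=
  Finsupp.equivFunOnFinite.symm fun i => (σ i : ℕ)

@[simp] theorem permExp_apply (σ : Equiv.Perm (Fin N)) (i : Fin N) : permExp σ i = σ i := rfl

theorem vdm_eq_sum : vdm N =
    ∑ σ : Equiv.Perm (Fin N), monomial (permExp σ) ((Equiv.Perm.sign σ : ℤ) : ℂ) := by
  rw [vdm_eq_det, ← Matrix.det_transpose, Matrix.det_apply']
  refine Finset.sum_congr rfl fun σ _ => ?_
  have : ∏ i, (Matrix.vandermonde fun i : Fin N => (X i : MvPolynomial _ ℂ)).transpose (σ i) i =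
      monomial (permExp σ) 1 := by
    rw [monomial_eq, map_one, one_mul, Finsupp.prod_fintype _ _ (by simp)]
    rfl
  rw [this, ← mul_one ((Equiv.Perm.sign σ : ℤ) : ℂ), ← C_mul_monomial]
  congr 1

theorem sum_eulerD_eulerD_vdm : ∑ A, eulerD A (eulerD A (vdm N)) =
    (∑ A : Fin N, (A : ℂ) ^ 2) • vdm N := by
  rw [vdm_eq_sum]
  simp only [map_sum, eulerD_monomial, Finset.smul_sum]
  rw [Finset.sum_comm]
  refine Finset.sum_congr rfl fun σ _ => ?_
  rw [smul_monomial, ← map_sum, smul_eq_mul, ← Equiv.sum_comp σ fun A => (A : ℂ) ^ 2,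
    Finset.sum_mul]
  congr 1
  refine Finset.sum_congr rfl fun A _ => ?_
  rw [permExp_apply]; ring

/-- The Vandermonde polynomial without one factor. -/
noncomputable def vdmErase (q : Fin N × Fin N) : MvPolynomial (Fin N) ℂ :=
  ∏ q' ∈ (ltPairs N).erase q, (X q'.2 - X q'.1)

theorem vdm_eq_mul {q : Fin N × Fin N} (hq : q ∈ ltPairs N) :
    vdm N = (X q.2 - X q.1) * vdmErase q :=
  (Finset.mul_prod_erase _ _ hq).symm

theorem derivation_prod {ι R A : Type*} [DecidableEq ι] [CommSemiring R] [CommSemiring A]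
    [Algebra R A] (D : Derivation R A A) (s : Finset ι) (f : ι → A) :
    D (∏ i ∈ s, f i) = ∑ i ∈ s, (∏ j ∈ s.erase i, f j) * D (f i) := by
  induction s using Finset.induction_on with
  | empty => simp
  | insert a s ha ih =>
    rw [Finset.prod_insert ha, Derivation.leibniz, ih, Finset.sum_insert ha, Finset.erase_insert ha,
      add_comm, smul_eq_mul, smul_eq_mul, Finset.mul_sum]
    congr 1
    refine Finset.sum_congr rfl fun i hi => ?_
    have hai : a ≠ i := by rintro rfl; exact ha hi
    rw [Finset.erase_insert_of_ne hai, Finset.prod_insert (by simp [ha]), mul_assoc]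

theorem sum_eulerD_vdm_mul (F : MvPolynomial (Fin N) ℂ) :
    ∑ A, eulerD A (vdm N) * eulerD A F =
      ∑ q ∈ ltPairs N, vdmErase q * (X q.2 * eulerD q.2 F - X q.1 * eulerD q.1 F) := by
  simp only [vdm, derivation_prod, map_sub, eulerD_X, Finset.sum_mul]
  rw [Finset.sum_comm]
  refine Finset.sum_congr rfl fun q _ => ?_
  simp only [mul_assoc, ← Finset.mul_sum, sub_mul, Finset.sum_sub_distrib, ite_mul, zero_mul,
    Finset.sum_ite_eq, Finset.mem_univ, if_true]
  rfl

variable {L : ℕ} {M : Type*} [AddCommGroup M] [Module ℂ M] [FiniteDimensional ℂ M]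
  {T : ∀ l, l + 1 < L → Set (M →ₗ[ℂ] M)}

/-- The product of the Vandermonde polynomial and the character is an eigenvector of the
Laplacian. -/
theorem laplacian_vdm_mul_eigChar (c : ℂ) :
    ∑ A, eulerD A (eulerD A (vdm N * eigChar T c)) =
      (c + ((N : ℂ) - 1) * L + ∑ A : Fin N, (A : ℂ) ^ 2) • (vdm N * eigChar T c) := by
  set F := eigChar (N := N) T c with hF
  have h1 : ∀ A, eulerD A (eulerD A (vdm N * F)) =
      vdm N * eulerD A (eulerD A F) + 2 * (eulerD A (vdm N) * eulerD A F) +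
        F * eulerD A (eulerD A (vdm N)) := by
    intro A
    simp only [Derivation.leibniz, map_add, smul_eq_mul]
    ring
  have h2 : ∑ A, ∑ B ∈ Finset.univ.erase A, eulerD A F = (((N : ℂ) - 1) * L) • F := by
    have : ∀ A : Fin N, ∑ B ∈ Finset.univ.erase A, eulerD A F = ((N : ℂ) - 1) • eulerD A F := by
      intro A
      have hN : 1 ≤ N := by have := A.2; omega
      rw [Finset.sum_const, Finset.card_erase_of_mem (Finset.mem_univ _), Finset.card_univ,
        Fintype.card_fin, ← Nat.cast_smul_eq_nsmul ℂ, Nat.cast_sub hN, Nat.cast_one]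
    rw [Finset.sum_congr rfl fun A _ => this A, ← Finset.smul_sum, sum_eulerD_eigChar, smul_smul]
  have h3 : 2 * ∑ A, eulerD A (vdm N) * eulerD A F =
      vdm N * (∑ A, ∑ B ∈ Finset.univ.erase A, trPoly T c A B) +
        vdm N * ∑ A, ∑ B ∈ Finset.univ.erase A, eulerD A F := by
    rw [sum_eulerD_vdm_mul, sum_erase_eq_sum_ltPairs, sum_erase_eq_sum_ltPairs, Finset.mul_sum,
      Finset.mul_sum, Finset.mul_sum, ← Finset.sum_add_distrib]
    refine Finset.sum_congr rfl fun q hq => ?_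
    have hne : q.1 ≠ q.2 := by
      have := (Finset.mem_filter.1 hq).2
      exact this.ne
    have e1 := X_mul_trPoly (T := T) c hne
    have e2 := trPoly_sub (T := T) c q.1 q.2
    rw [← hF] at e2
    rw [vdm_eq_mul hq]
    have e3 : (X q.2 - X q.1) * trPoly T c q.1 q.2 = X q.1 * (eulerD q.2 F - eulerD q.1 F) := by
      linear_combination (-1 : MvPolynomial (Fin N) ℂ) * e1 - X q.1 * e2
    have e4 : (X q.2 - X q.1) * trPoly T c q.2 q.1 = X q.2 * (eulerD q.2 F - eulerD q.1 F) := by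
      linear_combination (-1 : MvPolynomial (Fin N) ℂ) * e1 - X q.2 * e2
    linear_combination (-vdmErase q) * (e3 + e4)
  have h4 := smul_eigChar (N := N) (T := T) c
  rw [← hF] at h4
  rw [Finset.sum_congr rfl fun A _ => h1 A, Finset.sum_add_distrib, Finset.sum_add_distrib,
    ← Finset.mul_sum, ← Finset.mul_sum, ← Finset.mul_sum, h3, h2, sum_eulerD_eulerD_vdm, add_smul,
    add_smul, ← mul_smul_comm c, h4]
  simp only [smul_eq_C_mul]
  ring

theorem coeff_vdm_mul_eigChar_eq_zero {c : ℂ} {η : Fin N →₀ ℕ}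
    (h : ∑ A, (η A : ℂ) ^ 2 ≠ c + ((N : ℂ) - 1) * L + ∑ A : Fin N, (A : ℂ) ^ 2) :
    coeff η (vdm N * eigChar T c) = 0 := by
  have h1 := congrArg (coeff η) (laplacian_vdm_mul_eigChar (N := N) (T := T) c)
  rw [coeff_sum, coeff_smul, smul_eq_mul] at h1
  simp only [coeff_eulerD, ← mul_assoc, ← Finset.sum_mul, ← pow_two] at h1
  by_contra h0
  exact h (mul_right_cancel₀ h0 h1)

end Vandermonde

section HighestWeights

open MvPolynomial

variable {N L : ℕ} {M : Type*} [AddCommGroup M] [Module ℂ M]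
  {T : ∀ l, l + 1 < L → Set (M →ₗ[ℂ] M)}

/-- The eigenvalue of the Casimir operator on highest-weight vectors. -/
def casimirEig (κ : Fin N → ℕ) : ℂ :=
  ∑ A, ∑ B, if A = B then (κ A : ℂ) ^ 2 else if A < B then (κ A : ℂ) - κ B else 0

/-- The weight shifted by the half sum of positive roots. -/
def shifted (κ : Fin N → ℕ) (A : Fin N) : ℕ := κ A + (N - 1 - A)

theorem shifted_strictAnti {κ : Fin N → ℕ} (h : Antitone κ) : StrictAnti (shifted κ) := by
  intro A B hAB
  have := h hAB.le
  have h1 := A.2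
  have h2 := B.2
  have h3 : (A : ℕ) < B := hAB
  simp only [shifted]
  omega

theorem casimirEig_eq {κ : Fin N → ℕ} (hκ : ∑ A, κ A = L) :
    casimirEig κ + ((N : ℂ) - 1) * L + ∑ A : Fin N, (A : ℂ) ^ 2 =
      ∑ A, (shifted κ A : ℂ) ^ 2 := by
  have h1 : casimirEig κ = ∑ A, ((κ A : ℂ) ^ 2 + (κ A : ℂ) * ((N : ℂ) - 1 - 2 * A)) := by
    have e1 : ∀ A B : Fin N, (if A = B then (κ A : ℂ) ^ 2 else if A < B then (κ A : ℂ) - κ B else 0)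
        = (if A = B then (κ A : ℂ) ^ 2 else 0) + (if A < B then (κ A : ℂ) else 0) -
          if A < B then (κ B : ℂ) else 0 := by
      intro A B
      by_cases h : A = B
      · subst h; simp
      · by_cases h' : A < B <;> simp [h, h']
    have e2 : ∑ A : Fin N, ∑ B : Fin N, (if A < B then (κ B : ℂ) else 0) =
        ∑ A : Fin N, (κ A : ℂ) * A := by
      rw [Finset.sum_comm]
      refine Finset.sum_congr rfl fun A _ => ?_
      rw [← Finset.sum_filter, Finset.sum_const]
      have : Finset.univ.filter (· < A) = Finset.Iio A := by ext; simp
      rw [this, Fin.card_Iio, nsmul_eq_mul, mul_comm]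
    have e3 : ∑ A : Fin N, ∑ B : Fin N, (if A < B then (κ A : ℂ) else 0) =
        ∑ A : Fin N, (κ A : ℂ) * ((N : ℂ) - 1 - A) := by
      refine Finset.sum_congr rfl fun A _ => ?_
      rw [← Finset.sum_filter, Finset.sum_const]
      have : Finset.univ.filter (A < ·) = Finset.Ioi A := by ext; simp
      have hA := A.2
      rw [this, Fin.card_Ioi, nsmul_eq_mul, mul_comm, Nat.cast_sub (by omega),
        Nat.cast_sub (by omega), Nat.cast_one]
    simp only [casimirEig, e1, Finset.sum_sub_distrib, Finset.sum_add_distrib, e2, e3]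
    simp only [Finset.sum_ite_eq, Finset.mem_univ, if_true]
    rw [← Finset.sum_add_distrib, ← Finset.sum_sub_distrib, ← Finset.sum_add_distrib]
    exact Finset.sum_congr rfl fun A _ => by ring
  have h2 : ∑ A : Fin N, (A : ℂ) ^ 2 = ∑ A : Fin N, ((N : ℂ) - 1 - A) ^ 2 := by
    rw [← Equiv.sum_comp Fin.revPerm fun A : Fin N => (A : ℂ) ^ 2]
    refine Finset.sum_congr rfl fun A _ => ?_
    have hA := A.2
    rw [Fin.revPerm_apply, Fin.val_rev, Nat.cast_sub (by omega)]
    push_cast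
    ring
  rw [h1, h2, ← hκ, Nat.cast_sum, Finset.mul_sum, ← Finset.sum_add_distrib,
    ← Finset.sum_add_distrib]
  refine Finset.sum_congr rfl fun A _ => ?_
  have hA := A.2
  rw [shifted, Nat.cast_add, Nat.cast_sub (by omega), Nat.cast_sub (by omega)]
  push_cast
  ring

theorem casimir_apply_of_mem {κ : Fin N → ℕ} {v : (Fin L → Fin N) → M}
    (hv : v ∈ hwSpace (fun _ => 0) T (· < ·) κ) : casimir M L N v = casimirEig κ • v := by
  simp only [casimir, LinearMap.sum_apply, casimirEig, Finset.sum_smul]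
  refine Finset.sum_congr rfl fun A _ => Finset.sum_congr rfl fun B _ => ?_
  have h0 : ∀ A B : Fin N, A < B → glOp M L A B v = 0 := fun A B h => hv.2 A B h
  split_ifs with h1 h2
  · subst h1
    rw [Module.End.mul_apply, glOp_self hv.1.2, map_smul, glOp_self hv.1.2, smul_smul, pow_two]
  · rw [glOp_mul, if_pos rfl, if_pos rfl, LinearMap.add_apply, LinearMap.sub_apply,
      glOp_self hv.1.2, glOp_self hv.1.2, Module.End.mul_apply, h0 A B h2, map_zero, zero_add,
      sub_smul]
  · rw [Module.End.mul_apply, h0 B A (lt_of_le_of_ne (not_lt.1 h2) (Ne.symm h1)),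
      map_zero, zero_smul]

theorem eq_casimirEig_of_mem {c : ℂ} {κ : Fin N → ℕ} {v : (Fin L → Fin N) → M}
    (hv : v ∈ hwSpace (fun _ => 0) T (· < ·) κ) (hc : v ∈ (casimir M L N).maxGenEigenspace c)
    (h0 : v ≠ 0) : casimirEig κ = c := by
  obtain ⟨k, hk⟩ := Module.End.mem_maxGenEigenspace _ _ _ |>.1 hc
  have h1 : ∀ k : ℕ, ((casimir M L N - c • 1) ^ k) v = (casimirEig κ - c) ^ k • v := by
    intro k
    induction k with
    | zero => simp
    | succ k ih =>
      rw [pow_succ', Module.End.mul_apply, ih, map_smul, LinearMap.sub_apply,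
        casimir_apply_of_mem hv, LinearMap.smul_apply, Module.End.one_apply, ← sub_smul, smul_smul,
        pow_succ]
  rw [h1, smul_eq_zero] at hk
  by_contra hne
  exact pow_ne_zero k (sub_ne_zero.2 hne) (hk.resolve_right h0)

theorem sum_mul_of_shift {κ κ' l : Fin N → ℕ} {A B : Fin N}
    (h : κ' + Pi.single B 1 = κ + Pi.single A 1) :
    ∑ C, κ' C * l C + l B = ∑ C, κ C * l C + l A := by
  have := congrArg (fun f : Fin N → ℕ => ∑ C, f C * l C) h
  simpa [add_mul, Finset.sum_add_distrib, Pi.single_apply] using this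

theorem singular_of_maximal {c : ℂ} {κ μ : Fin N → ℕ} (hμ : Antitone μ)
    (hmax : ∀ κ', eigWt T c κ' ≠ ⊥ →
      ∑ A, κ' A * shifted μ A ≤ ∑ A, κ A * shifted μ A) :
    eigWt T c κ ≤ hwSpace (fun _ => 0) T (· < ·) κ := by
  intro v hv
  refine ⟨hv.1, fun A B hAB => ?_⟩
  by_cases hB : κ B = 0
  · exact glOp_eq_zero hAB.ne hB hv.1.2
  obtain ⟨κ', h⟩ := exists_weight_shift (κ := κ) (A := A) hB
  have h1 : eigWt T c κ' = ⊥ := by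
    by_contra hne
    have h2 := hmax κ' hne
    have h3 := sum_mul_of_shift (l := shifted μ) h
    have h4 := shifted_strictAnti hμ hAB
    omega
  have := glOp_mem_eigWt h hv
  rw [h1, Submodule.mem_bot] at this
  exact this

theorem weight_eq_of_maximal {κ μ : Fin N → ℕ} (hμ : Antitone μ) (hL : ∑ A, μ A = L)
    (hne : eigWt T (casimirEig μ) κ ≠ ⊥)
    (hmax : ∀ κ', eigWt T (casimirEig μ) κ' ≠ ⊥ →
      ∑ A, κ' A * shifted μ A ≤ ∑ A, κ A * shifted μ A)
    (hle : ∑ A, μ A * shifted μ A ≤ ∑ A, κ A * shifted μ A) : κ = μ := by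
  obtain ⟨v, hv, h0⟩ := (Submodule.ne_bot_iff _).1 hne
  have hκ : ∑ A, κ A = L := by
    by_contra h; exact hne (eigWt_eq_bot h)
  have hc := eq_casimirEig_of_mem (singular_of_maximal hμ hmax hv) hv.2 h0
  have h1 := casimirEig_eq hκ
  rw [hc, casimirEig_eq hL] at h1
  have h2 : ∑ A, (shifted μ A : ℤ) ^ 2 = ∑ A, (shifted κ A : ℤ) ^ 2 := by exact_mod_cast h1
  have h3 : ∑ A, ((κ A : ℤ) - μ A) ^ 2 ≤ 0 := by
    have e : ∀ A, ((κ A : ℤ) - μ A) ^ 2 = (shifted κ A : ℤ) ^ 2 - (shifted μ A : ℤ) ^ 2 +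
        2 * ((μ A : ℤ) * shifted μ A) - 2 * ((κ A : ℤ) * shifted μ A) := by
      intro A
      simp only [shifted]
      push_cast
      ring
    rw [Finset.sum_congr rfl fun A _ => e A, Finset.sum_sub_distrib, Finset.sum_add_distrib,
      Finset.sum_sub_distrib, h2, ← Finset.mul_sum, ← Finset.mul_sum]
    have : (∑ A, (μ A : ℤ) * shifted μ A) ≤ ∑ A, (κ A : ℤ) * shifted μ A := by exact_mod_cast hle
    linarith
  have h4 := (Finset.sum_eq_zero_iff_of_nonneg fun A _ => sq_nonneg _).1
    (le_antisymm h3 (Finset.sum_nonneg fun A _ => sq_nonneg ((κ A : ℤ) - μ A)))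
  funext A
  have := pow_eq_zero_iff (two_ne_zero) |>.1 (h4 A (Finset.mem_univ A))
  omega

theorem weight_le {κ μ : Fin N → ℕ} (hμ : Antitone μ) (hL : ∑ A, μ A = L)
    (hne : eigWt T (casimirEig μ) κ ≠ ⊥) :
    ∑ A, κ A * shifted μ A ≤ ∑ A, μ A * shifted μ A := by
  classical
  by_contra hlt
  push Not at hlt
  have hmem : ∀ κ', eigWt T (casimirEig μ) κ' ≠ ⊥ → Finsupp.equivFunOnFinite.symm κ' ∈
      (Finset.univ.finsuppAntidiag L).filter
        fun κ : Fin N →₀ ℕ => eigWt T (casimirEig μ) κ ≠ ⊥ := by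
    intro κ' h'
    have hκ : ∑ A, κ' A = L := by
      by_contra h; exact h' (eigWt_eq_bot h)
    refine Finset.mem_filter.2 ⟨?_, h'⟩
    simp [hκ]
  obtain ⟨κ₀, h₀, hmax⟩ := Finset.exists_max_image _
    (fun κ : Fin N →₀ ℕ => ∑ A, κ A * shifted μ A) ⟨_, hmem κ hne⟩
  have h1 := hmax _ (hmem κ hne)
  have h2 : ⇑κ₀ = μ := weight_eq_of_maximal hμ hL (Finset.mem_filter.1 h₀).2
    (fun κ' h' => hmax _ (hmem κ' h')) (hlt.le.trans h1)
  rw [← h2] at hlt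
  exact absurd (h2 ▸ h1) (not_le_of_gt (by simpa [h2] using hlt))

theorem weight_eq {κ μ : Fin N → ℕ} (hμ : Antitone μ) (hL : ∑ A, μ A = L)
    (hne : eigWt T (casimirEig μ) κ ≠ ⊥)
    (hle : ∑ A, μ A * shifted μ A ≤ ∑ A, κ A * shifted μ A) : κ = μ :=
  weight_eq_of_maximal hμ hL hne (fun _ h' => (weight_le hμ hL h').trans hle) hle

theorem eigWt_eq_hwSpace {μ : Fin N → ℕ} (hμ : Antitone μ) (hL : ∑ A, μ A = L) :
    eigWt T (casimirEig μ) μ = hwSpace (fun _ => 0) T (· < ·) μ := by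
  refine le_antisymm (singular_of_maximal hμ fun κ' h' => weight_le hμ hL h') fun v hv => ?_
  refine ⟨hv.1, (Module.End.mem_maxGenEigenspace _ _ _).2 ⟨1, ?_⟩⟩
  rw [pow_one, LinearMap.sub_apply, casimir_apply_of_mem hv, LinearMap.smul_apply,
    Module.End.one_apply, sub_self]

theorem sum_perm_mul_shifted_le {μ : Fin N → ℕ} (hμ : Antitone μ) (σ : Equiv.Perm (Fin N)) :
    ∑ A, (σ A : ℕ) * shifted μ A ≤ ∑ A : Fin N, (N - 1 - A) * shifted μ A := by
  have hm : Monovary (fun A : Fin N => N - 1 - (A : ℕ)) (shifted μ) := by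
    intro A B h
    have h1 : (B : ℕ) < A := (shifted_strictAnti hμ).lt_iff_gt.1 h
    change N - 1 - (A : ℕ) ≤ N - 1 - (B : ℕ)
    omega
  have := hm.sum_comp_perm_mul_le_sum_mul (σ := σ.trans Fin.revPerm)
  refine le_trans (le_of_eq ?_) this
  refine Finset.sum_congr rfl fun A _ => ?_
  congr 1
  rw [Equiv.trans_apply, Fin.revPerm_apply, Fin.val_rev]
  have := (σ A).2
  omega

variable [FiniteDimensional ℂ M]

theorem coeff_vdm_mul_eigChar (c : ℂ) (η : Fin N →₀ ℕ) : coeff η (vdm N * eigChar T c) =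
    ∑ σ : Equiv.Perm (Fin N), ((Equiv.Perm.sign σ : ℤ) : ℂ) *
      if permExp σ ≤ η then (Module.finrank ℂ (eigWt T c ⇑(η - permExp σ)) : ℂ) else 0 := by
  rw [vdm_eq_sum, Finset.sum_mul, coeff_sum]
  refine Finset.sum_congr rfl fun σ _ => ?_
  rw [coeff_monomial_mul', mul_ite, mul_zero, coeff_eigChar]

/-- The determinantal formula for the number of highest-weight vectors of `gl(N)`. -/
theorem finrank_hwSpace_eq_sum {μ : Fin N → ℕ} (hμ : Antitone μ) (hL : ∑ A, μ A = L) :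
    (Equiv.Perm.sign (Fin.revPerm (n := N)) : ℤ) *
        (Module.finrank ℂ (hwSpace (fun _ => 0) T (· < ·) μ) : ℤ) =
      ∑ σ : Equiv.Perm (Fin N), (Equiv.Perm.sign σ : ℤ) *
        if ∀ A, (σ A : ℕ) ≤ shifted μ A then
          (Module.finrank ℂ (invWt T fun A => shifted μ A - σ A) : ℤ) else 0 := by
  classical
  set η : Fin N →₀ ℕ := Finsupp.equivFunOnFinite.symm (shifted μ) with hη
  have hηA : ∀ A, η A = shifted μ A := fun A => rfl
  have hle : ∀ σ : Equiv.Perm (Fin N), permExp σ ≤ η ↔ ∀ A, (σ A : ℕ) ≤ shifted μ A :=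
    fun σ => Iff.rfl
  have hsub : ∀ σ : Equiv.Perm (Fin N), ⇑(η - permExp σ) = fun A => shifted μ A - σ A :=
    fun σ => rfl
  have hfin : {c | (casimir M L N).maxGenEigenspace c ≠ ⊥}.Finite :=
    WellFoundedGT.finite_ne_bot_of_iSupIndep (casimir M L N).independent_maxGenEigenspace
  let s : Finset ℂ := insert (casimirEig μ) hfin.toFinset
  have hs : ∀ c, (casimir M L N).maxGenEigenspace c ≠ ⊥ → c ∈ s := fun c hc => by simp [s, hc]
  have h1 : (∑ σ : Equiv.Perm (Fin N), ((Equiv.Perm.sign σ : ℤ) : ℂ) *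
      if ∀ A, (σ A : ℕ) ≤ shifted μ A then
        (Module.finrank ℂ (invWt T fun A => shifted μ A - σ A) : ℂ) else 0) =
      ∑ c ∈ s, coeff η (vdm N * eigChar T c) := by
    simp only [coeff_vdm_mul_eigChar, hle]
    rw [Finset.sum_comm]
    refine Finset.sum_congr rfl fun σ _ => ?_
    rw [← Finset.mul_sum]
    split_ifs
    · rw [finrank_invWt_eq_sum s hs, Nat.cast_sum]
      rfl
    · simp
  have h2 : ∑ c ∈ s, coeff η (vdm N * eigChar T c) =
      coeff η (vdm N * eigChar T (casimirEig μ)) := by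
    refine Finset.sum_eq_single _ (fun c _ hc => ?_) fun h => absurd (Finset.mem_insert_self _ _) h
    refine coeff_vdm_mul_eigChar_eq_zero ?_
    simp only [hηA, ← casimirEig_eq hL]
    intro h
    exact hc (add_right_cancel (add_right_cancel h)).symm
  have h3 : coeff η (vdm N * eigChar T (casimirEig μ)) =
      ((Equiv.Perm.sign (Fin.revPerm (n := N)) : ℤ) : ℂ) *
        (Module.finrank ℂ (hwSpace (fun _ => 0) T (· < ·) μ) : ℂ) := by
    rw [coeff_vdm_mul_eigChar, Finset.sum_eq_single Fin.revPerm]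
    · rw [if_pos, hsub]
      · have : (fun A => shifted μ A - ((Fin.revPerm A : Fin N) : ℕ)) = μ := by
          funext A
          rw [Fin.revPerm_apply, Fin.val_rev, shifted]
          omega
        rw [this, eigWt_eq_hwSpace hμ hL]
      · rw [hle]
        intro A
        rw [Fin.revPerm_apply, Fin.val_rev, shifted]
        omega
    · intro σ _ hσ
      split_ifs with hσl
      · rw [hle] at hσl
        by_cases hb : eigWt T (casimirEig μ) ⇑(η - permExp σ) = ⊥
        · rw [hb, finrank_bot, Nat.cast_zero, mul_zero]
        refine absurd ?_ hσ
        rw [hsub] at hb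
        have h4 := weight_eq hμ hL hb (by
          have h5 := sum_perm_mul_shifted_le hμ σ
          have h6 : ∑ A, (shifted μ A - σ A) * shifted μ A + ∑ A, (σ A : ℕ) * shifted μ A =
              ∑ A, μ A * shifted μ A + ∑ A : Fin N, (N - 1 - A) * shifted μ A := by
            rw [← Finset.sum_add_distrib, ← Finset.sum_add_distrib]
            refine Finset.sum_congr rfl fun A _ => ?_
            rw [← add_mul, Nat.sub_add_cancel (hσl A), ← add_mul]
            rfl
          omega)
        ext A
        have h7 := congrFun h4 A
        have h8 := hσl A
        rw [Fin.revPerm_apply, Fin.val_rev]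
        simp only [shifted] at h7 h8
        omega
      · rw [mul_zero]
    · intro h; exact absurd (Finset.mem_univ _) h
  rw [h2, h3] at h1
  exact_mod_cast h1.symm

end HighestWeights

section MultisetCounting

/-- Multisets of `n` natural numbers with sum `j`, without repetitions if `c` holds. -/
def sumMultisets (c : Prop) (n j : ℕ) : Set (Multiset ℕ) :=
  {s | s.card = n ∧ s.sum = j ∧ (c → s.Nodup)}

theorem finite_sumMultisets (c : Prop) (n j : ℕ) : (sumMultisets c n j).Finite := by
  refine (Set.finite_Iic (n • (Multiset.range (j + 1)))).subset ?_
  rintro s ⟨h1, h2, -⟩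
  rw [Set.mem_Iic, Multiset.le_iff_count]
  intro a
  by_cases ha : a ∈ s
  · have h3 : a ≤ j := h2 ▸ Multiset.le_sum_of_mem ha
    rw [Multiset.count_nsmul, Multiset.count_eq_one_of_mem (Multiset.nodup_range _)
      (Multiset.mem_range.2 (by omega)), mul_one, ← h1]
    exact Multiset.count_le_card _ _
  · rw [Multiset.count_eq_zero_of_notMem ha]; exact Nat.zero_le _

theorem sum_map_succ (s : Multiset ℕ) : (s.map Nat.succ).sum = s.sum + s.card := by
  induction s using Multiset.induction_on with
  | empty => rfl
  | cons a s ih => simp only [Multiset.map_cons, Multiset.sum_cons, Multiset.card_cons, ih]; omega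

theorem exists_map_succ {s : Multiset ℕ} (h : 0 ∉ s) : ∃ t : Multiset ℕ, t.map Nat.succ = s := by
  refine ⟨s.map Nat.pred, ?_⟩
  rw [Multiset.map_map]
  conv_rhs => rw [← Multiset.map_id s]
  refine Multiset.map_congr rfl fun a ha => ?_
  exact Nat.succ_pred_eq_of_ne_zero fun h0 => h (h0 ▸ ha)

theorem map_succ_mem_sumMultisets {c : Prop} {n j : ℕ} {t : Multiset ℕ} :
    t.map Nat.succ ∈ sumMultisets c n j ↔ n ≤ j ∧ t ∈ sumMultisets c n (j - n) := by
  simp only [sumMultisets, Set.mem_ofPred_eq, Multiset.card_map, sum_map_succ,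
    Multiset.nodup_map_iff_of_injective Nat.succ_injective]
  constructor
  · rintro ⟨h1, h2, h3⟩; exact ⟨by omega, h1, by omega, h3⟩
  · rintro ⟨h0, h1, h2, h3⟩; exact ⟨h1, by omega, h3⟩

theorem map_succ_injective : Function.Injective (Multiset.map Nat.succ) :=
  Multiset.map_injective Nat.succ_injective

theorem ncard_sumMultisets_split (c : Prop) (n j : ℕ) :
    (sumMultisets c n j).ncard = {s ∈ sumMultisets c n j | 0 ∈ s}.ncard +
      if n ≤ j then (sumMultisets c n (j - n)).ncard else 0 := by
  have hfin := finite_sumMultisets c n j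
  have h1 : sumMultisets c n j = {s ∈ sumMultisets c n j | 0 ∈ s} ∪
      {s ∈ sumMultisets c n j | 0 ∉ s} := by
    ext s; simp only [Set.mem_union, Set.mem_ofPred_eq]; tauto
  have h2 : {s ∈ sumMultisets c n j | 0 ∉ s} =
      if n ≤ j then Multiset.map Nat.succ '' sumMultisets c n (j - n) else ∅ := by
    ext s
    constructor
    · rintro ⟨hs, h0⟩
      obtain ⟨t, rfl⟩ := exists_map_succ h0
      obtain ⟨h3, h4⟩ := map_succ_mem_sumMultisets.1 hs
      rw [if_pos h3]
      exact ⟨t, h4, rfl⟩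
    · split_ifs with h3
      · rintro ⟨t, h4, rfl⟩
        exact ⟨map_succ_mem_sumMultisets.2 ⟨h3, h4⟩, by simp⟩
      · exact fun h => absurd h (Set.notMem_empty _)
  conv_lhs => rw [h1]
  rw [Set.ncard_union_eq _ (hfin.subset fun _ h => h.1) (hfin.subset fun _ h => h.1), h2]
  · congr 1
    split_ifs
    · exact Set.ncard_image_of_injective _ map_succ_injective
    · exact Set.ncard_empty _
  · rw [Set.disjoint_left]
    exact fun s hs hs' => hs'.2 hs.2

theorem ncard_sumMultisets_false_succ (n j : ℕ) : (sumMultisets False (n + 1) j).ncard =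
    (sumMultisets False n j).ncard +
      if n + 1 ≤ j then (sumMultisets False (n + 1) (j - (n + 1))).ncard else 0 := by
  rw [ncard_sumMultisets_split]
  congr 1
  rw [← Set.ncard_image_of_injective (sumMultisets False n j) (f := fun t => 0 ::ₘ t)
    fun a b h => Multiset.cons_inj_right 0 |>.1 h]
  congr 1
  ext s
  constructor
  · rintro ⟨⟨h1, h2, -⟩, h0⟩
    obtain ⟨t, rfl⟩ := Multiset.exists_cons_of_mem h0
    exact ⟨t, ⟨by simpa using h1, by simpa using h2, False.elim⟩, rfl⟩
  · rintro ⟨t, ⟨h1, h2, -⟩, rfl⟩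
    exact ⟨⟨by simpa using h1, by simpa using h2, False.elim⟩, by simp⟩

theorem ncard_sumMultisets_true_succ (n j : ℕ) : (sumMultisets True (n + 1) j).ncard =
    (if n ≤ j then (sumMultisets True n (j - n)).ncard else 0) +
      if n + 1 ≤ j then (sumMultisets True (n + 1) (j - (n + 1))).ncard else 0 := by
  rw [ncard_sumMultisets_split]
  congr 1
  have : {s ∈ sumMultisets True (n + 1) j | 0 ∈ s} = if n ≤ j then
      (fun t : Multiset ℕ => 0 ::ₘ t.map Nat.succ) '' sumMultisets True n (j - n) else ∅ := by
    ext s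
    constructor
    · rintro ⟨⟨h1, h2, h3⟩, h0⟩
      obtain ⟨t, rfl⟩ := Multiset.exists_cons_of_mem h0
      have h4 := Multiset.nodup_cons.1 (h3 trivial)
      obtain ⟨u, rfl⟩ := exists_map_succ h4.1
      have h5 : u.map Nat.succ ∈ sumMultisets True n j :=
        ⟨by simpa using h1, by simpa using h2, fun _ => h4.2⟩
      obtain ⟨h6, h7⟩ := map_succ_mem_sumMultisets.1 h5
      rw [if_pos h6]
      exact ⟨u, h7, rfl⟩
    · split_ifs with h6
      · rintro ⟨u, h7, rfl⟩
        obtain ⟨h1, h2, h3⟩ := map_succ_mem_sumMultisets.2 ⟨h6, h7⟩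
        refine ⟨⟨by simpa using h1, by simpa using h2, fun _ => ?_⟩, by simp⟩
        exact Multiset.nodup_cons.2 ⟨by simp, h3 trivial⟩
      · exact fun h => absurd h (Set.notMem_empty _)
  rw [this]
  split_ifs
  · exact Set.ncard_image_of_injective _ fun a b h =>
      map_succ_injective ((Multiset.cons_inj_right 0).1 h)
  · exact Set.ncard_empty _

/-- The generating function of `sumMultisets`. -/
noncomputable def sumSeries (c : Prop) (n : ℕ) : PowerSeries ℚ :=
  PowerSeries.mk fun j => ((sumMultisets c n j).ncard : ℚ)

theorem sumSeries_zero (c : Prop) : sumSeries c 0 = 1 := by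
  ext j
  rw [sumSeries, PowerSeries.coeff_mk, PowerSeries.coeff_one]
  split_ifs with h
  · subst h
    have : sumMultisets c 0 0 = {0} := by
      ext s
      constructor
      · rintro ⟨h1, -, -⟩; exact Multiset.card_eq_zero.1 h1
      · rintro rfl; exact ⟨rfl, rfl, fun _ => Multiset.nodup_zero⟩
    rw [this, Set.ncard_singleton, Nat.cast_one]
  · have : sumMultisets c 0 j = ∅ := by
      ext s
      constructor
      · rintro ⟨h1, h2, -⟩
        rw [Multiset.card_eq_zero.1 h1] at h2
        exact absurd h2.symm h
      · exact fun h => absurd h (Set.notMem_empty _)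
    rw [this, Set.ncard_empty, Nat.cast_zero]

theorem mul_inv_one_sub_X_pow {f g : PowerSeries ℚ} {k : ℕ} (hk : k ≠ 0)
    (h : f = g + PowerSeries.X ^ k * f) : f = g * (1 - PowerSeries.X ^ k)⁻¹ := by
  rw [PowerSeries.eq_mul_inv_iff_mul_eq]
  · linear_combination h
  · simp [hk]

theorem sumSeries_false (n : ℕ) : sumSeries False n =
    ∏ k ∈ Finset.Icc 1 n, (1 - PowerSeries.X ^ k)⁻¹ := by
  induction n with
  | zero => simp [sumSeries_zero]
  | succ n ih =>
    rw [Finset.prod_Icc_succ_top (by omega), ← ih]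
    refine mul_inv_one_sub_X_pow (by omega) ?_
    ext j
    rw [map_add, PowerSeries.coeff_X_pow_mul']
    simp only [sumSeries, PowerSeries.coeff_mk]
    rw [ncard_sumMultisets_false_succ]
    push_cast
    rfl

theorem triangle_succ (n : ℕ) : (n + 1) * (n + 1 - 1) / 2 = n * (n - 1) / 2 + n := by
  rw [← Finset.sum_range_id, ← Finset.sum_range_id, Finset.sum_range_succ]

theorem sumSeries_true (n : ℕ) : sumSeries True n =
    PowerSeries.X ^ (n * (n - 1) / 2) * ∏ k ∈ Finset.Icc 1 n, (1 - PowerSeries.X ^ k)⁻¹ := by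
  induction n with
  | zero => simp [sumSeries_zero]
  | succ n ih =>
    have : sumSeries True (n + 1) =
        (PowerSeries.X ^ n * sumSeries True n) * (1 - PowerSeries.X ^ (n + 1))⁻¹ := by
      refine mul_inv_one_sub_X_pow (by omega) ?_
      ext j
      rw [map_add, PowerSeries.coeff_X_pow_mul', PowerSeries.coeff_X_pow_mul']
      simp only [sumSeries, PowerSeries.coeff_mk]
      rw [ncard_sumMultisets_true_succ]
      push_cast
      rfl
    rw [this, ih, Finset.prod_Icc_succ_top (by omega), triangle_succ, pow_add]
    ring

variable {ι : Type*} [Fintype ι] [DecidableEq ι]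

/-- Families of multisets with prescribed cardinalities and prescribed total sum. -/
def multisetFamilies (c : ι → Prop) (w : ι → ℕ) (k : ℕ) : Set (ι → Multiset ℕ) :=
  {F | (∀ A, (F A).card = w A ∧ (c A → (F A).Nodup)) ∧ ∑ A, (F A).sum = k}

theorem multisetFamilies_eq (c : ι → Prop) (w : ι → ℕ) (k : ℕ) : multisetFamilies c w k =
    ↑((Finset.piAntidiag Finset.univ k).biUnion fun l : ι → ℕ =>
      Fintype.piFinset fun A => (finite_sumMultisets (c A) (w A) (l A)).toFinset) := by
  ext F
  simp only [multisetFamilies, Set.mem_ofPred_eq, Finset.coe_biUnion, Set.mem_iUnion,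
    Finset.mem_coe, Fintype.mem_piFinset, Set.Finite.mem_toFinset, exists_prop]
  constructor
  · rintro ⟨h1, h2⟩
    exact ⟨fun A => (F A).sum, by simp [h2], fun A => ⟨(h1 A).1, rfl, (h1 A).2⟩⟩
  · rintro ⟨l, hl, h⟩
    refine ⟨fun A => ⟨(h A).1, (h A).2.2⟩, ?_⟩
    rw [Finset.sum_congr rfl fun A _ => (h A).2.1]
    simpa using hl

theorem finite_multisetFamilies (c : ι → Prop) (w : ι → ℕ) (k : ℕ) :
    (multisetFamilies c w k).Finite := by
  rw [multisetFamilies_eq]; exact Finset.finite_toSet _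

theorem ncard_multisetFamilies (c : ι → Prop) (w : ι → ℕ) (k : ℕ) :
    ((multisetFamilies c w k).ncard : ℚ) =
      PowerSeries.coeff k (∏ A, sumSeries (c A) (w A)) := by
  rw [multisetFamilies_eq, Set.ncard_coe_finset, Finset.card_biUnion, PowerSeries.coeff_prod,
    Nat.cast_sum]
  · refine Finset.sum_bij' (fun l _ => Finsupp.equivFunOnFinite.symm l) (fun l _ => ⇑l) ?_ ?_ ?_ ?_
      ?_
    · intro l hl; simpa using hl
    · intro l hl; simpa using hl
    · intro l _; rfl
    · intro l _; ext; rfl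
    · intro l _
      rw [Fintype.card_piFinset, Nat.cast_prod]
      refine Finset.prod_congr rfl fun A _ => ?_
      rw [sumSeries, PowerSeries.coeff_mk, Set.ncard_eq_toFinset_card _ (finite_sumMultisets _ _ _)]
      rfl
  · intro l _ l' _ hne
    rw [Function.onFun, Finset.disjoint_left]
    intro F hF hF'
    refine hne (funext fun A => ?_)
    have h1 := (Set.Finite.mem_toFinset _).1 (Fintype.mem_piFinset.1 hF A)
    have h2 := (Set.Finite.mem_toFinset _).1 (Fintype.mem_piFinset.1 hF' A)
    rw [← h1.2.1, ← h2.2.1]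

/-- The multiset of pairs associated with a family of multisets. -/
def joinFamily (F : ι → Multiset ℕ) : Multiset (ι × ℕ) := ∑ A, (F A).map (Prod.mk A)

/-- The family of multisets associated with a multiset of pairs. -/
def splitFamily (s : Multiset (ι × ℕ)) (A : ι) : Multiset ℕ :=
  (s.filter fun b => b.1 = A).map Prod.snd

theorem count_splitFamily (s : Multiset (ι × ℕ)) (A : ι) (x : ℕ) :
    (splitFamily s A).count x = s.count (A, x) := by
  rw [splitFamily, Multiset.count_map, Multiset.filter_filter, Multiset.count,
    Multiset.countP_eq_card_filter]
  congr 1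
  refine Multiset.filter_congr fun b _ => ?_
  rw [Prod.ext_iff]
  exact ⟨fun h => ⟨h.2.symm, h.1⟩, fun h => ⟨h.2, h.1.symm⟩⟩

theorem count_joinFamily (F : ι → Multiset ℕ) (A : ι) (x : ℕ) :
    (joinFamily F).count (A, x) = (F A).count x := by
  rw [joinFamily, Multiset.count_sum', Finset.sum_eq_single A]
  · exact Multiset.count_map_eq_count' _ _ (Prod.mk_right_injective A) x
  · intro B _ hB
    rw [Multiset.count_eq_zero]
    intro h
    obtain ⟨y, -, hy⟩ := Multiset.mem_map.1 h
    exact hB (congrArg Prod.fst hy)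
  · intro h; exact absurd (Finset.mem_univ _) h

theorem splitFamily_joinFamily (F : ι → Multiset ℕ) : splitFamily (joinFamily F) = F := by
  funext A
  ext x
  rw [count_splitFamily, count_joinFamily]

theorem joinFamily_splitFamily (s : Multiset (ι × ℕ)) : joinFamily (splitFamily s) = s := by
  ext ⟨A, x⟩
  rw [count_joinFamily, count_splitFamily]

theorem card_joinFamily (F : ι → Multiset ℕ) : (joinFamily F).card = ∑ A, (F A).card := by
  simp [joinFamily, Multiset.card_sum]

theorem sum_map_snd_joinFamily (F : ι → Multiset ℕ) :
    ((joinFamily F).map Prod.snd).sum = ∑ A, (F A).sum := by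
  have : (joinFamily F).map Prod.snd = ∑ A, F A := by
    rw [joinFamily, ← Multiset.coe_mapAddMonoidHom, map_sum]
    simp
  rw [this, ← Multiset.coe_sumAddMonoidHom, map_sum]

end MultisetCounting

section AdjacentSwaps

variable {L : ℕ}

/-- Induction along products of adjacent transpositions. -/
theorem perm_induction_siteSwap {P : Equiv.Perm (Fin L) → Prop} (one : P 1)
    (mul : ∀ σ l h, P σ → P (σ * siteSwap l h)) (σ : Equiv.Perm (Fin L)) : P σ := by
  obtain _ | n := L
  · rwa [Subsingleton.elim σ 1]
  · have hσ : σ ∈ Submonoid.closure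
        (Set.range fun i : Fin n => Equiv.swap i.castSucc i.succ) := by
      rw [Equiv.Perm.mclosure_swap_castSucc_succ]; exact Submonoid.mem_top _
    induction hσ using Submonoid.closure_induction_right with
    | one => exact one
    | mul_right x hx y hy ih =>
      obtain ⟨i, rfl⟩ := hy
      exact mul x i (by omega) ih

/-- A product over pairs of sites, after an adjacent transposition. -/
theorem prod_ltPairs_siteSwap {R : Type*} [CommMonoid R] (F : Fin L → Fin L → R) (l : ℕ)
    (h : l + 1 < L) : ∏ q ∈ ltPairs L, F (siteSwap l h q.1) (siteSwap l h q.2) =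
      F (siteR l h) (siteL l h) *
        ∏ q ∈ (ltPairs L).erase (siteL l h, siteR l h), F q.1 q.2 := by
  have hm : (siteL l h, siteR l h) ∈ ltPairs L := by
    simp [ltPairs]
  rw [← Finset.mul_prod_erase _ _ hm, siteSwap_siteL, siteSwap_siteR]
  congr 1
  have key : ∀ q ∈ (ltPairs L).erase (siteL l h, siteR l h),
      (siteSwap l h q.1, siteSwap l h q.2) ∈ (ltPairs L).erase (siteL l h, siteR l h) := by
    rintro ⟨i, j⟩ hq
    have hs : ∀ k : Fin L, (k = siteL l h ∧ siteSwap l h k = siteR l h) ∨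
        (k = siteR l h ∧ siteSwap l h k = siteL l h) ∨
        (k ≠ siteL l h ∧ k ≠ siteR l h ∧ siteSwap l h k = k) := by
      intro k
      by_cases h1 : k = siteL l h
      · exact Or.inl ⟨h1, by rw [h1, siteSwap_siteL]⟩
      by_cases h2 : k = siteR l h
      · exact Or.inr (Or.inl ⟨h2, by rw [h2, siteSwap_siteR]⟩)
      · exact Or.inr (Or.inr ⟨h1, h2, siteSwap_apply_of_ne l h h1 h2⟩)
    simp only [ltPairs, Finset.mem_erase, Finset.mem_filter, Finset.mem_univ, true_and, ne_eq,
      Prod.mk.injEq] at hq ⊢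
    have hi := hs i
    have hj := hs j
    simp only [Fin.ext_iff, Fin.lt_def] at *
    omega
  refine Finset.prod_bij' (fun q _ => (siteSwap l h q.1, siteSwap l h q.2))
    (fun q _ => (siteSwap l h q.1, siteSwap l h q.2)) key key ?_ ?_ ?_
  · intro q _; simp
  · intro q _; simp
  · intro q _; rfl

theorem prod_ltPairs_eq_mul_erase {R : Type*} [CommMonoid R] (F : Fin L → Fin L → R) (l : ℕ)
    (h : l + 1 < L) : ∏ q ∈ ltPairs L, F q.1 q.2 = F (siteL l h) (siteR l h) *
        ∏ q ∈ (ltPairs L).erase (siteL l h, siteR l h), F q.1 q.2 :=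
  (Finset.mul_prod_erase _ (fun q : Fin L × Fin L => F q.1 q.2)
    (a := (siteL l h, siteR l h)) (by simp [ltPairs])).symm

end AdjacentSwaps

section SortSign

variable {X : Type*} (p r : X → ℕ) {L : ℕ}

/-- The sign contributed by a pair of letters which is not in the order given by `r`. -/
def pairSign (x y : X) : ℂ := if r y < r x then (-1) ^ (p x * p y) else 1

theorem pairSign_mul_self (x y : X) : pairSign p r x y * pairSign p r x y = 1 := by
  rw [pairSign]
  split_ifs
  · rw [← pow_add, ← two_mul, pow_mul]; simp
  · simp

/-- The sign obtained when a word is sorted with respect to `r`. -/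
def sortSign (z : Fin L → X) : ℂ := ∏ q ∈ ltPairs L, pairSign p r (z q.1) (z q.2)

theorem sortSign_mul_self (z : Fin L → X) : sortSign p r z * sortSign p r z = 1 := by
  rw [sortSign, ← Finset.prod_mul_distrib]
  exact Finset.prod_eq_one fun q _ => pairSign_mul_self p r _ _

theorem sortSign_comp_siteSwap (z : Fin L → X) (l : ℕ) (h : l + 1 < L)
    (hz : Odd (p (z (siteL l h)) * p (z (siteR l h))) → r (z (siteL l h)) ≠ r (z (siteR l h))) :
    sortSign p r (z ∘ siteSwap l h) = swapSign p l h z * sortSign p r z := by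
  rw [sortSign, sortSign, prod_ltPairs_eq_mul_erase (fun i j => pairSign p r (z i) (z j)) l h]
  simp only [Function.comp_apply]
  rw [prod_ltPairs_siteSwap (fun i j => pairSign p r (z i) (z j)) l h, ← mul_assoc]
  congr 1
  rw [swapSign, pairSign, pairSign, mul_comm (p (z (siteR l h)))]
  rcases Nat.even_or_odd (p (z (siteL l h)) * p (z (siteR l h))) with he | ho
  · simp [he.neg_one_pow]
  · have := hz ho
    rw [ho.neg_one_pow]
    rcases this.lt_or_gt with h1 | h1
    · rw [if_pos h1, if_neg h1.not_gt]; norm_num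
    · rw [if_neg h1.not_gt, if_pos h1]; norm_num

end SortSign

section SymFun

variable {X : Type*} (p : X → ℕ) {L : ℕ}

/-- The multiset of letters of a word. -/
def letters (z : Fin L → X) : Multiset X := Finset.univ.val.map z

theorem letters_comp (z : Fin L → X) (σ : Equiv.Perm (Fin L)) : letters (z ∘ σ) = letters z := by
  rw [letters, letters, ← Multiset.map_map]
  congr 1
  have := congrArg Finset.val (Finset.map_univ_equiv σ)
  rwa [Finset.map_val] at this

theorem card_letters (z : Fin L → X) : (letters z).card = L := by simp [letters]

theorem exists_letters_eq (s : Multiset X) (h : s.card = L) : ∃ z : Fin L → X, letters z = s := by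
  obtain ⟨l, rfl⟩ := Quot.exists_rep s
  have h : l.length = L := h
  subst h
  refine ⟨l.get, ?_⟩
  rw [letters, Fin.univ_val_map]
  simp

theorem exists_perm_of_letters_eq {z z' : Fin L → X} (h : letters z = letters z') :
    ∃ σ : Equiv.Perm (Fin L), z = z' ∘ σ := by
  classical
  have hc : ∀ (y : Fin L → X) (x : X), (letters y).count x = Fintype.card {i // y i = x} := by
    intro y x
    rw [letters, Multiset.count_map, Fintype.card_subtype, Finset.card_def, Finset.filter_val]
    simp only [eq_comm]
  have e : ∀ x, Nonempty ({i // z i = x} ≃ {i // z' i = x}) := fun x =>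
    Fintype.card_eq.1 (by rw [← hc, ← hc, h])
  refine ⟨Equiv.ofFiberEquiv fun x => (e x).some, ?_⟩
  funext i
  exact (Equiv.ofFiberEquiv_map (fun x => (e x).some) i).symm

/-- Functions on words in `Ω` which are symmetric in the graded sense. -/
def symFun (Ω : Set (Multiset X)) (L : ℕ) : Submodule ℂ ((Fin L → X) → ℂ) where
  carrier := {V | (∀ l h z, swapSign p l h z * V (z ∘ siteSwap l h) = V z) ∧
    ∀ z, V z ≠ 0 → letters z ∈ Ω}
  zero_mem' := ⟨fun l h z => by simp, fun z h => absurd rfl h⟩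
  add_mem' := fun {V W} hV hW => ⟨fun l h z => by
    rw [Pi.add_apply, mul_add, hV.1, hW.1, Pi.add_apply], fun z h => by
    by_contra hc
    exact h (by rw [Pi.add_apply, not_not.1 (mt (hV.2 z) hc), not_not.1 (mt (hW.2 z) hc),
      add_zero])⟩
  smul_mem' := fun c V hV => ⟨fun l h z => by
    rw [Pi.smul_apply, mul_smul_comm, hV.1, Pi.smul_apply], fun z h => hV.2 z fun h0 => h (by
      rw [Pi.smul_apply, h0, smul_zero])⟩

variable {p} {Ω : Set (Multiset X)} {V : (Fin L → X) → ℂ}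

theorem symFun_comp_eq_zero (hV : V ∈ symFun p Ω L) {z : Fin L → X} (hz : V z = 0)
    (σ : Equiv.Perm (Fin L)) : V (z ∘ σ) = 0 := by
  refine perm_induction_siteSwap (P := fun σ => V (z ∘ σ) = 0) hz (fun σ l h ih => ?_) σ
  have h1 := hV.1 l h (z ∘ σ)
  rw [ih] at h1
  refine (mul_eq_zero.1 h1).resolve_left fun h0 => ?_
  classical
  have := swapSign_mul_self p l h (z ∘ σ)
  rw [h0, mul_zero] at this
  exact zero_ne_one this

theorem symFun_eq_zero_of_eq (hV : V ∈ symFun p Ω L) {z : Fin L → X} {i j : Fin L} (hij : i ≠ j)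
    (he : z i = z j) (ho : Odd (p (z i))) : V z = 0 := by
  have hL : 0 + 1 < L := by
    have := i.2; have := j.2
    have : (i : ℕ) ≠ j := fun h => hij (Fin.ext h)
    omega
  obtain ⟨σ, h1, h2⟩ : ∃ σ : Equiv.Perm (Fin L), σ (siteL 0 hL) = i ∧ σ (siteR 0 hL) = j := by
    refine ⟨Equiv.swap (Equiv.swap (siteL 0 hL) i (siteR 0 hL)) j * Equiv.swap (siteL 0 hL) i,
      ?_, ?_⟩
    · rw [Equiv.Perm.mul_apply, Equiv.swap_apply_left, Equiv.swap_apply_of_ne_of_ne _ hij]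
      intro h
      have := (Equiv.swap (siteL 0 hL) i).injective
        (h.symm.trans (Equiv.swap_apply_left (siteL 0 hL) i).symm)
      exact siteL_ne_siteR 0 hL this.symm
    · rw [Equiv.Perm.mul_apply, Equiv.swap_apply_left]
  have h3 : (z ∘ σ) ∘ siteSwap 0 hL = z ∘ σ := by
    funext k
    by_cases hk : k = siteL 0 hL
    · subst hk; simp only [Function.comp_apply, siteSwap_siteL, h1, h2, he]
    by_cases hk' : k = siteR 0 hL
    · subst hk'; simp only [Function.comp_apply, siteSwap_siteR, h1, h2, he]
    · simp only [Function.comp_apply, siteSwap_apply_of_ne 0 hL hk hk']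
  have h4 := hV.1 0 hL (z ∘ σ)
  have h5 : swapSign p 0 hL (z ∘ σ) = -1 := by
    rw [swapSign, Function.comp_apply, Function.comp_apply, h1, h2, ← he]
    exact (ho.mul ho).neg_one_pow
  rw [h3, h5] at h4
  have h6 : V (z ∘ σ) = 0 := by linear_combination (-1 / 2 : ℂ) * h4
  have h7 := symFun_comp_eq_zero hV h6 σ⁻¹
  have h8 : (z ∘ σ) ∘ ⇑σ⁻¹ = z := by funext k; simp
  rwa [h8] at h7

theorem two_le_count_letters [DecidableEq X] {z : Fin L → X} {x : X}
    (h : ¬ (letters z).count x ≤ 1) : ∃ i j, i ≠ j ∧ z i = x ∧ z j = x := by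
  rw [letters, Multiset.count_map, ← Finset.filter_val, ← Finset.card_def] at h
  obtain ⟨i, hi, j, hj, hij⟩ := Finset.one_lt_card.1 (not_le.1 h)
  exact ⟨i, j, hij, (Finset.mem_filter.1 hi).2.symm, (Finset.mem_filter.1 hj).2.symm⟩

theorem count_letters_two_le [DecidableEq X] {z : Fin L → X} {i j : Fin L} (hij : i ≠ j)
    (h : z i = z j) : ¬ (letters z).count (z i) ≤ 1 := by
  rw [letters, Multiset.count_map, ← Finset.filter_val, ← Finset.card_def, not_le]
  exact Finset.one_lt_card.2 ⟨i, by simp, j, by simp [h], hij⟩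

theorem finrank_symFun [Countable X] [DecidableEq X] (hΩ : ∀ s ∈ Ω, s.card = L)
    (hfin : {s ∈ Ω | ∀ x, Odd (p x) → s.count x ≤ 1}.Finite) :
    Module.finrank ℂ (symFun p Ω L) = {s ∈ Ω | ∀ x, Odd (p x) → s.count x ≤ 1}.ncard := by
  set Ω' := {s ∈ Ω | ∀ x, Odd (p x) → s.count x ≤ 1} with hΩ'
  have hex : ∀ s : Ω', ∃ z : Fin L → X, letters z = s := fun s =>
    exists_letters_eq _ (hΩ _ s.2.1)
  choose rep hrep using hex
  obtain ⟨r, hr⟩ := Countable.exists_injective_nat X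
  let ev : symFun p Ω L →ₗ[ℂ] (Ω' → ℂ) :=
    (LinearMap.funLeft ℂ ℂ rep) ∘ₗ (symFun p Ω L).subtype
  have hev : Function.Bijective ev := by
    constructor
    · rw [← LinearMap.ker_eq_bot, LinearMap.ker_eq_bot']
      rintro ⟨V, hV⟩ h0
      have h0 : ∀ s, V (rep s) = 0 := fun s => congrFun h0 s
      refine Subtype.ext (funext fun z => ?_)
      change V z = 0
      by_contra hz
      have h1 : letters z ∈ Ω' := by
        refine ⟨hV.2 z hz, fun x hx => ?_⟩
        by_contra hc
        obtain ⟨i, j, hij, rfl, hj⟩ := two_le_count_letters hc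
        exact hz (symFun_eq_zero_of_eq hV hij hj.symm hx)
      obtain ⟨σ, hσ⟩ := exists_perm_of_letters_eq (hrep ⟨_, h1⟩).symm
      exact hz (hσ ▸ symFun_comp_eq_zero hV (h0 _) σ)
    · intro c
      classical
      let V : (Fin L → X) → ℂ := fun z => if h : letters z ∈ Ω' then
        c ⟨letters z, h⟩ * sortSign p r z * sortSign p r (rep ⟨letters z, h⟩) else 0
      have hV : V ∈ symFun p Ω L := by
        constructor
        · intro l h z
          by_cases hz : letters z ∈ Ω'
          · have hz' : letters (z ∘ siteSwap l h) ∈ Ω' := by rwa [letters_comp]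
            simp only [V]
            rw [dif_pos hz, dif_pos hz', sortSign_comp_siteSwap]
            · simp only [letters_comp]
              linear_combination (c ⟨letters z, hz⟩ * sortSign p r z *
                sortSign p r (rep ⟨letters z, hz⟩)) * swapSign_mul_self p l h z
            · intro ho he
              refine count_letters_two_le (siteL_ne_siteR l h) (hr he)
                (hz.2 _ (Nat.odd_mul.1 ho).1)
          · have hz' : letters (z ∘ siteSwap l h) ∉ Ω' := by rwa [letters_comp]
            simp only [V]
            rw [dif_neg hz, dif_neg hz', mul_zero]
        · intro z hz
          by_contra hc
          exact hz (dif_neg fun h => hc h.1)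
      refine ⟨⟨V, hV⟩, funext fun s => ?_⟩
      change V (rep s) = c s
      have h1 : letters (rep s) ∈ Ω' := by rw [hrep]; exact s.2
      have h2 : (⟨letters (rep s), h1⟩ : Ω') = s := Subtype.ext (hrep s)
      simp only [V]
      rw [dif_pos h1, h2]
      linear_combination (c s) * sortSign_mul_self p r (rep s)
  have := hfin.fintype
  rw [(LinearEquiv.ofBijective ev hev).finrank_eq, Module.finrank_pi, Set.ncard_eq_toFinset_card',
    Set.toFinset_card]

end SymFun

section Homogeneous

variable (L k : ℕ)

/-- Homogeneous polynomials of degree `k` in `θ_1, …, θ_L`. -/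
abbrev Homog : Submodule ℂ (PolyTheta L) := MvPolynomial.homogeneousSubmodule (Fin L) ℂ k

instance : FiniteDimensional ℂ (Homog L k) :=
  Module.Finite.iff_fg.2 (by apply MvPolynomial.homogeneousSubmodule_fg)

variable {L}

theorem varSwap_mem_homog {l : ℕ} {h : l + 1 < L} {f : PolyTheta L} (hf : f ∈ Homog L k) :
    varSwap l h f ∈ Homog L k :=
  MvPolynomial.IsHomogeneous.rename_isHomogeneous hf

/-- The exchange of two neighbouring variables on homogeneous polynomials. -/
noncomputable def homogSwap (l : ℕ) (h : l + 1 < L) : Homog L k →ₗ[ℂ] Homog L k :=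
  (varSwap l h).toLinearMap.restrict fun _ hf => varSwap_mem_homog k hf

/-- The exchanges of neighbouring variables on homogeneous polynomials. -/
def homogOps (L k : ℕ) (l : ℕ) (h : l + 1 < L) : Set (Homog L k →ₗ[ℂ] Homog L k) :=
  {homogSwap k l h}

theorem coeff_varSwap (l : ℕ) (h : l + 1 < L) (f : PolyTheta L) (d : Fin L →₀ ℕ) :
    (varSwap l h f).coeff d = f.coeff (d.equivMapDomain (siteSwap l h)) := by
  have : d = (d.equivMapDomain (siteSwap l h)).mapDomain (siteSwap l h) := by
    rw [← Finsupp.equivMapDomain_eq_mapDomain]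
    ext i
    simp [Finsupp.equivMapDomain_apply, siteSwap]
  conv_lhs => rw [this]
  exact MvPolynomial.coeff_rename_mapDomain _ (siteSwap l h).injective _ _

variable {ι : Type*} [Fintype ι] [DecidableEq ι] (p : ι → ℕ) (w : ι → ℕ)

/-- The multisets of pairs (letter, exponent) of size `L` with content `w` and degree `k`. -/
def pairMultisets (L k : ℕ) (w : ι → ℕ) : Set (Multiset (ι × ℕ)) :=
  {s | s.card = L ∧ (∀ A, (splitFamily s A).card = w A) ∧ (s.map Prod.snd).sum = k}

theorem card_splitFamily_letters (z : Fin L → ι × ℕ) (A : ι) :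
    (splitFamily (letters z) A).card = content (Prod.fst ∘ z) A := by
  rw [splitFamily, Multiset.card_map, letters, Multiset.filter_map, Multiset.card_map, content,
    Finset.card_def, Finset.filter_val]
  rfl

theorem sum_snd_letters (z : Fin L → ι × ℕ) :
    ((letters z).map Prod.snd).sum =
      (Finsupp.equivFunOnFinite.symm (Prod.snd ∘ z) : Fin L →₀ ℕ).degree := by
  rw [letters, Multiset.map_map, Finsupp.degree_eq_sum]
  rfl

theorem letters_mem_pairMultisets {z : Fin L → ι × ℕ} : letters z ∈ pairMultisets L k w ↔
    content (Prod.fst ∘ z) = w ∧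
      (Finsupp.equivFunOnFinite.symm (Prod.snd ∘ z) : Fin L →₀ ℕ).degree = k := by
  simp only [pairMultisets, Set.mem_ofPred_eq, card_letters, true_and, card_splitFamily_letters,
    sum_snd_letters, funext_iff]

theorem ncard_pairMultisets (hw : ∑ A, w A = L) :
    {s ∈ pairMultisets L k w | ∀ x : ι × ℕ, Odd (p x.1) → s.count x ≤ 1}.ncard =
      (multisetFamilies (fun A => Odd (p A)) w k).ncard := by
  rw [← Set.ncard_image_of_injective (multisetFamilies _ w k)
    (Function.LeftInverse.injective splitFamily_joinFamily)]
  congr 1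
  ext s
  constructor
  · rintro ⟨⟨h1, h2, h3⟩, h4⟩
    refine ⟨splitFamily s, ⟨fun A => ⟨h2 A, fun hA => ?_⟩, ?_⟩, joinFamily_splitFamily s⟩
    · rw [Multiset.nodup_iff_count_le_one]
      intro x
      rw [count_splitFamily]
      exact h4 _ hA
    · rw [← sum_map_snd_joinFamily, joinFamily_splitFamily, h3]
  · rintro ⟨F, ⟨h1, h2⟩, rfl⟩
    refine ⟨⟨?_, fun A => ?_, ?_⟩, ?_⟩
    · rw [card_joinFamily, ← hw]
      exact Finset.sum_congr rfl fun A _ => (h1 A).1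
    · rw [splitFamily_joinFamily, (h1 A).1]
    · rw [sum_map_snd_joinFamily, h2]
    · rintro ⟨A, x⟩ hA
      rw [count_joinFamily]
      exact Multiset.nodup_iff_count_le_one.1 ((h1 A).2 hA) x

theorem finite_pairMultisets (L k : ℕ) (w : ι → ℕ) :
    {s ∈ pairMultisets L k w | ∀ x : ι × ℕ, Odd (p x.1) → s.count x ≤ 1}.Finite := by
  refine (((finite_multisetFamilies (fun _ : ι => False) w k).image joinFamily)).subset ?_
  rintro s ⟨⟨h1, h2, h3⟩, -⟩
  refine ⟨splitFamily s, ⟨fun A => ⟨h2 A, False.elim⟩, ?_⟩, joinFamily_splitFamily s⟩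
  rw [← sum_map_snd_joinFamily, joinFamily_splitFamily, h3]

theorem superInv_homogOps_comp {v : (Fin L → ι) → Homog L k}
    (hv : v ∈ superInv p (homogOps L k)) (l : ℕ) (h : l + 1 < L) (J : Fin L → ι)
    (d : Fin L →₀ ℕ) :
    swapSign p l h J * (v (J ∘ siteSwap l h)).1.coeff (d.equivMapDomain (siteSwap l h)) =
      (v J).1.coeff d := by
  have h1 := congrArg (fun f : Homog L k => f.1.coeff (d.equivMapDomain (siteSwap l h)))
    (hv l h _ rfl J)
  simp only [Submodule.coe_smul, MvPolynomial.coeff_smul, smul_eq_mul] at h1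
  rw [h1]
  change (varSwap l h (v J).1).coeff _ = _
  rw [coeff_varSwap]
  congr 1
  ext i
  simp [Finsupp.equivMapDomain_apply, siteSwap]

/-- The dimension of the space of graded symmetric vectors of given weight and degree. -/
theorem finrank_superInv_homogOps (hw : ∑ A, w A = L) :
    Module.finrank ℂ ↥(superInv p (homogOps L k) ⊓ wtSpace (Homog L k) L w) =
      (multisetFamilies (fun A => Odd (p A)) w k).ncard := by
  rw [← ncard_pairMultisets k p w hw, ← finrank_symFun (p := fun x : ι × ℕ => p x.1)
    (fun s hs => hs.1) (finite_pairMultisets p L k w)]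
  let U := superInv p (homogOps L k) ⊓ wtSpace (Homog L k) L w
  let W := symFun (fun x : ι × ℕ => p x.1) (pairMultisets L k w) L
  let f : ((Fin L → ι) → Homog L k) →ₗ[ℂ] ((Fin L → ι × ℕ) → ℂ) :=
    { toFun := fun v z => (v (Prod.fst ∘ z)).1.coeff (Finsupp.equivFunOnFinite.symm (Prod.snd ∘ z))
      map_add' := fun v v' => by funext z; simp
      map_smul' := fun c v => by funext z; simp }
  have hf : ∀ v ∈ U, f v ∈ W := by
    rintro v ⟨h1, h2⟩
    refine ⟨fun l h z => ?_, fun z hz => ?_⟩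
    · have := superInv_homogOps_comp k p h1 l h (Prod.fst ∘ z)
        (Finsupp.equivFunOnFinite.symm (Prod.snd ∘ z))
      refine Eq.trans ?_ this
      have e : (Finsupp.equivFunOnFinite.symm (Prod.snd ∘ z ∘ siteSwap l h) : Fin L →₀ ℕ) =
          (Finsupp.equivFunOnFinite.symm (Prod.snd ∘ z)).equivMapDomain (siteSwap l h) := by
        ext i
        simp [Finsupp.equivMapDomain_apply, siteSwap]
      rw [← e]
      rfl
    · rw [letters_mem_pairMultisets]
      have hz : (v (Prod.fst ∘ z)).1.coeff (Finsupp.equivFunOnFinite.symm (Prod.snd ∘ z)) ≠ 0 :=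
        hz
      refine ⟨h2 _ fun h0 => hz (by rw [h0]; simp), ?_⟩
      have := (v (Prod.fst ∘ z)).2 hz
      rwa [Finsupp.degree_eq_weight_one]
  let g : U →ₗ[ℂ] W := f.restrict hf
  have hg : Function.Bijective g := by
    constructor
    · rintro ⟨v, hv⟩ ⟨v', hv'⟩ h0
      have h0 : f v = f v' := congrArg Subtype.val h0
      refine Subtype.ext (funext fun J => Subtype.ext (MvPolynomial.ext _ _ fun d => ?_))
      have e : (Finsupp.equivFunOnFinite.symm (Prod.snd ∘ fun i => (J i, d i)) : Fin L →₀ ℕ) = d :=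
        Finsupp.ext fun i => rfl
      have h1 : (v J).1.coeff _ = (v' J).1.coeff _ := congrFun h0 fun i => (J i, d i)
      rwa [e] at h1
    · rintro ⟨V, hV⟩
      let v : (Fin L → ι) → Homog L k := fun J =>
        ⟨∑ d ∈ Finset.finsuppAntidiag Finset.univ k,
          MvPolynomial.monomial d (V fun i => (J i, d i)), Submodule.sum_mem _ fun d hd =>
          MvPolynomial.isHomogeneous_monomial _ (by
            rw [Finsupp.degree_eq_sum]; exact (Finset.mem_finsuppAntidiag.1 hd).1)⟩
      have hz : ∀ (J : Fin L → ι) (d : Fin L →₀ ℕ), (v J).1.coeff d = V fun i => (J i, d i) := by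
        intro J d
        simp only [v, MvPolynomial.coeff_sum, MvPolynomial.coeff_monomial]
        rw [Finset.sum_ite_eq']
        split_ifs with hd
        · rfl
        · by_contra hc
          have := ((letters_mem_pairMultisets k w).1 (hV.2 _ (Ne.symm hc))).2
          refine hd (Finset.mem_finsuppAntidiag.2 ⟨?_, Finset.subset_univ _⟩)
          rw [Finsupp.degree_eq_sum] at this
          exact this
      have hvU : v ∈ U := by
        constructor
        · rintro l h t rfl J
          refine Subtype.ext (MvPolynomial.ext _ _ fun d => ?_)
          rw [Submodule.coe_smul, MvPolynomial.coeff_smul]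
          change _ = (varSwap l h (v J).1).coeff d
          rw [coeff_varSwap, hz, hz, smul_eq_mul]
          refine Eq.trans ?_ (hV.1 l h _)
          congr 1
          congr 1
          funext i
          simp [Finsupp.equivMapDomain_apply, siteSwap]
        · intro J hJ
          have : (v J).1 ≠ 0 := fun h => hJ (Subtype.ext h)
          obtain ⟨d, hd⟩ := MvPolynomial.ne_zero_iff.1 this
          rw [hz] at hd
          exact ((letters_mem_pairMultisets k w).1 (hV.2 _ hd)).1
      refine ⟨⟨v, hvU⟩, Subtype.ext (funext fun z => ?_)⟩
      change (v (Prod.fst ∘ z)).1.coeff _ = V z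
      rw [hz]
      rfl
  exact (LinearEquiv.ofBijective g hg).finrank_eq

end Homogeneous

section Words

variable {ι : Type*} [Fintype ι] [DecidableEq ι] {L : ℕ} (w : ι → ℕ)

theorem finrank_wtSpace_complex : Module.finrank ℂ (wtSpace ℂ L w) =
    (Finset.univ.filter fun J : Fin L → ι => content J = w).card := by
  let S := {J : Fin L → ι // content J = w}
  let g : wtSpace ℂ L w →ₗ[ℂ] (S → ℂ) :=
    (LinearMap.funLeft ℂ ℂ Subtype.val) ∘ₗ (wtSpace ℂ L w).subtype
  have hg : Function.Bijective g := by
    constructor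
    · rw [← LinearMap.ker_eq_bot, LinearMap.ker_eq_bot']
      rintro ⟨v, hv⟩ h0
      refine Subtype.ext (funext fun J => ?_)
      by_contra hJ
      exact hJ (congrFun h0 ⟨J, hv J hJ⟩)
    · intro c
      refine ⟨⟨fun J => if h : content J = w then c ⟨J, h⟩ else 0, fun J hJ => ?_⟩, ?_⟩
      · by_contra h; exact hJ (dif_neg h)
      · funext J; exact dif_pos J.2
  rw [(LinearEquiv.ofBijective g hg).finrank_eq, Module.finrank_pi, Fintype.card_subtype]

theorem card_words_content (hw : ∑ A, w A = L) :
    (Finset.univ.filter fun J : Fin L → ι => content J = w).card =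
      Nat.multinomial Finset.univ w := by
  have hmon : ∀ c : ι → ℕ, ∏ A, (MvPolynomial.X A : MvPolynomial ι ℤ) ^ c A =
      MvPolynomial.monomial (Finsupp.equivFunOnFinite.symm c) 1 := by
    intro c
    rw [MvPolynomial.monomial_eq, map_one, one_mul, Finsupp.prod_fintype _ _ fun _ => pow_zero _]
    rfl
  have h1 : (∑ A, (MvPolynomial.X A : MvPolynomial ι ℤ)) ^ L = ∑ J : Fin L → ι,
      MvPolynomial.monomial (Finsupp.equivFunOnFinite.symm (content J)) 1 := by
    have := Finset.prod_univ_sum (fun _ : Fin L => (Finset.univ : Finset ι))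
      fun _ A => (MvPolynomial.X A : MvPolynomial ι ℤ)
    rw [Finset.prod_const, Finset.card_univ, Fintype.card_fin] at this
    rw [this, Fintype.piFinset_univ]
    refine Finset.sum_congr rfl fun J _ => ?_
    rw [← hmon, ← Finset.prod_fiberwise Finset.univ J]
    refine Finset.prod_congr rfl fun A _ => ?_
    rw [content, Finset.prod_congr rfl fun l hl => by rw [(Finset.mem_filter.1 hl).2],
      Finset.prod_const]
  have h2 := Finset.sum_pow_eq_sum_piAntidiag (Finset.univ : Finset ι)
    (fun A => (MvPolynomial.X A : MvPolynomial ι ℤ)) L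
  rw [h1] at h2
  have h3 := congrArg (MvPolynomial.coeff (Finsupp.equivFunOnFinite.symm w)) h2
  simp only [MvPolynomial.coeff_sum, hmon] at h3
  rw [Finset.sum_eq_single w] at h3
  · have h4 : ∀ n : ℕ, (n : MvPolynomial ι ℤ) = MvPolynomial.C (n : ℤ) := fun n => by simp
    rw [h4, MvPolynomial.coeff_C_mul] at h3
    simp only [MvPolynomial.coeff_monomial, EmbeddingLike.apply_eq_iff_eq, if_true,
      Finset.sum_boole, mul_one] at h3
    exact_mod_cast h3
  · intro c _ hc
    have h4 : ∀ n : ℕ, (n : MvPolynomial ι ℤ) = MvPolynomial.C (n : ℤ) := fun n => by simp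
    rw [h4, MvPolynomial.coeff_C_mul, MvPolynomial.coeff_monomial, if_neg, mul_zero]
    exact fun h => hc (Finsupp.equivFunOnFinite.symm.injective h)
  · intro h
    exact absurd (by simp [hw]) h

theorem finrank_wtSpace_complex_eq_div (hw : ∑ A, w A = L) :
    (Module.finrank ℂ (wtSpace ℂ L w) : ℚ) = L.factorial / ∏ A, ((w A).factorial : ℚ) := by
  rw [finrank_wtSpace_complex, card_words_content w hw, eq_div_iff, mul_comm, ← hw,
    ← Nat.multinomial_spec]
  · push_cast; rfl
  · exact Finset.prod_ne_zero_iff.2 fun A _ => by exact_mod_cast Nat.factorial_ne_zero _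

theorem superInv_empty (p : ι → ℕ) {M : Type*} [AddCommGroup M] [Module ℂ M] :
    superInv p (fun _ _ => (∅ : Set (M →ₗ[ℂ] M))) = (⊤ : Submodule ℂ ((Fin L → ι) → M)) :=
  eq_top_iff.2 fun _ _ _ _ _ ht => absurd ht (Set.notMem_empty _)

end Words

section InverseFactorialDeterminant

variable {R : Type*} [CommRing R] {g e c X : ℕ → R}

theorem prod_Icc_eq_prod_range_mul (g : ℕ → R) {j l : ℕ} (h : j ≤ l) :
    ∏ k ∈ Finset.Icc 1 l, g k =
      (∏ r ∈ Finset.range j, g (l - r)) * ∏ k ∈ Finset.Icc 1 (l - j), g k := by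
  induction j with
  | zero => simp
  | succ j ih =>
    rw [ih (by omega), Finset.prod_range_succ, show l - j = (l - (j + 1)) + 1 by omega,
      Finset.prod_Icc_succ_top (by omega)]
    ring

theorem prod_Icc_mul_ite (hg0 : g 0 = 0) (he : ∀ l, e l * ∏ k ∈ Finset.Icc 1 l, g k = 1)
    (j l : ℕ) : (∏ k ∈ Finset.Icc 1 l, g k) * (if j ≤ l then e (l - j) else 0) =
      ∏ r ∈ Finset.range j, g (l - r) := by
  split_ifs with h
  · rw [prod_Icc_eq_prod_range_mul g h, mul_assoc, mul_comm _ (e _), he, mul_one]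
  · rw [mul_zero, Finset.prod_eq_zero (Finset.mem_range.2 (not_le.1 h))]
    rw [Nat.sub_self, hg0]

theorem prod_range_mul_prod_range (hg0 : g 0 = 0)
    (hX : ∀ r l, r ≤ l → c r * g (l - r) = X r - X l) (j l : ℕ) :
    (∏ r ∈ Finset.range j, c r) * ∏ r ∈ Finset.range j, g (l - r) =
      ∏ r ∈ Finset.range j, (X r - X l) := by
  rcases le_or_gt j l with h | h
  · rw [← Finset.prod_mul_distrib]
    exact Finset.prod_congr rfl fun r hr => hX r l (by have := Finset.mem_range.1 hr; omega)
  · rw [Finset.prod_eq_zero (f := fun r => g (l - r)) (Finset.mem_range.2 h)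
      (by rw [Nat.sub_self, hg0]), mul_zero,
      Finset.prod_eq_zero (Finset.mem_range.2 h) (sub_self _)]

theorem det_newton_rev {N : ℕ} (X : ℕ → R) (l : Fin N → ℕ) :
    (Matrix.of fun A j : Fin N => ∏ r ∈ Finset.range j, (X r - X (l (Fin.rev A)))).det =
      ∏ q ∈ ltPairs N, (X (l q.2) - X (l q.1)) := by
  nontriviality R
  have h := Matrix.det_eval_matrixOfPolynomials_eq_det_vandermonde
    (fun A : Fin N => -X (l (Fin.rev A)))
    (fun j : Fin N => ∏ r ∈ Finset.range j, (Polynomial.X + Polynomial.C (X r)))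
    (fun j => by
      rw [Polynomial.natDegree_prod_of_monic _ _ fun r _ => Polynomial.monic_X_add_C _]
      simp)
    (fun j => Polynomial.monic_prod_of_monic _ _ fun r _ => Polynomial.monic_X_add_C _)
  rw [Matrix.det_vandermonde] at h
  have h2 : (Matrix.of fun A j : Fin N => ∏ r ∈ Finset.range j, (X r - X (l (Fin.rev A)))) =
      Matrix.of fun A j : Fin N => Polynomial.eval (-X (l (Fin.rev A)))
        (∏ r ∈ Finset.range j, (Polynomial.X + Polynomial.C (X r))) := by
    ext A j
    simp only [Matrix.of_apply, Polynomial.eval_prod, Polynomial.eval_add, Polynomial.eval_X,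
      Polynomial.eval_C]
    exact Finset.prod_congr rfl fun r _ => by ring
  rw [h2, ← h, Finset.prod_sigma']
  refine Finset.prod_bij' (fun q _ => (Fin.rev q.2, Fin.rev q.1))
    (fun q _ => ⟨Fin.rev q.2, Fin.rev q.1⟩) ?_ ?_ ?_ ?_ ?_
  · intro q hq
    simpa [ltPairs] using hq
  · intro q hq
    simpa [ltPairs] using hq
  · intro q _; simp
  · intro q _; simp
  · intro q _; simp only; ring

theorem sum_sign_inverse_factorial {N : ℕ} (hg0 : g 0 = 0)
    (he : ∀ l, e l * ∏ k ∈ Finset.Icc 1 l, g k = 1)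
    (hX : ∀ r l, r ≤ l → c r * g (l - r) = X r - X l) {l : Fin N → ℕ} (hl : StrictAnti l) :
    (∏ j : Fin N, ∏ r ∈ Finset.range j, c r) * (∏ A, ∏ k ∈ Finset.Icc 1 (l A), g k) *
      (((Equiv.Perm.sign (Fin.revPerm : Equiv.Perm (Fin N)) : ℤ) : R) *
        ∑ σ : Equiv.Perm (Fin N), ((Equiv.Perm.sign σ : ℤ) : R) *
          ∏ A, if (σ A : ℕ) ≤ l A then e (l A - σ A) else 0) =
      ∏ q ∈ ltPairs N, c (l q.2) * g (l q.1 - l q.2) := by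
  let M : Matrix (Fin N) (Fin N) R := Matrix.of fun A j =>
    if (j : ℕ) ≤ l A then e (l A - j) else 0
  have h1 : ∑ σ : Equiv.Perm (Fin N), ((Equiv.Perm.sign σ : ℤ) : R) *
      (∏ A, if (σ A : ℕ) ≤ l A then e (l A - σ A) else 0) = M.det := by
    rw [← Matrix.det_transpose, Matrix.det_apply']
    rfl
  rw [h1, mul_left_comm, mul_assoc,
    ← Matrix.det_mul_column (fun A => ∏ k ∈ Finset.Icc 1 (l A), g k),
    ← Matrix.det_mul_row fun j : Fin N => ∏ r ∈ Finset.range j, c r, ← Matrix.det_permute]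
  have h2 : ((Matrix.of fun i j : Fin N => (∏ r ∈ Finset.range j, c r) *
      (Matrix.of fun A j : Fin N => (∏ k ∈ Finset.Icc 1 (l A), g k) * M A j) i j).submatrix
        (Fin.revPerm : Equiv.Perm (Fin N)) id) =
      Matrix.of fun A j : Fin N => ∏ r ∈ Finset.range j, (X r - X (l (Fin.rev A))) := by
    ext A j
    simp only [Matrix.submatrix_apply, Matrix.of_apply, id_eq, Fin.revPerm_apply, M]
    rw [prod_Icc_mul_ite hg0 he, prod_range_mul_prod_range hg0 hX]
  rw [h2, det_newton_rev]
  refine Finset.prod_congr rfl fun q hq => ?_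
  have : q.1 < q.2 := by simpa [ltPairs] using hq
  exact (hX _ _ (hl this).le).symm

end InverseFactorialDeterminant

section Hooks

variable (μ : YoungDiagram) {N : ℕ}

theorem antitone_rowLen : Antitone fun A : Fin N => μ.rowLen A :=
  fun _ _ h => μ.rowLen_anti _ _ h

@[to_additive]
theorem prod_cells {R : Type*} [CommMonoid R] (hN : μ.colLen 0 ≤ N) (f : ℕ × ℕ → R) :
    ∏ b ∈ μ.cells, f b = ∏ A : Fin N, ∏ s ∈ Finset.range (μ.rowLen A), f (A, s) := by
  rw [Finset.prod_finset_product μ.cells (Finset.range N) fun i => Finset.range (μ.rowLen i),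
    Finset.prod_range fun i => ∏ s ∈ Finset.range (μ.rowLen i), f (i, s)]
  rintro ⟨i, s⟩
  rw [YoungDiagram.mem_cells, Finset.mem_range, Finset.mem_range, YoungDiagram.mem_iff_lt_rowLen]
  refine ⟨fun h => ⟨?_, h⟩, fun h => h.2⟩
  have := (lt_colLen_iff_lt_rowLen μ i s).2 h
  have := μ.colLen_anti 0 s (Nat.zero_le _)
  dsimp only
  omega

/-- The numbers `1, …, l_i` are the hook lengths in row `i` and the differences `l_i - l_j`. -/
theorem prod_hook_row {R : Type*} [CommMonoid R] (hN : μ.colLen 0 ≤ N) (g : ℕ → R) (A : Fin N) :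
    ∏ k ∈ Finset.Icc 1 (shifted (fun B : Fin N => μ.rowLen B) A), g k =
      (∏ B ∈ Finset.univ.filter (A < ·), g (shifted (fun B : Fin N => μ.rowLen B) A -
        shifted (fun B : Fin N => μ.rowLen B) B)) *
      ∏ s ∈ Finset.range (μ.rowLen A), g (hookLength μ (A, s)) := by
  set l := shifted (fun B : Fin N => μ.rowLen B) with hl
  have hdef : ∀ B, l B = μ.rowLen B + (N - 1 - B) := fun B => rfl
  have hanti : StrictAnti l := shifted_strictAnti (antitone_rowLen μ)
  have hcol : ∀ s, μ.colLen s ≤ N := fun s => (μ.colLen_anti 0 s (Nat.zero_le _)).trans hN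
  have hiff := lt_colLen_iff_lt_rowLen μ
  have hAN := A.2
  have hh : ∀ s ∈ Finset.range (μ.rowLen A),
      hookLength μ (A, s) = l A - (s + N - μ.colLen s) := by
    intro s hs
    have h1 := Finset.mem_range.1 hs
    have h2 := (hiff A s).2 h1
    have h3 := hcol s
    rw [hookLength, hdef]
    dsimp only
    omega
  have hh' : ∏ s ∈ Finset.range (μ.rowLen A), g (hookLength μ (A, s)) =
      ∏ s ∈ Finset.range (μ.rowLen A), g (l A - (s + N - μ.colLen s)) :=
    Finset.prod_congr rfl fun s hs => by rw [hh s hs]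
  rw [hh']
  have hinj1 : Set.InjOn l (Finset.univ.filter (A < ·) : Finset (Fin N)) := hanti.injective.injOn
  have hinj2 : Set.InjOn (fun s => s + N - μ.colLen s) (Finset.range (μ.rowLen A)) := by
    intro s _ s' _ h
    have := hcol s
    have := hcol s'
    dsimp only at h
    rcases lt_trichotomy s s' with h1 | h1 | h1
    · have := μ.colLen_anti _ _ h1.le
      omega
    · exact h1
    · have := μ.colLen_anti _ _ h1.le
      omega
  have hdisj : Disjoint ((Finset.univ.filter (A < ·)).image l)
      ((Finset.range (μ.rowLen A)).image fun s => s + N - μ.colLen s) := by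
    rw [Finset.disjoint_left]
    intro x hx hx'
    obtain ⟨B, -, rfl⟩ := Finset.mem_image.1 hx
    obtain ⟨s, -, hs⟩ := Finset.mem_image.1 hx'
    have h1 := hiff B s
    have h2 := hcol s
    have h3 := B.2
    rw [hdef] at hs
    omega
  have hunion : (Finset.univ.filter (A < ·)).image l ∪
      (Finset.range (μ.rowLen A)).image (fun s => s + N - μ.colLen s) = Finset.range (l A) := by
    refine Finset.eq_of_subset_of_card_le ?_ ?_
    · intro x hx
      rw [Finset.mem_range]
      rcases Finset.mem_union.1 hx with hx | hx
      · obtain ⟨B, hB, rfl⟩ := Finset.mem_image.1 hx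
        exact hanti (Finset.mem_filter.1 hB).2
      · obtain ⟨s, hs, rfl⟩ := Finset.mem_image.1 hx
        have h1 := Finset.mem_range.1 hs
        have h2 := (hiff A s).2 h1
        have := hcol s
        rw [hdef]
        omega
    · rw [Finset.card_union_of_disjoint hdisj, Finset.card_image_of_injOn hinj1,
        Finset.card_image_of_injOn hinj2, Finset.card_range, Finset.card_range, hdef,
        Finset.filter_lt_eq_Ioi, Fin.card_Ioi]
      omega
  rw [← Finset.prod_image (f := fun x => g (l A - x)) hinj1,
    ← Finset.prod_image (f := fun x => g (l A - x)) hinj2, ← Finset.prod_union hdisj, hunion]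
  refine Finset.prod_bij' (fun k _ => l A - k) (fun x _ => l A - x) ?_ ?_ ?_ ?_ ?_
  · intro k hk; have := Finset.mem_Icc.1 hk; rw [Finset.mem_range]; omega
  · intro x hx; have := Finset.mem_range.1 hx; rw [Finset.mem_Icc]; omega
  · intro k hk; have := Finset.mem_Icc.1 hk; omega
  · intro x hx; have := Finset.mem_range.1 hx; omega
  · intro k hk; have := Finset.mem_Icc.1 hk; congr 1; omega

theorem prod_ltPairs {R : Type*} [CommMonoid R] (f : Fin N → Fin N → R) :
    ∏ q ∈ ltPairs N, f q.1 q.2 = ∏ A, ∏ B ∈ Finset.univ.filter (A < ·), f A B :=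
  Finset.prod_finset_product (ltPairs N) Finset.univ (fun A => Finset.univ.filter (A < ·))
    (by intro q; simp [ltPairs])

theorem prod_hooks {R : Type*} [CommMonoid R] (hN : μ.colLen 0 ≤ N) (g : ℕ → R) :
    ∏ A, ∏ k ∈ Finset.Icc 1 (shifted (fun B : Fin N => μ.rowLen B) A), g k =
      (∏ q ∈ ltPairs N, g (shifted (fun B : Fin N => μ.rowLen B) q.1 -
        shifted (fun B : Fin N => μ.rowLen B) q.2)) *
      ∏ b ∈ μ.cells, g (hookLength μ b) := by
  rw [Finset.prod_congr rfl fun A _ => prod_hook_row μ hN g A, Finset.prod_mul_distrib,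
    prod_cells μ hN, prod_ltPairs fun A B => g (shifted (fun B : Fin N => μ.rowLen B) A -
      shifted (fun B : Fin N => μ.rowLen B) B)]

/-- The alternating sum of products of inverse factorials as a product over hooks. -/
theorem sum_sign_hook {R : Type*} [CommRing R] [IsDomain R] {g e c X : ℕ → R}
    (hN : μ.colLen 0 ≤ N) (hg0 : g 0 = 0) (he : ∀ l, e l * ∏ k ∈ Finset.Icc 1 l, g k = 1)
    (hX : ∀ r l, r ≤ l → c r * g (l - r) = X r - X l) :
    (∏ j : Fin N, ∏ r ∈ Finset.range j, c r) * (∏ b ∈ μ.cells, g (hookLength μ b)) *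
      (((Equiv.Perm.sign (Fin.revPerm : Equiv.Perm (Fin N)) : ℤ) : R) *
        ∑ σ : Equiv.Perm (Fin N), ((Equiv.Perm.sign σ : ℤ) : R) *
          ∏ A, if (σ A : ℕ) ≤ shifted (fun B : Fin N => μ.rowLen B) A then
            e (shifted (fun B : Fin N => μ.rowLen B) A - σ A) else 0) =
      ∏ q ∈ ltPairs N, c (shifted (fun B : Fin N => μ.rowLen B) q.2) := by
  have h := sum_sign_inverse_factorial hg0 he hX
    (shifted_strictAnti (antitone_rowLen (N := N) μ))
  rw [prod_hooks μ hN, Finset.prod_mul_distrib] at h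
  have hne : ∏ q ∈ ltPairs N, g (shifted (fun B : Fin N => μ.rowLen B) q.1 -
      shifted (fun B : Fin N => μ.rowLen B) q.2) ≠ 0 := by
    intro h0
    have := Finset.prod_congr rfl fun A (_ : A ∈ Finset.univ) =>
      he (shifted (fun B : Fin N => μ.rowLen B) A)
    rw [Finset.prod_mul_distrib, prod_hooks μ hN, h0, zero_mul, mul_zero, Finset.prod_const_one]
      at this
    exact zero_ne_one this
  refine mul_right_cancel₀ hne ?_
  rw [← h]
  ring

end Hooks

section HighestWeightCount

variable (μ : YoungDiagram) {N L : ℕ}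

theorem sum_rowLen (hN : μ.colLen 0 ≤ N) (hL : μ.card = L) : ∑ A : Fin N, μ.rowLen A = L := by
  rw [← hL, YoungDiagram.card, Finset.card_eq_sum_ones, sum_cells μ hN]
  simp

theorem sum_shifted_sub (κ : Fin N → ℕ) (σ : Equiv.Perm (Fin N))
    (h : ∀ A, (σ A : ℕ) ≤ shifted κ A) : ∑ A, (shifted κ A - σ A) = ∑ A, κ A := by
  have h1 : ∑ A, (shifted κ A - σ A) + ∑ A, (σ A : ℕ) =
      ∑ A, κ A + ∑ A : Fin N, (N - 1 - (A : ℕ)) := by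
    rw [← Finset.sum_add_distrib, ← Finset.sum_add_distrib]
    exact Finset.sum_congr rfl fun A _ => Nat.sub_add_cancel (h A)
  have h2 : ∑ A, (σ A : ℕ) = ∑ A : Fin N, (A : ℕ) := Equiv.sum_comp σ fun A => (A : ℕ)
  have h3 : ∑ A : Fin N, (N - 1 - (A : ℕ)) = ∑ A : Fin N, (A : ℕ) := by
    rw [← Equiv.sum_comp Fin.revPerm fun A : Fin N => (A : ℕ)]
    exact Finset.sum_congr rfl fun A _ => by rw [Fin.revPerm_apply, Fin.val_rev]; omega
  omega

theorem sign_mul_sign_cast {R : Type*} [CommRing R] (σ : Equiv.Perm (Fin N)) :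
    ((Equiv.Perm.sign σ : ℤ) : R) * ((Equiv.Perm.sign σ : ℤ) : R) = 1 := by
  rw [← Int.cast_mul, ← Units.val_mul, Int.units_mul_self]; simp

theorem prod_Icc_cast (l : ℕ) : ∏ k ∈ Finset.Icc 1 l, (k : ℚ) = l.factorial := by
  induction l with
  | zero => simp
  | succ l ih =>
    rw [Finset.prod_Icc_succ_top (by omega), ih, Nat.factorial_succ, Nat.cast_mul, mul_comm]

theorem ite_forall_prod {R : Type*} [CommMonoidWithZero R] (P : Fin N → Prop) [DecidablePred P]
    (f : Fin N → R) : (if ∀ A, P A then ∏ A, f A else 0) = ∏ A, if P A then f A else 0 := by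
  split_ifs with h
  · exact Finset.prod_congr rfl fun A _ => (if_pos (h A)).symm
  · push Not at h
    obtain ⟨A, hA⟩ := h
    exact (Finset.prod_eq_zero (Finset.mem_univ A) (if_neg hA)).symm

/-- The number of highest-weight vectors: the hook length formula. -/
theorem finrank_hwSpace_complex (hN : μ.colLen 0 ≤ N) (hL : μ.card = L) :
    (Module.finrank ℂ (hwSpace (M := ℂ) (L := L) (fun _ : Fin N => 0) (fun _ _ => ∅) (· < ·)
      fun a => μ.rowLen a) : ℚ) = L.factorial / ∏ b ∈ μ.cells, (hookLength μ b : ℚ) := by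
  have hs := sum_rowLen μ hN hL
  have h := finrank_hwSpace_eq_sum (M := ℂ) (T := fun _ _ => ∅) (antitone_rowLen (N := N) μ) hs
  set D := Module.finrank ℂ (hwSpace (M := ℂ) (L := L) (fun _ : Fin N => 0) (fun _ _ => ∅) (· < ·)
      fun a => μ.rowLen a)
  set l := shifted fun A : Fin N => μ.rowLen A with hl
  have hterm : ∀ σ : Equiv.Perm (Fin N), (((if ∀ A, (σ A : ℕ) ≤ l A then
      (Module.finrank ℂ (invWt (L := L) (M := ℂ) (fun _ _ => ∅)
        fun A => l A - σ A) : ℤ) else 0 : ℤ)) : ℚ) =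
      L.factorial * ∏ A, if (σ A : ℕ) ≤ l A then (((l A - σ A).factorial : ℚ))⁻¹ else 0 := by
    intro σ
    rw [← ite_forall_prod]
    split_ifs with hσ
    · rw [invWt, superInv_empty, top_inf_eq, Int.cast_natCast,
        finrank_wtSpace_complex_eq_div _ (by rw [sum_shifted_sub _ _ hσ, hs]),
        Finset.prod_inv_distrib,
        div_eq_mul_inv]
    · simp
  have h' : ((Equiv.Perm.sign (Fin.revPerm : Equiv.Perm (Fin N)) : ℤ) : ℚ) * D =
      L.factorial * ∑ σ : Equiv.Perm (Fin N), ((Equiv.Perm.sign σ : ℤ) : ℚ) *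
        ∏ A, if (σ A : ℕ) ≤ l A then (((l A - σ A).factorial : ℚ))⁻¹ else 0 := by
    have := congrArg (Int.cast : ℤ → ℚ) h
    rw [Int.cast_mul, Int.cast_sum, Int.cast_natCast] at this
    rw [this, Finset.mul_sum]
    refine Finset.sum_congr rfl fun σ _ => ?_
    rw [Int.cast_mul, hterm]
    ring
  have hk := sum_sign_hook (R := ℚ) μ hN (g := fun k => (k : ℚ))
    (e := fun l => ((l.factorial : ℚ))⁻¹)
    (c := fun _ => 1) (X := fun l => -(l : ℚ)) (by simp) (fun l => by
      rw [prod_Icc_cast]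
      exact inv_mul_cancel₀ (by exact_mod_cast l.factorial_ne_zero))
    (fun r l hrl => by push_cast [hrl]; ring)
  simp only [Finset.prod_const_one, one_mul] at hk
  have hne : (∏ b ∈ μ.cells, (hookLength μ b : ℚ)) ≠ 0 :=
    Finset.prod_ne_zero_iff.2 fun b _ => by rw [hookLength]; positivity
  rw [eq_div_iff hne]
  have hsq := sign_mul_sign_cast (R := ℚ) (Fin.revPerm : Equiv.Perm (Fin N))
  linear_combination (-(D : ℚ) * ∏ b ∈ μ.cells, (hookLength μ b : ℚ)) * hsq +
    (((Equiv.Perm.sign (Fin.revPerm : Equiv.Perm (Fin N)) : ℤ) : ℚ) *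
      ∏ b ∈ μ.cells, (hookLength μ b : ℚ)) * h' + (L.factorial : ℚ) * hk

theorem sum_ltPairs_val (f : ℕ → ℕ → ℕ) : ∑ q ∈ ltPairs N, f q.1 q.2 =
    ∑ j : Fin N, ∑ r ∈ Finset.range j, f r j := by
  rw [Finset.sum_finset_product_right (ltPairs N) Finset.univ
    (fun B => Finset.univ.filter (· < B)) (by intro q; simp [ltPairs])]
  refine Finset.sum_congr rfl fun B _ => ?_
  refine Finset.sum_bij (fun A _ => (A : ℕ)) ?_ ?_ ?_ ?_
  · intro A hA; simpa using hA
  · intro A _ A' _ h; exact Fin.ext h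
  · intro r hr
    have := Finset.mem_range.1 hr
    exact ⟨⟨r, by omega⟩, Finset.mem_filter.2 ⟨Finset.mem_univ _, Fin.lt_def.2 this⟩, rfl⟩
  · intro A _; rfl

theorem sum_ltPairs_shifted (hN : μ.colLen 0 ≤ N) :
    ∑ q ∈ ltPairs N, shifted (fun A : Fin N => μ.rowLen A) q.2 =
      (∑ j : Fin N, ∑ r ∈ Finset.range j, r) +
        ∑ s ∈ Finset.range (μ.rowLen 0), μ.colLen s * (μ.colLen s - 1) / 2 := by
  have h1 : ∑ q ∈ ltPairs N, (N - 1 - (q.2 : ℕ)) = ∑ q ∈ ltPairs N, (q.1 : ℕ) := by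
    refine Finset.sum_bij' (fun q _ => (Fin.rev q.2, Fin.rev q.1))
      (fun q _ => (Fin.rev q.2, Fin.rev q.1)) ?_ ?_ ?_ ?_ ?_
    · intro q hq; simpa [ltPairs] using hq
    · intro q hq; simpa [ltPairs] using hq
    · intro q _; simp
    · intro q _; simp
    · intro q _; rw [Fin.val_rev]; omega
  have h2 : ∑ s ∈ Finset.range (μ.rowLen 0), μ.colLen s * (μ.colLen s - 1) / 2 =
      ∑ b ∈ μ.cells, b.1 := by
    rw [Finset.sum_finset_product_right μ.cells (Finset.range (μ.rowLen 0))
      fun s => Finset.range (μ.colLen s)]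
    · exact Finset.sum_congr rfl fun s _ => (Finset.sum_range_id _).symm
    · rintro ⟨i, s⟩
      rw [YoungDiagram.mem_cells, Finset.mem_range, Finset.mem_range,
        YoungDiagram.mem_iff_lt_colLen]
      refine ⟨fun h => ⟨?_, h⟩, fun h => h.2⟩
      have := (lt_colLen_iff_lt_rowLen μ i s).1 h
      have := μ.rowLen_anti 0 i (Nat.zero_le _)
      dsimp only
      omega
  simp only [shifted]
  rw [Finset.sum_add_distrib, h1, h2, sum_cells μ hN, sum_ltPairs_val fun r _ => r,
    sum_ltPairs_val fun _ j => μ.rowLen j, add_comm]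
  congr 1
  refine Finset.sum_congr rfl fun j _ => ?_
  rw [Finset.sum_const, Finset.sum_const, Finset.card_range, Finset.card_range, smul_eq_mul,
    smul_eq_mul, mul_comm]

/-- The graded dimension of the highest-weight vectors among the graded symmetric vectors. -/
theorem mk_finrank_hwSpace_homogOps (hN : μ.colLen 0 ≤ N) (hL : μ.card = L) :
    (PowerSeries.mk fun k => (Module.finrank ℂ (hwSpace (fun _ : Fin N => 0) (homogOps L k)
      (· < ·) fun a => μ.rowLen a) : ℚ)) =
    PowerSeries.X ^ (∑ s ∈ Finset.range (μ.rowLen 0), μ.colLen s * (μ.colLen s - 1) / 2) *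
      ∏ b ∈ μ.cells, (1 - PowerSeries.X ^ hookLength μ b)⁻¹ := by
  have hs := sum_rowLen μ hN hL
  set H : PowerSeries ℚ := PowerSeries.mk fun k => (Module.finrank ℂ
    (hwSpace (fun _ : Fin N => 0) (homogOps L k) (· < ·) fun a => μ.rowLen a) : ℚ) with hH
  set l := shifted fun A : Fin N => μ.rowLen A with hl
  have h' : ((Equiv.Perm.sign (Fin.revPerm : Equiv.Perm (Fin N)) : ℤ) : PowerSeries ℚ) * H =
      ∑ σ : Equiv.Perm (Fin N), ((Equiv.Perm.sign σ : ℤ) : PowerSeries ℚ) *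
        ∏ A, if (σ A : ℕ) ≤ l A then
          ∏ k ∈ Finset.Icc 1 (l A - σ A), (1 - (PowerSeries.X : PowerSeries ℚ) ^ k)⁻¹ else 0 := by
    ext k
    have h := congrArg (Int.cast : ℤ → ℚ)
      (finrank_hwSpace_eq_sum (T := homogOps L k) (antitone_rowLen (N := N) μ) hs)
    rw [Int.cast_mul, Int.cast_sum, Int.cast_natCast] at h
    rw [← zsmul_eq_mul, map_zsmul, zsmul_eq_mul, hH, PowerSeries.coeff_mk, h, map_sum]
    refine Finset.sum_congr rfl fun σ _ => ?_
    rw [Int.cast_mul, ← zsmul_eq_mul (a := ∏ A, _), map_zsmul, zsmul_eq_mul, ← ite_forall_prod]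
    congr 1
    split_ifs with hσ
    · rw [invWt, finrank_superInv_homogOps _ _ _ (by rw [sum_shifted_sub _ _ hσ, hs]),
        Int.cast_natCast, ncard_multisetFamilies]
      have : Odd 0 = False := by simp
      rw [this]
      simp only [sumSeries_false]
      rfl
    · simp
  have hk := sum_sign_hook (R := PowerSeries ℚ) μ hN (g := fun k => 1 - PowerSeries.X ^ k)
    (e := fun l => ∏ k ∈ Finset.Icc 1 l, (1 - PowerSeries.X ^ k)⁻¹)
    (c := fun r => PowerSeries.X ^ r) (X := fun l => PowerSeries.X ^ l) (by simp) (fun l => by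
      rw [← Finset.prod_mul_distrib]
      refine Finset.prod_eq_one fun k hk => PowerSeries.inv_mul_cancel _ ?_
      have : k ≠ 0 := by have := Finset.mem_Icc.1 hk; omega
      simp [this])
    (fun r l hrl => by rw [mul_sub, mul_one, ← pow_add, Nat.add_sub_cancel' hrl])
  rw [← h', ← mul_assoc _ _ H, sign_mul_sign_cast, one_mul, Finset.prod_pow_eq_pow_sum,
    sum_ltPairs_shifted μ hN, pow_add] at hk
  have hc : (∏ j : Fin N, ∏ r ∈ Finset.range j, (PowerSeries.X : PowerSeries ℚ) ^ r) =
      PowerSeries.X ^ ∑ j : Fin N, ∑ r ∈ Finset.range j, r := by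
    rw [← Finset.prod_pow_eq_pow_sum]
    exact Finset.prod_congr rfl fun j _ => Finset.prod_pow_eq_pow_sum _ (fun r => r) _
  rw [hc, mul_assoc] at hk
  have hk := mul_left_cancel₀ (pow_ne_zero _ PowerSeries.X_ne_zero) hk
  have hu : (∏ b ∈ μ.cells, (1 - (PowerSeries.X : PowerSeries ℚ) ^ hookLength μ b)⁻¹) *
      ∏ b ∈ μ.cells, (1 - PowerSeries.X ^ hookLength μ b) = 1 := by
    rw [← Finset.prod_mul_distrib]
    refine Finset.prod_eq_one fun b _ => PowerSeries.inv_mul_cancel _ ?_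
    simp [hookLength]
  linear_combination (∏ b ∈ μ.cells, (1 - (PowerSeries.X : PowerSeries ℚ) ^ hookLength μ b)⁻¹) *
    hk - H * hu

end HighestWeightCount

section FieldBraid

variable {K : Type*} [Field K] {σ τ : K →+* K} {x y z h : K} {B C : K → K}

theorem hecke_braid_field (hxσ : σ x = -x) (hyσ : σ y = z) (hzσ : σ z = y) (hxτ : τ x = z)
    (hyτ : τ y = -y) (hzτ : τ z = x) (hhσ : σ h = h) (hhτ : τ h = h) (hx : x ≠ 0) (hy : y ≠ 0)
    (hz : z ≠ 0) (hxy : z = x + y) (hσσ : ∀ f, σ (σ f) = f) (hττ : ∀ f, τ (τ f) = f)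
    (hb : ∀ f, σ (τ (σ f)) = τ (σ (τ f))) (hB : ∀ f, B f = σ f + h * ((σ f - f) / x))
    (hC : ∀ f, C f = τ f + h * ((τ f - f) / y)) (f : K) : B (C (B f)) = C (B (C f)) := by
  simp only [hB, hC, map_add, map_mul, map_div₀, map_sub, hxσ, hyσ, hzσ, hzτ, hxτ, hyτ,
    hhσ, hhτ, hσσ, hττ, hb]
  field_simp
  subst hxy
  ring

theorem hecke_comm_field (hyσ : σ y = y) (hxτ : τ x = x) (hhσ : σ h = h) (hhτ : τ h = h)
    (hx : x ≠ 0) (hy : y ≠ 0) (hb : ∀ f, σ (τ f) = τ (σ f))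
    (hB : ∀ f, B f = σ f + h * ((σ f - f) / x))
    (hC : ∀ f, C f = τ f + h * ((τ f - f) / y)) (f : K) : B (C f) = C (B f) := by
  simp only [hB, hC, map_add, map_mul, map_div₀, map_sub, hyσ, hxτ, hhσ, hhτ, hb]
  field_simp
  ring

end FieldBraid

section HeckeOperators

variable {L : ℕ} (hbar : ℂ)

/-- The operator `Π_{ℓ,ℓ+1} + ℏ (θ_ℓ - θ_{ℓ+1})⁻¹ (Π_{ℓ,ℓ+1} - 1)` on polynomials. -/
noncomputable def heckeOp (l : ℕ) (h : l + 1 < L) : PolyTheta L →ₗ[PolyChi L] PolyTheta L where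
  toFun f := varSwap l h f + hbar • divDiff l h f
  map_add' f g := by simp only [map_add, smul_add]; ring
  map_smul' c f := by
    have e : ∀ g : PolyTheta L, c • g = (c : PolyTheta L) * g := fun g => rfl
    simp only [e, map_mul, varSwap_chi, divDiff_chi_mul, RingHom.id_apply, mul_add, mul_smul_comm]

theorem heckeOp_apply (l : ℕ) (h : l + 1 < L) (f : PolyTheta L) :
    heckeOp hbar l h f = varSwap l h f + hbar • divDiff l h f := rfl

theorem heckeOp_zero_apply (l : ℕ) (h : l + 1 < L) (f : PolyTheta L) :
    heckeOp 0 l h f = varSwap l h f := by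
  rw [heckeOp_apply, zero_smul, add_zero]

theorem varSwap_varSwap (l : ℕ) (h : l + 1 < L) (f : PolyTheta L) :
    varSwap l h (varSwap l h f) = f := by
  rw [varSwap, MvPolynomial.rename_rename]
  have : ⇑(siteSwap l h) ∘ ⇑(siteSwap l h) = id := by funext k; simp
  rw [this, MvPolynomial.rename_id_apply]

theorem varSwap_X (l : ℕ) (h : l + 1 < L) (k : Fin L) :
    varSwap l h (MvPolynomial.X k) = MvPolynomial.X (siteSwap l h k) :=
  MvPolynomial.rename_X _ _

theorem divDiff_varSwap (l : ℕ) (h : l + 1 < L) (f : PolyTheta L) :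
    divDiff l h (varSwap l h f) = -divDiff l h f := by
  apply mul_left_cancel₀ (theta_sub_ne_zero l h)
  rw [mul_neg, theta_sub_mul_divDiff, theta_sub_mul_divDiff, varSwap_varSwap, neg_sub]

theorem varSwap_divDiff (l : ℕ) (h : l + 1 < L) (f : PolyTheta L) :
    varSwap l h (divDiff l h f) = divDiff l h f := by
  apply mul_left_cancel₀ (theta_sub_ne_zero l h)
  have := congrArg (varSwap l h) (theta_sub_mul_divDiff l h f)
  rw [map_mul, map_sub, map_sub, varSwap_varSwap, varSwap_X, varSwap_X, siteSwap_siteL,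
    siteSwap_siteR] at this
  rw [theta_sub_mul_divDiff, ← neg_inj, neg_sub, ← this]
  ring

theorem divDiff_divDiff (l : ℕ) (h : l + 1 < L) (f : PolyTheta L) :
    divDiff l h (divDiff l h f) = 0 := by
  apply mul_left_cancel₀ (theta_sub_ne_zero l h)
  rw [theta_sub_mul_divDiff, varSwap_divDiff, sub_self, mul_zero]

theorem heckeOp_heckeOp (l : ℕ) (h : l + 1 < L) (f : PolyTheta L) :
    heckeOp hbar l h (heckeOp hbar l h f) = f := by
  simp only [heckeOp_apply, map_add, map_smul, varSwap_varSwap, varSwap_divDiff, divDiff_varSwap,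
    divDiff_divDiff, smul_zero, add_zero, smul_neg]
  ring

/-- The symmetry relation of `symOp` in terms of `heckeOp`. -/
theorem symOp_eq_self_iff {m n : ℕ} {l : ℕ} {h : l + 1 < L} {v : ThetaChain m n L} :
    symOp m n hbar l h v = v ↔
      ∀ J, swapSign parity l h J • v (J ∘ siteSwap l h) = heckeOp hbar l h (v J) := by
  have e : ∀ J : Word m n L,
      ((-1 : PolyTheta L) ^ (parity (J (siteL l h)) * parity (J (siteR l h)))) =
      MvPolynomial.C (swapSign parity l h J) := fun J => by simp [swapSign]
  rw [funext_iff]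
  refine forall_congr' fun J => ?_
  rw [symOp_apply, e, ← MvPolynomial.smul_eq_C_mul, ← map_smul]
  constructor
  · intro h1
    have := congrArg (varSwap l h) h1
    rw [map_sub, varSwap_varSwap, map_smul, varSwap_divDiff] at this
    rw [heckeOp_apply, ← this, sub_add_cancel]
  · intro h1
    rw [h1, heckeOp_apply, map_add, varSwap_varSwap, map_smul, varSwap_divDiff,
      add_sub_cancel_right]

/-- The automorphism of the field of rational functions which exchanges two variables. -/
noncomputable def fracSwap (l : ℕ) (h : l + 1 < L) :
    FractionRing (PolyTheta L) →+* FractionRing (PolyTheta L) :=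
  (IsFractionRing.ringEquivOfRingEquiv (K := FractionRing (PolyTheta L))
    (L := FractionRing (PolyTheta L))
    (MvPolynomial.renameEquiv ℂ (siteSwap l h)).toRingEquiv).toRingHom

theorem fracSwap_algebraMap (l : ℕ) (h : l + 1 < L) (f : PolyTheta L) :
    fracSwap l h (algebraMap _ (FractionRing (PolyTheta L)) f) =
      algebraMap _ (FractionRing (PolyTheta L)) (varSwap l h f) :=
  IsFractionRing.ringEquivOfRingEquiv_algebraMap _ _

theorem fracSwap_ext {F G : FractionRing (PolyTheta L) →+* FractionRing (PolyTheta L)}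
    (h : ∀ f : PolyTheta L, F (algebraMap _ _ f) = G (algebraMap _ _ f))
    (f : FractionRing (PolyTheta L)) : F f = G f :=
  congrFun (congrArg _ (IsLocalization.ringHom_ext (nonZeroDivisors (PolyTheta L))
    (RingHom.ext h))) f

/-- `heckeOp` on rational functions. -/
noncomputable def fracHecke (l : ℕ) (h : l + 1 < L) (f : FractionRing (PolyTheta L)) :
    FractionRing (PolyTheta L) :=
  fracSwap l h f + algebraMap (PolyTheta L) _ (MvPolynomial.C hbar) * ((fracSwap l h f - f) /
    algebraMap (PolyTheta L) _ (MvPolynomial.X (siteL l h) - MvPolynomial.X (siteR l h)))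

theorem fracHecke_algebraMap (l : ℕ) (h : l + 1 < L) (f : PolyTheta L) :
    fracHecke hbar l h (algebraMap _ _ f) = algebraMap _ _ (heckeOp hbar l h f) := by
  have hne : algebraMap (PolyTheta L) (FractionRing (PolyTheta L))
      (MvPolynomial.X (siteL l h) - MvPolynomial.X (siteR l h)) ≠ 0 := by
    rw [Ne, FaithfulSMul.algebraMap_eq_zero_iff]
    exact theta_sub_ne_zero l h
  rw [fracHecke, fracSwap_algebraMap, ← map_sub, ← theta_sub_mul_divDiff, map_mul,
    mul_div_cancel_left₀ _ hne, heckeOp_apply, MvPolynomial.smul_eq_C_mul, map_add, map_mul]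

theorem X_sub_X_ne_zero {i j : Fin L} (h : i ≠ j) :
    algebraMap (PolyTheta L) (FractionRing (PolyTheta L))
      (MvPolynomial.X i - MvPolynomial.X j) ≠ 0 := by
  rw [Ne, FaithfulSMul.algebraMap_eq_zero_iff, sub_eq_zero]
  exact fun e => h (MvPolynomial.X_injective e)

theorem val_siteSwap (l : ℕ) (h : l + 1 < L) (k : Fin L) : (siteSwap l h k : ℕ) =
    if (k : ℕ) = l then l + 1 else if (k : ℕ) = l + 1 then l else k := by
  simp only [siteSwap, Equiv.swap_apply_def, Fin.ext_iff]
  split_ifs <;> rfl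

theorem siteSwap_braid (l : ℕ) (h : l + 1 < L) (h' : l + 1 + 1 < L) (k : Fin L) :
    siteSwap l h (siteSwap (l + 1) h' (siteSwap l h k)) =
      siteSwap (l + 1) h' (siteSwap l h (siteSwap (l + 1) h' k)) := by
  refine Fin.ext ?_
  simp only [val_siteSwap]
  split_ifs <;> omega

theorem siteSwap_comm {l l' : ℕ} (h : l + 1 < L) (h' : l' + 1 < L) (hll : l + 1 < l') (k : Fin L) :
    siteSwap l h (siteSwap l' h' k) = siteSwap l' h' (siteSwap l h k) := by
  refine Fin.ext ?_
  simp only [val_siteSwap]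
  split_ifs <;> omega

theorem varSwap_C (l : ℕ) (h : l + 1 < L) (c : ℂ) :
    varSwap l h (MvPolynomial.C c) = MvPolynomial.C c := MvPolynomial.rename_C _ _

theorem heckeOp_braid (l : ℕ) (h : l + 1 < L) (h' : l + 1 + 1 < L) (f : PolyTheta L) :
    heckeOp hbar l h (heckeOp hbar (l + 1) h' (heckeOp hbar l h f)) =
      heckeOp hbar (l + 1) h' (heckeOp hbar l h (heckeOp hbar (l + 1) h' f)) := by
  have hinj := IsFractionRing.injective (PolyTheta L) (FractionRing (PolyTheta L))
  apply hinj
  simp only [← fracHecke_algebraMap]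
  have ne : ∀ i j : ℕ, ∀ hi hj, i ≠ j → (⟨i, hi⟩ : Fin L) ≠ ⟨j, hj⟩ := fun i j _ _ hij e =>
    hij (Fin.mk.inj e)
  have e1 : siteSwap (l + 1) h' (siteL l h) = siteL l h :=
    siteSwap_apply_of_ne _ _ (ne _ _ _ _ (by omega)) (ne _ _ _ _ (by omega))
  have e2 : siteSwap (l + 1) h' (siteR l h) = siteR (l + 1) h' := siteSwap_siteL _ _
  have e3 : siteSwap l h (siteR (l + 1) h') = siteR (l + 1) h' :=
    siteSwap_apply_of_ne _ _ (ne _ _ _ _ (by omega)) (ne _ _ _ _ (by omega))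
  have e4 : siteSwap l h (siteL (l + 1) h') = siteL l h := siteSwap_siteR _ _
  have e5 : siteL (l + 1) h' = siteR l h := rfl
  refine hecke_braid_field (σ := fracSwap l h) (τ := fracSwap (l + 1) h')
    (x := algebraMap _ _ (MvPolynomial.X (siteL l h) - MvPolynomial.X (siteR l h)))
    (y := algebraMap _ _ (MvPolynomial.X (siteL (l + 1) h') - MvPolynomial.X (siteR (l + 1) h')))
    (z := algebraMap _ _ (MvPolynomial.X (siteL l h) - MvPolynomial.X (siteR (l + 1) h')))
    (h := algebraMap _ _ (MvPolynomial.C hbar)) ?_ ?_ ?_ ?_ ?_ ?_ ?_ ?_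
    (X_sub_X_ne_zero (siteL_ne_siteR _ _)) (X_sub_X_ne_zero (siteL_ne_siteR _ _))
    (X_sub_X_ne_zero (ne _ _ _ _ (by omega))) ?_ ?_ ?_ ?_ (fun _ => rfl) (fun _ => rfl) _
  · rw [fracSwap_algebraMap, ← map_neg, map_sub, varSwap_X, varSwap_X, siteSwap_siteL,
      siteSwap_siteR, neg_sub]
  · rw [fracSwap_algebraMap, map_sub, varSwap_X, varSwap_X, e3, e4]
  · rw [fracSwap_algebraMap, map_sub, varSwap_X, varSwap_X, e3, siteSwap_siteL]
  · rw [fracSwap_algebraMap, map_sub, varSwap_X, varSwap_X, e1, e2]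
  · rw [fracSwap_algebraMap, ← map_neg, map_sub, varSwap_X, varSwap_X, siteSwap_siteL,
      siteSwap_siteR, neg_sub]
  · rw [fracSwap_algebraMap, map_sub, varSwap_X, varSwap_X, e1, siteSwap_siteR]
  · rw [fracSwap_algebraMap, varSwap_C]
  · rw [fracSwap_algebraMap, varSwap_C]
  · rw [← map_add]
    congr 1
    rw [e5]
    ring
  · exact fun f => fracSwap_ext (F := (fracSwap l h).comp (fracSwap l h)) (G := RingHom.id _)
      (fun f => by
        rw [RingHom.comp_apply, fracSwap_algebraMap, fracSwap_algebraMap, varSwap_varSwap,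
          RingHom.id_apply]) f
  · exact fun f => fracSwap_ext (F := (fracSwap (l + 1) h').comp (fracSwap (l + 1) h'))
      (G := RingHom.id _) (fun f => by
        rw [RingHom.comp_apply, fracSwap_algebraMap, fracSwap_algebraMap, varSwap_varSwap,
          RingHom.id_apply]) f
  · exact fun f => fracSwap_ext
      (F := (fracSwap l h).comp ((fracSwap (l + 1) h').comp (fracSwap l h)))
      (G := (fracSwap (l + 1) h').comp ((fracSwap l h).comp (fracSwap (l + 1) h')))
      (fun f => by
        simp only [RingHom.comp_apply, fracSwap_algebraMap, varSwap, MvPolynomial.rename_rename]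
        congr 2
        refine congrArg (MvPolynomial.rename (R := ℂ)) (funext fun k => ?_)
        exact siteSwap_braid l h h' k) f

theorem heckeOp_comm {l l' : ℕ} (h : l + 1 < L) (h' : l' + 1 < L) (hll : l + 1 < l')
    (f : PolyTheta L) :
    heckeOp hbar l h (heckeOp hbar l' h' f) = heckeOp hbar l' h' (heckeOp hbar l h f) := by
  have hinj := IsFractionRing.injective (PolyTheta L) (FractionRing (PolyTheta L))
  apply hinj
  simp only [← fracHecke_algebraMap]
  have ne : ∀ i j : ℕ, ∀ hi hj, i ≠ j → (⟨i, hi⟩ : Fin L) ≠ ⟨j, hj⟩ := fun i j _ _ hij e =>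
    hij (Fin.mk.inj e)
  refine hecke_comm_field (σ := fracSwap l h) (τ := fracSwap l' h')
    (x := algebraMap _ _ (MvPolynomial.X (siteL l h) - MvPolynomial.X (siteR l h)))
    (y := algebraMap _ _ (MvPolynomial.X (siteL l' h') - MvPolynomial.X (siteR l' h')))
    (h := algebraMap _ _ (MvPolynomial.C hbar)) ?_ ?_ ?_ ?_
    (X_sub_X_ne_zero (siteL_ne_siteR _ _)) (X_sub_X_ne_zero (siteL_ne_siteR _ _)) ?_
    (fun _ => rfl) (fun _ => rfl) _
  · rw [fracSwap_algebraMap, map_sub, varSwap_X, varSwap_X,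
      siteSwap_apply_of_ne l h (ne _ _ _ _ (by omega)) (ne _ _ _ _ (by omega)),
      siteSwap_apply_of_ne l h (ne _ _ _ _ (by omega)) (ne _ _ _ _ (by omega))]
  · rw [fracSwap_algebraMap, map_sub, varSwap_X, varSwap_X,
      siteSwap_apply_of_ne l' h' (ne _ _ _ _ (by omega)) (ne _ _ _ _ (by omega)),
      siteSwap_apply_of_ne l' h' (ne _ _ _ _ (by omega)) (ne _ _ _ _ (by omega))]
  · rw [fracSwap_algebraMap, varSwap_C]
  · rw [fracSwap_algebraMap, varSwap_C]
  · exact fun f => fracSwap_ext (F := (fracSwap l h).comp (fracSwap l' h'))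
      (G := (fracSwap l' h').comp (fracSwap l h)) (fun f => by
        simp only [RingHom.comp_apply, fracSwap_algebraMap, varSwap, MvPolynomial.rename_rename]
        congr 2
        refine congrArg (MvPolynomial.rename (R := ℂ)) (funext fun k => ?_)
        exact siteSwap_comm h h' hll k) f

end HeckeOperators

section Symmetrizer

variable {E : Type*} [AddCommMonoid E] {c : ℕ → E →+ E} {n : ℕ}

/-- The elements `c_j c_{j+1} ⋯ c_k x`. -/
def descent (c : ℕ → E →+ E) (k : ℕ) (x : E) : ℕ → E
  | 0 => x
  | t + 1 => c (k - t) (descent c k x t)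

theorem descent_fixed (hbraid : ∀ i, i + 1 < n → ∀ x,
      c i (c (i + 1) (c i x)) = c (i + 1) (c i (c (i + 1) x)))
    (hcomm : ∀ i j, i + 1 < j → j < n → ∀ x, c i (c j x) = c j (c i x)) {k : ℕ} (hk : k < n)
    {x : E} (hx : ∀ i < k, c i x = x) (t : ℕ) (i : ℕ) (hi : i ≤ k) (ht : t ≤ k + 1)
    (h1 : t ≠ k - i) (h2 : t ≠ k - i + 1) : c i (descent c k x t) = descent c k x t := by
  induction t using Nat.strong_induction_on generalizing i with
  | _ t ih =>
  obtain _ | t := t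
  · exact hx i (by omega)
  rcases lt_or_gt_of_ne h1 with h3 | h3
  · rw [descent, hcomm i (k - t) (by omega) (by omega),
      ih t (by omega) i hi (by omega) (by omega) (by omega)]
  · obtain _ | t := t
    · omega
    by_cases h4 : t = k - i
    · have e1 : k - t = i := by omega
      have e2 : k - (t + 1) = i - 1 := by omega
      have e3 := hbraid (i - 1) (by omega) (descent c k x t)
      rw [Nat.sub_add_cancel (by omega)] at e3
      rw [descent, descent, e1, e2, ← e3, ih t (by omega) (i - 1) (by omega) (by omega) (by omega)
        (by omega)]
    · rw [descent, ← hcomm (k - (t + 1)) i (by omega) (by omega),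
        ih (t + 1) (by omega) i hi (by omega) (by omega) (by omega)]

theorem descent_swap (hinv : ∀ i < n, ∀ x, c i (c i x) = x)
    (hbraid : ∀ i, i + 1 < n → ∀ x, c i (c (i + 1) (c i x)) = c (i + 1) (c i (c (i + 1) x)))
    (hcomm : ∀ i j, i + 1 < j → j < n → ∀ x, c i (c j x) = c j (c i x)) {k : ℕ} (hk : k < n)
    {x : E} (hx : ∀ i < k, c i x = x) (t : ℕ) (i : ℕ) (hi : i ≤ k) (ht : t ≤ k + 1) :
    c i (descent c k x t) = descent c k x (Equiv.swap (k - i) (k - i + 1) t) := by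
  have e : k - (k - i) = i := by omega
  by_cases h1 : t = k - i
  · subst h1
    rw [Equiv.swap_apply_left, descent, e]
  by_cases h2 : t = k - i + 1
  · subst h2
    rw [Equiv.swap_apply_right, descent, e, hinv i (by omega)]
  · rw [Equiv.swap_apply_of_ne_of_ne h1 h2, descent_fixed hbraid hcomm hk hx t i hi ht h1 h2]

/-- Operators which satisfy the Coxeter relations of the symmetric group have a common fixed
element in every class that is stable under the operators and under sums. -/
theorem exists_common_fixed (hinv : ∀ i < n, ∀ x, c i (c i x) = x)
    (hbraid : ∀ i, i + 1 < n → ∀ x, c i (c (i + 1) (c i x)) = c (i + 1) (c i (c (i + 1) x)))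
    (hcomm : ∀ i j, i + 1 < j → j < n → ∀ x, c i (c j x) = c j (c i x))
    {Q : ℕ → E → Prop} (hQc : ∀ i < n, ∀ a x, Q a x → Q a (c i x))
    (hQadd : ∀ a b x y, Q a x → Q b y → Q (a + b) (x + y)) {x₀ : E} (h0 : Q 1 x₀) (k : ℕ)
    (hk : k ≤ n) : ∃ a x, 0 < a ∧ Q a x ∧ ∀ i < k, c i x = x := by
  induction k with
  | zero => exact ⟨1, x₀, one_pos, h0, fun i hi => absurd hi (Nat.not_lt_zero _)⟩
  | succ k ih =>
    obtain ⟨a, x, ha, hQ, hx⟩ := ih (by omega)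
    have hQd : ∀ t, Q a (descent c k x t) := by
      intro t
      induction t with
      | zero => exact hQ
      | succ t ih => exact hQc _ (by omega) _ _ ih
    refine ⟨a * (k + 2), ∑ t ∈ Finset.range (k + 2), descent c k x t, by positivity, ?_, ?_⟩
    · have : ∀ s : ℕ, Q (a * (s + 1)) (∑ t ∈ Finset.range (s + 1), descent c k x t) := by
        intro s
        induction s with
        | zero => simpa using hQd 0
        | succ s ih =>
          rw [Finset.sum_range_succ, mul_add, mul_one]
          exact hQadd _ _ _ _ ih (hQd _)
      exact this (k + 1)
    · intro i hi
      rw [map_sum, Finset.sum_congr rfl fun t ht => descent_swap hinv hbraid hcomm (by omega) hx t i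
        (by omega) (by have := Finset.mem_range.1 ht; omega)]
      refine Equiv.Perm.sum_comp _ _ (descent c k x) fun t ht => ?_
      rw [Finset.mem_coe, Finset.mem_range]
      by_contra hc
      exact ht (Equiv.swap_apply_of_ne_of_ne (by omega) (by omega))

end Symmetrizer

section Filtered

variable {L : ℕ}

/-- Polynomials of degree less than `k`. -/
noncomputable def polyLT (L k : ℕ) : Submodule ℂ (PolyTheta L) :=
  MvPolynomial.restrictSupport ℂ {d | d.degree < k}

theorem mem_polyLT {k : ℕ} {f : PolyTheta L} :
    f ∈ polyLT L k ↔ ∀ d, f.coeff d ≠ 0 → d.degree < k := by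
  rw [polyLT, MvPolynomial.mem_restrictSupport_iff]
  exact ⟨fun h d hd => h (MvPolynomial.mem_support_iff.2 hd),
    fun h d hd => h d (MvPolynomial.mem_support_iff.1 hd)⟩

theorem mem_polyLT_succ {k : ℕ} {f : PolyTheta L} :
    f ∈ polyLT L (k + 1) ↔ f.totalDegree ≤ k := by
  rw [mem_polyLT]
  constructor
  · intro h
    refine Finset.sup_le fun d hd => ?_
    have := h d (MvPolynomial.mem_support_iff.1 hd)
    exact Nat.lt_succ_iff.1 this
  · intro h d hd
    have := MvPolynomial.le_totalDegree (MvPolynomial.mem_support_iff.2 hd)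
    exact Nat.lt_succ_iff.2 (this.trans h)

theorem polyLT_mono {j k : ℕ} (h : j ≤ k) : polyLT L j ≤ polyLT L k :=
  MvPolynomial.restrictSupport_mono _ fun _ hd => lt_of_lt_of_le hd h

theorem eq_zero_of_mem_polyLT_zero {f : PolyTheta L} (h : f ∈ polyLT L 0) : f = 0 := by
  ext d
  by_contra hd
  exact Nat.not_lt_zero _ (mem_polyLT.1 h d hd)

theorem exists_mem_polyLT (f : PolyTheta L) : ∃ k, f ∈ polyLT L k :=
  ⟨f.totalDegree + 1, mem_polyLT_succ.2 le_rfl⟩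

theorem varSwap_mem_polyLT {l : ℕ} {h : l + 1 < L} {k : ℕ} {f : PolyTheta L}
    (hf : f ∈ polyLT L k) : varSwap l h f ∈ polyLT L k := by
  obtain _ | k := k
  · rw [eq_zero_of_mem_polyLT_zero hf, map_zero]; exact Submodule.zero_mem _
  · rw [mem_polyLT_succ] at hf ⊢
    exact (MvPolynomial.totalDegree_rename_le _ _).trans hf

theorem divDiff_mem_polyLT {l : ℕ} {h : l + 1 < L} {k : ℕ} {f : PolyTheta L}
    (hf : f ∈ polyLT L (k + 1)) : divDiff l h f ∈ polyLT L k := by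
  by_cases h0 : divDiff l h f = 0
  · rw [h0]; exact Submodule.zero_mem _
  have h1 := MvPolynomial.totalDegree_mul_of_isDomain (theta_sub_ne_zero l h) h0
  have h2 : (MvPolynomial.X (siteL l h) - MvPolynomial.X (siteR l h) :
      PolyTheta L).totalDegree = 1 :=
    MvPolynomial.IsHomogeneous.totalDegree
      ((MvPolynomial.isHomogeneous_X _ _).sub (MvPolynomial.isHomogeneous_X _ _))
      (theta_sub_ne_zero l h)
  have h3 := mem_polyLT_succ.1 (Submodule.sub_mem _ (varSwap_mem_polyLT (h := h) hf) hf)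
  rw [theta_sub_mul_divDiff, h2] at h1
  obtain _ | k := k
  · omega
  · rw [mem_polyLT_succ]; omega

/-- Operators which act on the leading homogeneous part as multiplication by `a`. -/
def IsScalarPlusLower (a : ℕ) (X : PolyTheta L →ₗ[PolyChi L] PolyTheta L) : Prop :=
  ∀ k, ∀ f ∈ polyLT L (k + 1), X f - a • f ∈ polyLT L k

theorem IsScalarPlusLower.mem {a : ℕ} {X : PolyTheta L →ₗ[PolyChi L] PolyTheta L}
    (hX : IsScalarPlusLower a X) {k : ℕ} {f : PolyTheta L} (hf : f ∈ polyLT L k) :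
    X f ∈ polyLT L k := by
  obtain _ | k := k
  · rw [eq_zero_of_mem_polyLT_zero hf, map_zero]; exact Submodule.zero_mem _
  have := Submodule.add_mem _ (polyLT_mono (Nat.le_succ k) (hX k f hf))
    (Submodule.smul_of_tower_mem (polyLT L (k + 1)) a hf)
  rwa [sub_add_cancel] at this

theorem IsScalarPlusLower.of_apply_mem {a : ℕ} (ha : 0 < a)
    {X : PolyTheta L →ₗ[PolyChi L] PolyTheta L} (hX : IsScalarPlusLower a X) {k : ℕ}
    {f : PolyTheta L} (hf : X f ∈ polyLT L k) : f ∈ polyLT L k := by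
  have step : ∀ j, f ∈ polyLT L (k + j) → f ∈ polyLT L k := by
    intro j
    induction j with
    | zero => exact id
    | succ j ih =>
      intro h
      refine ih ?_
      have h1 := Submodule.sub_mem _ (polyLT_mono (Nat.le_add_right k j) hf) (hX (k + j) f h)
      rw [sub_sub_cancel, ← Nat.cast_smul_eq_nsmul ℂ] at h1
      exact (Submodule.smul_mem_iff _ (Nat.cast_ne_zero.2 ha.ne')).1 h1
  obtain ⟨j, hj⟩ := exists_mem_polyLT f
  exact step j (polyLT_mono (Nat.le_add_left _ _) hj)

theorem IsScalarPlusLower.bijective {a : ℕ} (ha : 0 < a)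
    {X : PolyTheta L →ₗ[PolyChi L] PolyTheta L} (hX : IsScalarPlusLower a X) :
    Function.Bijective X := by
  constructor
  · rw [injective_iff_map_eq_zero]
    intro f hf
    exact eq_zero_of_mem_polyLT_zero (hX.of_apply_mem ha (by rw [hf]; exact Submodule.zero_mem _))
  · intro g
    obtain ⟨k, hk⟩ := exists_mem_polyLT g
    induction k generalizing g with
    | zero => exact ⟨0, by rw [map_zero, eq_zero_of_mem_polyLT_zero hk]⟩
    | succ k ih =>
      have hg : a • ((a : ℂ)⁻¹ • g) = g := by
        rw [← Nat.cast_smul_eq_nsmul ℂ, smul_smul, mul_inv_cancel₀ (Nat.cast_ne_zero.2 ha.ne'),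
          one_smul]
      have h1 := hX k _ (Submodule.smul_mem _ (a : ℂ)⁻¹ hk)
      rw [hg] at h1
      obtain ⟨f, hf⟩ := ih _ h1
      exact ⟨(a : ℂ)⁻¹ • g - f, by rw [map_sub, hf, sub_sub_cancel]⟩

theorem heckeOp_sub_mem {hbar : ℂ} {l : ℕ} {h : l + 1 < L} {k : ℕ} {f : PolyTheta L}
    (hf : f ∈ polyLT L (k + 1)) : heckeOp hbar l h f - varSwap l h f ∈ polyLT L k := by
  rw [heckeOp_apply, add_sub_cancel_left]
  exact Submodule.smul_mem _ _ (divDiff_mem_polyLT hf)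

theorem heckeOp_mem_polyLT {hbar : ℂ} {l : ℕ} {h : l + 1 < L} {k : ℕ} {f : PolyTheta L}
    (hf : f ∈ polyLT L k) : heckeOp hbar l h f ∈ polyLT L k := by
  obtain _ | k := k
  · rw [eq_zero_of_mem_polyLT_zero hf, map_zero]; exact Submodule.zero_mem _
  have := Submodule.add_mem _
    (polyLT_mono (Nat.le_succ k) (heckeOp_sub_mem (hbar := hbar) (h := h) hf))
    (varSwap_mem_polyLT (h := h) hf)
  rwa [sub_add_cancel] at this

/-- The conjugation `X ↦ b_i X Π_i` on operators, where `b_i` is `heckeOp`. -/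
noncomputable def heckeConj (L : ℕ) (hbar : ℂ) (i : ℕ) :
    (PolyTheta L →ₗ[PolyChi L] PolyTheta L) →+ (PolyTheta L →ₗ[PolyChi L] PolyTheta L) where
  toFun X := if h : i + 1 < L then heckeOp hbar i h ∘ₗ X ∘ₗ heckeOp 0 i h else X
  map_zero' := by split_ifs <;> simp
  map_add' X Y := by
    split_ifs
    · rw [LinearMap.add_comp, LinearMap.comp_add]
    · rfl

theorem heckeConj_apply {hbar : ℂ} {i : ℕ} (h : i + 1 < L)
    (X : PolyTheta L →ₗ[PolyChi L] PolyTheta L) :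
    heckeConj L hbar i X = heckeOp hbar i h ∘ₗ X ∘ₗ heckeOp 0 i h := dif_pos h

/-- An operator which intertwines the undeformed and the deformed symmetric group actions. -/
theorem exists_intertwiner (L : ℕ) (hbar : ℂ) : ∃ a : ℕ, 0 < a ∧
    ∃ φ : PolyTheta L →ₗ[PolyChi L] PolyTheta L, IsScalarPlusLower a φ ∧
      ∀ l h f, φ (varSwap l h f) = heckeOp hbar l h (φ f) := by
  obtain ⟨a, φ, ha, hφ, hfix⟩ : ∃ a X, 0 < a ∧ IsScalarPlusLower a X ∧
      ∀ i < L - 1, heckeConj L hbar i X = X := by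
    refine exists_common_fixed (n := L - 1) (x₀ := LinearMap.id) ?_ ?_ ?_ ?_ ?_ ?_ (L - 1) le_rfl
    · intro i hi X
      have h : i + 1 < L := by omega
      refine LinearMap.ext fun f => ?_
      simp only [heckeConj_apply h, LinearMap.comp_apply, heckeOp_heckeOp]
    · intro i hi X
      have h : i + 1 < L := by omega
      have h' : i + 1 + 1 < L := by omega
      refine LinearMap.ext fun f => ?_
      simp only [heckeConj_apply h, heckeConj_apply h', LinearMap.comp_apply]
      rw [heckeOp_braid, heckeOp_braid]
    · intro i j hij hj X
      have h : i + 1 < L := by omega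
      have h' : j + 1 < L := by omega
      refine LinearMap.ext fun f => ?_
      simp only [heckeConj_apply h, heckeConj_apply h', LinearMap.comp_apply]
      rw [heckeOp_comm _ h h' hij, heckeOp_comm _ h h' hij]
    · intro i hi a X hX k f hf
      have h : i + 1 < L := by omega
      rw [heckeConj_apply h, LinearMap.comp_apply, LinearMap.comp_apply, heckeOp_zero_apply]
      have h1 := hX k _ (varSwap_mem_polyLT (h := h) hf)
      have h2 := heckeOp_mem_polyLT (hbar := hbar) (h := h) h1
      rw [map_sub, map_nsmul] at h2
      have h3 := heckeOp_sub_mem (hbar := hbar) (h := h) (varSwap_mem_polyLT (h := h) hf)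
      rw [varSwap_varSwap] at h3
      have h4 := Submodule.add_mem _ h2 (Submodule.smul_of_tower_mem _ a h3)
      rwa [smul_sub, sub_add_sub_cancel] at h4
    · intro a b X Y hX hY k f hf
      have := Submodule.add_mem _ (hX k f hf) (hY k f hf)
      rw [LinearMap.add_apply, add_smul, add_sub_add_comm]
      exact this
    · intro k f _
      rw [LinearMap.id_apply, one_smul, sub_self]
      exact Submodule.zero_mem _
  refine ⟨a, ha, φ, hφ, fun l h f => ?_⟩
  have h1 := LinearMap.congr_fun (hfix l (by omega)) (varSwap l h f)
  rw [heckeConj_apply h, LinearMap.comp_apply, LinearMap.comp_apply, heckeOp_zero_apply,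
    varSwap_varSwap] at h1
  exact h1.symm

end Filtered

section Artin

variable {L : ℕ}

/-- The polynomial `∏_{j ≥ i} (T - θ_j)`. -/
noncomputable def tailPoly (L i : ℕ) : Polynomial (PolyTheta L) :=
  ∏ j ∈ Finset.univ.filter fun j : Fin L => i ≤ j, (Polynomial.X - Polynomial.C (MvPolynomial.X j))

/-- The subalgebra generated by the symmetric polynomials and `θ_j` for `j < i`. -/
noncomputable def headAlg (L i : ℕ) : Subalgebra (PolyChi L) (PolyTheta L) :=
  Algebra.adjoin (PolyChi L) {f | ∃ j : Fin L, (j : ℕ) < i ∧ f = MvPolynomial.X j}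

theorem headAlg_mono {i j : ℕ} (h : i ≤ j) : headAlg L i ≤ headAlg L j :=
  Algebra.adjoin_mono fun _ ⟨k, hk, hf⟩ => ⟨k, hk.trans_le h, hf⟩

theorem tailPoly_eq_mul {i : ℕ} (hi : i < L) : tailPoly L i =
    (Polynomial.X - Polynomial.C (MvPolynomial.X ⟨i, hi⟩)) * tailPoly L (i + 1) := by
  have : (Finset.univ.filter fun j : Fin L => i ≤ j) =
      insert ⟨i, hi⟩ (Finset.univ.filter fun j : Fin L => i + 1 ≤ j) := by
    ext j
    simp only [Finset.mem_filter, Finset.mem_univ, true_and, Finset.mem_insert, Fin.ext_iff]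
    omega
  rw [tailPoly, this, Finset.prod_insert (by simp), tailPoly]

theorem tailPoly_coeff_mem (i : ℕ) (hi : i ≤ L) (k : ℕ) :
    (tailPoly L i).coeff k ∈ headAlg L i := by
  induction i generalizing k with
  | zero =>
    have hs : (tailPoly L 0).coeff k ∈ PolyChi L := by
      rw [MvPolynomial.mem_symmetricSubalgebra]
      intro σ
      have h1 :
          (tailPoly L 0).map (MvPolynomial.rename σ : PolyTheta L →ₐ[ℂ] PolyTheta L).toRingHom =
          tailPoly L 0 := by
        simp only [tailPoly, Nat.zero_le, Finset.filter_true, Polynomial.map_prod,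
          Polynomial.map_sub, Polynomial.map_X, Polynomial.map_C]
        refine Eq.trans ?_ (Equiv.prod_comp σ fun j : Fin L =>
          (Polynomial.X - Polynomial.C (MvPolynomial.X j) : Polynomial (PolyTheta L)))
        refine Finset.prod_congr rfl fun j _ => ?_
        congr 2
        exact MvPolynomial.rename_X _ _
      have h2 := congrArg (fun f => Polynomial.coeff f k) h1
      simp only [Polynomial.coeff_map] at h2
      exact h2
    exact (headAlg L 0).algebraMap_mem ⟨_, hs⟩
  | succ i ih =>
    have ih := ih (by omega)
    have hrec : ∀ k, (tailPoly L (i + 1)).coeff k = (tailPoly L i).coeff (k + 1) +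
        MvPolynomial.X ⟨i, hi⟩ * (tailPoly L (i + 1)).coeff (k + 1) := fun k => by
      rw [tailPoly_eq_mul hi, sub_mul, Polynomial.coeff_sub, Polynomial.coeff_X_mul,
        Polynomial.coeff_C_mul, sub_add_cancel]
    have key : ∀ s k, (tailPoly L (i + 1)).natDegree < k + s →
        (tailPoly L (i + 1)).coeff k ∈ headAlg L (i + 1) := by
      intro s
      induction s with
      | zero =>
        intro k hk
        rw [Polynomial.coeff_eq_zero_of_natDegree_lt (show _ < k from hk)]
        exact Subalgebra.zero_mem _
      | succ s ih' =>
        intro k hk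
        rw [hrec]
        refine Subalgebra.add_mem _ (headAlg_mono (Nat.le_succ i) (ih _))
          (Subalgebra.mul_mem _ (Algebra.subset_adjoin ⟨⟨i, hi⟩, Nat.lt_succ_self i, rfl⟩)
            (ih' _ (by omega)))
    exact key ((tailPoly L (i + 1)).natDegree + 1) k (by omega)

theorem tailPoly_monic (i : ℕ) : (tailPoly L i).Monic :=
  Polynomial.monic_prod_of_monic _ _ fun _ _ => Polynomial.monic_X_sub_C _

theorem tailPoly_natDegree {i : ℕ} (hi : i ≤ L) : (tailPoly L i).natDegree = L - i := by
  rw [tailPoly, Polynomial.natDegree_prod_of_monic _ _ fun _ _ => Polynomial.monic_X_sub_C _]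
  simp only [Polynomial.natDegree_X_sub_C, Finset.sum_const, smul_eq_mul, mul_one]
  obtain rfl | h := hi.eq_or_lt
  · rw [Nat.sub_self, Finset.card_eq_zero, Finset.filter_eq_empty_iff]
    intro j _; omega
  · have : (Finset.univ.filter fun j : Fin L => i ≤ j) = Finset.Ici ⟨i, h⟩ := by
      ext j; simp [Fin.le_def]
    rw [this, Fin.card_Ici]

theorem X_pow_eq_neg_sum {i : ℕ} (hi : i < L) : (MvPolynomial.X ⟨i, hi⟩ : PolyTheta L) ^ (L - i) =
    -∑ t ∈ Finset.range (L - i), (tailPoly L i).coeff t * MvPolynomial.X ⟨i, hi⟩ ^ t := by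
  have h1 : (tailPoly L i).eval (MvPolynomial.X ⟨i, hi⟩) = 0 := by
    rw [tailPoly_eq_mul hi]; simp
  rw [Polynomial.eval_eq_sum_range, tailPoly_natDegree hi.le, Finset.sum_range_succ] at h1
  have h2 := tailPoly_monic (L := L) i
  rw [Polynomial.Monic, Polynomial.leadingCoeff, tailPoly_natDegree hi.le] at h2
  rw [h2, one_mul] at h1
  exact eq_neg_of_add_eq_zero_right h1

/-- The span over the symmetric polynomials of the monomials `θ^a` with `a_j < L - j` for
`j ≥ i`. -/
noncomputable def artinSpan (L i : ℕ) : Submodule (PolyChi L) (PolyTheta L) :=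
  Submodule.span (PolyChi L) {f | ∃ a : Fin L →₀ ℕ, (∀ j : Fin L, i ≤ j → a j + j < L) ∧
    f = MvPolynomial.monomial a 1}

theorem mul_mem_artinSpan {i : ℕ} {s w : PolyTheta L} (hs : s ∈ headAlg L i)
    (hw : w ∈ artinSpan L i) : s * w ∈ artinSpan L i := by
  induction hs using Algebra.adjoin_induction generalizing w with
  | mem s hs =>
    obtain ⟨j, hj, rfl⟩ := hs
    induction hw using Submodule.span_induction with
    | mem w hw =>
      obtain ⟨a, ha, rfl⟩ := hw
      refine Submodule.subset_span ⟨Finsupp.single j 1 + a, fun k hk => ?_, ?_⟩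
      · have : k ≠ j := fun e => by subst e; omega
        rw [Finsupp.add_apply, Finsupp.single_eq_of_ne this, zero_add]
        exact ha k hk
      · rw [MvPolynomial.X, MvPolynomial.monomial_mul, one_mul]
    | zero => rw [mul_zero]; exact Submodule.zero_mem _
    | add w w' _ _ h h' => rw [mul_add]; exact Submodule.add_mem _ h h'
    | smul c w _ h => rw [mul_smul_comm]; exact Submodule.smul_mem _ _ h
  | algebraMap r => rw [← Algebra.smul_def]; exact Submodule.smul_mem _ _ hw
  | add s t _ _ h h' => rw [add_mul]; exact Submodule.add_mem _ (h hw) (h' hw)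
  | mul s t _ _ h h' => rw [mul_assoc]; exact h (h' hw)

theorem artinSpan_succ_le {i : ℕ} (hi : i < L) : artinSpan L (i + 1) ≤ artinSpan L i := by
  have key : ∀ e : ℕ, ∀ a : Fin L →₀ ℕ, a ⟨i, hi⟩ = e → (∀ j : Fin L, i + 1 ≤ j → a j + j < L) →
      (MvPolynomial.monomial a 1 : PolyTheta L) ∈ artinSpan L i := by
    intro e
    induction e using Nat.strong_induction_on with
    | _ e ih =>
    intro a hae ha
    by_cases he : e + i < L
    · refine Submodule.subset_span ⟨a, fun j hj => ?_, rfl⟩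
      rcases hj.eq_or_lt with h | h
      · have : j = ⟨i, hi⟩ := Fin.ext h.symm
        subst this
        rw [hae]; exact he
      · exact ha j h
    · let a' := a - Finsupp.single ⟨i, hi⟩ (L - i)
      have haa : Finsupp.single ⟨i, hi⟩ (L - i) + a' = a := by
        ext j
        rw [Finsupp.add_apply, Finsupp.tsub_apply]
        by_cases hj : j = ⟨i, hi⟩
        · subst hj; rw [Finsupp.single_eq_same, hae]; omega
        · rw [Finsupp.single_eq_of_ne hj]; omega
      have h1 : (MvPolynomial.monomial a 1 : PolyTheta L) =
          MvPolynomial.X ⟨i, hi⟩ ^ (L - i) * MvPolynomial.monomial a' 1 := by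
        rw [MvPolynomial.X_pow_eq_monomial, MvPolynomial.monomial_mul, one_mul, haa]
      rw [h1, X_pow_eq_neg_sum hi, neg_mul, Finset.sum_mul]
      refine Submodule.neg_mem _ (Submodule.sum_mem _ fun t ht => ?_)
      have ht := Finset.mem_range.1 ht
      rw [mul_assoc]
      refine mul_mem_artinSpan (tailPoly_coeff_mem i hi.le t) ?_
      rw [MvPolynomial.X_pow_eq_monomial, MvPolynomial.monomial_mul, one_mul]
      refine ih (t + (e - (L - i))) (by omega) _ ?_ fun j hj => ?_
      · rw [Finsupp.add_apply, Finsupp.tsub_apply, Finsupp.single_eq_same, Finsupp.single_eq_same,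
          hae]
      · have hj' : j ≠ ⟨i, hi⟩ := fun h => by subst h; simp at hj
        rw [Finsupp.add_apply, Finsupp.tsub_apply, Finsupp.single_eq_of_ne hj',
          Finsupp.single_eq_of_ne hj']
        have := ha j hj
        omega
  refine Submodule.span_le.2 ?_
  rintro f ⟨a, ha, rfl⟩
  exact key _ a rfl ha

theorem complex_smul_mem {W : Submodule (PolyChi L) (PolyTheta L)} {f : PolyTheta L} (hf : f ∈ W)
    (c : ℂ) : c • f ∈ W := by
  rw [← algebraMap_smul (PolyChi L) c f]
  exact W.smul_mem _ hf

theorem artinSpan_eq_top (i : ℕ) (hi : i ≤ L) : artinSpan L i = ⊤ := by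
  induction hi using Nat.decreasingInduction with
  | self =>
    refine eq_top_iff.2 fun f _ => ?_
    rw [← MvPolynomial.support_sum_monomial_coeff f]
    refine Submodule.sum_mem _ fun d _ => ?_
    rw [← mul_one (f.coeff d), ← smul_eq_mul, ← MvPolynomial.smul_monomial]
    have hd : (MvPolynomial.monomial d 1 : PolyTheta L) ∈ artinSpan L L :=
      Submodule.subset_span ⟨d, fun j hj => by omega, rfl⟩
    exact complex_smul_mem hd _
  | of_succ i hi ih => exact eq_top_iff.2 (ih ▸ artinSpan_succ_le hi)

/-- Exponents of the Artin monomials. -/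
abbrev ArtinIdx (L : ℕ) : Type := (j : Fin L) → Fin (L - j)

theorem card_artinIdx (L : ℕ) : Fintype.card (ArtinIdx L) = L.factorial := by
  rw [Fintype.card_pi]
  simp only [Fintype.card_fin]
  rw [Finset.prod_fin_eq_prod_range]
  rw [Finset.prod_congr rfl fun i hi => dif_pos (Finset.mem_range.1 hi),
    ← Finset.prod_range_reflect, ← Finset.prod_range_add_one_eq_factorial]
  refine Finset.prod_congr rfl fun i hi => ?_
  have := Finset.mem_range.1 hi
  omega

/-- The exponent vector of an Artin monomial. -/
noncomputable def artinExp (a : ArtinIdx L) : Fin L →₀ ℕ :=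
  Finsupp.equivFunOnFinite.symm fun j => (a j : ℕ)

/-- The Artin monomials. -/
noncomputable def artinMonomial (a : ArtinIdx L) : PolyTheta L :=
  MvPolynomial.monomial (artinExp a) 1

theorem span_artinMonomial :
    Submodule.span (PolyChi L) (Set.range (artinMonomial (L := L))) = ⊤ := by
  rw [← artinSpan_eq_top 0 (Nat.zero_le L), artinSpan]
  congr 1
  ext f
  constructor
  · rintro ⟨a, rfl⟩
    refine ⟨artinExp a, fun j _ => ?_, rfl⟩
    have := (a j).2
    change (a j : ℕ) + j < L
    omega
  · rintro ⟨a, ha, rfl⟩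
    refine ⟨fun j => ⟨a j, by have := ha j (Nat.zero_le _); omega⟩, ?_⟩
    exact congrArg (fun e => MvPolynomial.monomial e 1) (Finsupp.ext fun j => rfl)

end Artin

section Evaluation

variable {L : ℕ}

theorem eval_comp_perm (x : Fin L → ℂ) (σ : Equiv.Perm (Fin L)) (f : PolyTheta L) :
    MvPolynomial.eval (x ∘ σ) f = MvPolynomial.eval x (MvPolynomial.rename σ f) :=
  (MvPolynomial.eval_rename _ _ _).symm

theorem eval_comp_perm_chi (x : Fin L → ℂ) (σ : Equiv.Perm (Fin L)) (r : PolyChi L) :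
    MvPolynomial.eval (x ∘ σ) (r : PolyTheta L) = MvPolynomial.eval x (r : PolyTheta L) := by
  rw [eval_comp_perm, (MvPolynomial.mem_symmetricSubalgebra _).1 r.2]

theorem eval_chi_smul (x : Fin L → ℂ) (r : PolyChi L) (f : PolyTheta L) :
    MvPolynomial.eval x (r • f) = MvPolynomial.eval x (r : PolyTheta L) * MvPolynomial.eval x f :=
  map_mul _ _ _

theorem exists_eval_perm {x : Fin L → ℂ} (hx : Function.Injective x)
    (c : Equiv.Perm (Fin L) → ℂ) : ∃ f : PolyTheta L,
      ∀ σ : Equiv.Perm (Fin L), MvPolynomial.eval (x ∘ σ) f = c σ := by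
  have hsep : ∀ σ τ : Equiv.Perm (Fin L), ∃ f : PolyTheta L, σ ≠ τ →
      MvPolynomial.eval (x ∘ σ) f = 1 ∧ MvPolynomial.eval (x ∘ τ) f = 0 := by
    intro σ τ
    by_cases h : σ = τ
    · exact ⟨0, fun h' => absurd h h'⟩
    · obtain ⟨i, hi⟩ := Function.ne_iff.1 fun e => h (Equiv.coe_fn_injective e)
      have hne : x (σ i) - x (τ i) ≠ 0 := sub_ne_zero.2 fun e => hi (hx e)
      refine ⟨MvPolynomial.C (x (σ i) - x (τ i))⁻¹ *
        (MvPolynomial.X i - MvPolynomial.C (x (τ i))), fun _ => ⟨?_, ?_⟩⟩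
      · simp [hne]
      · simp
  choose g hg using hsep
  refine ⟨∑ σ, MvPolynomial.C (c σ) * ∏ τ ∈ Finset.univ.erase σ, g σ τ, fun σ => ?_⟩
  rw [map_sum, Finset.sum_eq_single σ]
  · rw [map_mul, MvPolynomial.eval_C, map_prod, Finset.prod_eq_one, mul_one]
    exact fun τ hτ => (hg σ τ (Finset.ne_of_mem_erase hτ).symm).1
  · intro τ _ hτ
    rw [map_mul, map_prod, Finset.prod_eq_zero (Finset.mem_erase.2 ⟨hτ.symm, Finset.mem_univ σ⟩),
      mul_zero]
    exact (hg τ σ hτ).2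
  · intro h; exact absurd (Finset.mem_univ _) h

theorem eq_zero_of_eval_injective {f : PolyTheta L}
    (h : ∀ x : Fin L → ℂ, Function.Injective x → MvPolynomial.eval x f = 0) : f = 0 := by
  have hv : (∏ q ∈ ltPairs L, (MvPolynomial.X q.2 - MvPolynomial.X q.1) : PolyTheta L) ≠ 0 := by
    refine Finset.prod_ne_zero_iff.2 fun q hq => sub_ne_zero.2 fun e => ?_
    have h1 : q.1 < q.2 := by simpa [ltPairs] using hq
    exact h1.ne' (MvPolynomial.X_injective e)
  refine (mul_eq_zero.1 (MvPolynomial.funext (q := 0) fun x => ?_)).resolve_right hv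
  rw [map_mul, map_zero]
  by_cases hx : Function.Injective x
  · rw [h x hx, zero_mul]
  · have : ∃ i j : Fin L, i < j ∧ x i = x j := by
      rw [Function.Injective] at hx
      push Not at hx
      obtain ⟨i, j, hij, hne⟩ := hx
      rcases hne.lt_or_gt with h1 | h1
      · exact ⟨i, j, h1, hij⟩
      · exact ⟨j, i, h1, hij.symm⟩
    obtain ⟨i, j, hij, he⟩ := this
    rw [map_prod, Finset.prod_eq_zero (i := (i, j)) (by simpa [ltPairs] using hij), mul_zero]
    simp [he]

variable {ι : Type*} [Fintype ι] {b : ι → PolyTheta L}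

/-- The values of linear combinations of the `b_i` on the orbit of a point. -/
noncomputable def orbitEval (b : ι → PolyTheta L) (x : Fin L → ℂ) :
    (ι → ℂ) →ₗ[ℂ] (Equiv.Perm (Fin L) → ℂ) where
  toFun z σ := MvPolynomial.eval (x ∘ σ) (∑ i, z i • b i)
  map_add' z z' := by
    funext σ
    simp only [Pi.add_apply, add_smul, Finset.sum_add_distrib, map_add]
  map_smul' c z := by
    funext σ
    simp only [Pi.smul_apply, smul_eq_mul, mul_smul, ← Finset.smul_sum, MvPolynomial.smul_eval,
      RingHom.id_apply]

theorem orbitEval_bijective (hcard : Fintype.card ι = L.factorial)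
    (hspan : Submodule.span (PolyChi L) (Set.range b) = ⊤) {x : Fin L → ℂ}
    (hx : Function.Injective x) : Function.Bijective (orbitEval b x) := by
  have hsurj : Function.Surjective (orbitEval b x) := by
    intro c
    obtain ⟨f, hf⟩ := exists_eval_perm hx c
    have hm : f ∈ Submodule.span (PolyChi L) (Set.range b) := hspan ▸ Submodule.mem_top
    obtain ⟨r, rfl⟩ := (Submodule.mem_span_range_iff_exists_fun _).1 hm
    refine ⟨fun i => MvPolynomial.eval x (r i : PolyTheta L), funext fun σ => ?_⟩
    rw [← hf σ]
    change MvPolynomial.eval (x ∘ σ) _ = _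
    rw [map_sum, map_sum]
    refine Finset.sum_congr rfl fun i _ => ?_
    rw [MvPolynomial.smul_eval, eval_chi_smul, eval_comp_perm_chi]
  refine ⟨(LinearMap.injective_iff_surjective_of_finrank_eq_finrank ?_).2 hsurj, hsurj⟩
  rw [Module.finrank_pi, Module.finrank_pi, hcard, Fintype.card_perm, Fintype.card_fin]

/-- A family of `L!` polynomials which spans over the symmetric polynomials is independent. -/
theorem linearIndependent_of_span (hcard : Fintype.card ι = L.factorial)
    (hspan : Submodule.span (PolyChi L) (Set.range b) = ⊤) : LinearIndependent (PolyChi L) b := by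
  rw [Fintype.linearIndependent_iff]
  intro r hr i
  refine Subtype.ext (eq_zero_of_eval_injective fun x hx => ?_)
  have h0 : orbitEval b x (fun i => MvPolynomial.eval x (r i : PolyTheta L)) = 0 := by
    funext σ
    have := congrArg (MvPolynomial.eval (x ∘ σ)) hr
    rw [map_sum, map_zero] at this
    refine Eq.trans ?_ this
    change MvPolynomial.eval (x ∘ σ) _ = _
    rw [map_sum]
    refine Finset.sum_congr rfl fun i _ => ?_
    rw [MvPolynomial.smul_eval, eval_chi_smul, eval_comp_perm_chi]
  have h1 := (orbitEval_bijective hcard hspan hx).1 (h0.trans (map_zero _).symm)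
  exact congrFun h1 i

end Evaluation

section Specialize

variable {L : ℕ} {ι : Type*} [Fintype ι] (b : Module.Basis ι (PolyChi L) (PolyTheta L))
  (s : PolyChi L →ₗ[ℂ] ℂ)

/-- Apply a linear functional to the coordinates with respect to a basis over `ℂ[χ]`. -/
noncomputable def specialize : PolyTheta L →ₗ[ℂ] PolyTheta L where
  toFun f := ∑ i, s (b.repr f i) • b i
  map_add' f g := by simp [add_smul, Finset.sum_add_distrib]
  map_smul' c f := by
    have : b.repr (c • f) = c • b.repr f := by
      rw [← algebraMap_smul (PolyChi L) c f, map_smul, algebraMap_smul]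
    simp only [this, Finsupp.smul_apply, map_smul, smul_eq_mul, mul_smul, RingHom.id_apply,
      Finset.smul_sum]

theorem specialize_apply (f : PolyTheta L) : specialize b s f = ∑ i, s (b.repr f i) • b i := rfl

theorem specialize_smul_basis (r : PolyChi L) (i : ι) :
    specialize b s (r • b i) = s r • b i := by
  classical
  rw [specialize_apply, Finset.sum_eq_single i]
  · simp
  · intro j _ hj
    simp [hj.symm]
  · intro h; exact absurd (Finset.mem_univ _) h

theorem specialize_smul_of_mem (r : PolyChi L) {f : PolyTheta L}
    (hf : f ∈ Submodule.span ℂ (Set.range b)) : specialize b s (r • f) = s r • f := by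
  induction hf using Submodule.span_induction with
  | mem f hf => obtain ⟨i, rfl⟩ := hf; exact specialize_smul_basis b s r i
  | zero => simp
  | add f g _ _ hf hg => rw [smul_add, map_add, hf, hg, smul_add]
  | smul c f _ hf => rw [smul_comm, map_smul, hf, smul_comm]

theorem specialize_mem (f : PolyTheta L) :
    specialize b s f ∈ Submodule.span ℂ (Set.range b) :=
  Submodule.sum_mem _ fun i _ => Submodule.smul_mem _ _ (Submodule.subset_span ⟨i, rfl⟩)

theorem rename_chi_smul (σ : Equiv.Perm (Fin L)) (r : PolyChi L) (f : PolyTheta L) :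
    MvPolynomial.rename σ (r • f) = r • MvPolynomial.rename σ f := by
  change MvPolynomial.rename σ ((r : PolyTheta L) * f) = (r : PolyTheta L) * _
  rw [map_mul, (MvPolynomial.mem_symmetricSubalgebra _).1 r.2]

variable {b} in
theorem specialize_rename {σ : Equiv.Perm (Fin L)}
    (hb : ∀ i, MvPolynomial.rename σ (b i) ∈ Submodule.span ℂ (Set.range b)) (f : PolyTheta L) :
    specialize b s (MvPolynomial.rename σ f) = MvPolynomial.rename σ (specialize b s f) := by
  conv_lhs => rw [← b.sum_repr f]
  rw [map_sum, map_sum, specialize_apply, map_sum]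
  refine Finset.sum_congr rfl fun i _ => ?_
  rw [rename_chi_smul, specialize_smul_of_mem b s _ (hb i), map_smul]

end Specialize

section StableBasis

variable {L : ℕ}

/-- The basis of `ℂ[θ]` over `ℂ[χ]` by Artin monomials. -/
noncomputable def artinBasis (L : ℕ) : Module.Basis (ArtinIdx L) (PolyChi L) (PolyTheta L) :=
  Module.Basis.mk (linearIndependent_of_span (card_artinIdx L) span_artinMonomial)
    span_artinMonomial.ge

theorem artinBasis_apply (a : ArtinIdx L) : artinBasis L a = artinMonomial a :=
  Module.Basis.mk_apply _ _ _

/-- The constant term of a symmetric polynomial. -/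
noncomputable def chiConst (L : ℕ) : PolyChi L →ₗ[ℂ] ℂ :=
  MvPolynomial.lcoeff ℂ (0 : Fin L →₀ ℕ) ∘ₗ (PolyChi L).val.toLinearMap

theorem chiConst_apply (r : PolyChi L) :
    chiConst L r = MvPolynomial.constantCoeff (r : PolyTheta L) :=
  rfl

/-- The projection of `ℂ[θ]` to the span of the Artin monomials. -/
noncomputable def artinProj (L : ℕ) : PolyTheta L →ₗ[ℂ] PolyTheta L :=
  specialize (artinBasis L) (chiConst L)

theorem artinProj_smul (r : PolyChi L) (f : PolyTheta L) :
    artinProj L (r • f) = chiConst L r • artinProj L f := by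
  rw [artinProj, specialize_apply, specialize_apply, Finset.smul_sum]
  refine Finset.sum_congr rfl fun a _ => ?_
  rw [map_smul, Finsupp.smul_apply, smul_smul, chiConst_apply, chiConst_apply, chiConst_apply,
    smul_eq_mul, MulMemClass.coe_mul, map_mul]

theorem artinProj_artinMonomial (a : ArtinIdx L) :
    artinProj L (artinMonomial a) = artinMonomial a := by
  have h := specialize_smul_basis (artinBasis L) (chiConst L) 1 a
  rwa [one_smul, artinBasis_apply, chiConst_apply, OneMemClass.coe_one, map_one, one_smul] at h

theorem homogeneousComponent_mem_chi (r : PolyChi L) (j : ℕ) :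
    MvPolynomial.homogeneousComponent j (r : PolyTheta L) ∈ PolyChi L := by
  rw [MvPolynomial.mem_symmetricSubalgebra]
  intro σ
  refine MvPolynomial.ext _ _ fun d => ?_
  obtain ⟨d, rfl⟩ : ∃ d' : Fin L →₀ ℕ, d'.mapDomain σ = d :=
    ⟨d.mapDomain σ.symm, by rw [← Finsupp.mapDomain_comp]; simp⟩
  rw [MvPolynomial.coeff_rename_mapDomain _ σ.injective, MvPolynomial.coeff_homogeneousComponent,
    MvPolynomial.coeff_homogeneousComponent, Finsupp.degree_mapDomain]
  have h := (MvPolynomial.mem_symmetricSubalgebra _).1 r.2 σ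
  conv_rhs => rw [← h]
  rw [MvPolynomial.coeff_rename_mapDomain _ σ.injective]

theorem artinMonomial_isHomogeneous (a : ArtinIdx L) :
    (artinMonomial a).IsHomogeneous (artinExp a).degree :=
  MvPolynomial.isHomogeneous_monomial _ rfl

/-- A homogeneous polynomial is a combination of Artin monomials with homogeneous symmetric
coefficients of complementary degrees. -/
theorem homogeneousComponent_mem_span (f : PolyTheta L) (k : ℕ) :
    MvPolynomial.homogeneousComponent k f ∈ Submodule.span ℂ
      {g : PolyTheta L | ∃ (r : PolyChi L) (a : ArtinIdx L) (j : ℕ),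
        (r : PolyTheta L).IsHomogeneous j ∧ j + (artinExp a).degree = k ∧
          g = r • artinMonomial a} := by
  rw [← (artinBasis L).sum_repr f, map_sum]
  refine Submodule.sum_mem _ fun a _ => ?_
  rw [artinBasis_apply]
  generalize (artinBasis L).repr f a = r
  have h1 : r • artinMonomial a = ∑ j ∈ Finset.range ((r : PolyTheta L).totalDegree + 1),
      (⟨_, homogeneousComponent_mem_chi r j⟩ : PolyChi L) • artinMonomial a := by
    change (r : PolyTheta L) * artinMonomial a = ∑ j ∈ _,
      MvPolynomial.homogeneousComponent j (r : PolyTheta L) * artinMonomial a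
    rw [← Finset.sum_mul, MvPolynomial.sum_homogeneousComponent]
  rw [h1, map_sum]
  refine Submodule.sum_mem _ fun j _ => ?_
  have h2 : MvPolynomial.IsHomogeneous ((⟨_, homogeneousComponent_mem_chi r j⟩ : PolyChi L) •
      artinMonomial a) (j + (artinExp a).degree) :=
    (MvPolynomial.homogeneousComponent_isHomogeneous j _).mul (artinMonomial_isHomogeneous a)
  rw [MvPolynomial.homogeneousComponent_of_mem h2]
  split_ifs with h
  · exact Submodule.subset_span
      ⟨_, a, j, MvPolynomial.homogeneousComponent_isHomogeneous j _, h.symm, rfl⟩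
  · exact Submodule.zero_mem _

theorem sub_artinProj_mem {k : ℕ} {f : PolyTheta L} (hf : f ∈ polyLT L (k + 1)) :
    f - artinProj L f ∈ Submodule.span (PolyChi L) (polyLT L k : Set (PolyTheta L)) := by
  let W : Submodule ℂ (PolyTheta L) :=
    (Submodule.span (PolyChi L) (polyLT L k : Set (PolyTheta L))).restrictScalars ℂ
  have hlin : ∀ g ∈ Submodule.span ℂ {g : PolyTheta L | ∃ (r : PolyChi L) (a : ArtinIdx L) (j : ℕ),
      (r : PolyTheta L).IsHomogeneous j ∧ j + (artinExp a).degree ≤ k ∧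
          g = r • artinMonomial a},
      g - artinProj L g ∈ W := by
    intro g hg
    refine (Submodule.span_le
      (p := W.comap (LinearMap.id - artinProj L : PolyTheta L →ₗ[ℂ] PolyTheta L))).2 ?_ hg
    rintro _ ⟨r, a, j, hr, hk, rfl⟩
    change r • artinMonomial a - artinProj L (r • artinMonomial a) ∈ W
    rw [artinProj_smul, artinProj_artinMonomial]
    rcases Nat.eq_zero_or_pos j with rfl | hj
    · have h1 : (r : PolyTheta L) = MvPolynomial.C (chiConst L r) :=
        MvPolynomial.totalDegree_eq_zero_iff_eq_C.1
          ((MvPolynomial.totalDegree_zero_iff_isHomogeneous _).2 hr)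
      have h2 : r • artinMonomial a = chiConst L r • artinMonomial a := by
        rw [MvPolynomial.smul_eq_C_mul, ← h1]; rfl
      rw [h2, sub_self]
      exact Submodule.zero_mem _
    · have h1 : chiConst L r = 0 := by
        by_contra hc
        have := hr hc
        simp at this
        omega
      rw [h1, zero_smul, sub_zero]
      refine Submodule.smul_mem _ _ (Submodule.subset_span ?_)
      have : 0 < k := by omega
      obtain ⟨k, rfl⟩ := Nat.exists_eq_succ_of_ne_zero this.ne'
      refine mem_polyLT_succ.2 ?_
      exact (artinMonomial_isHomogeneous a).totalDegree_le.trans (by omega)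
  refine hlin f ?_
  rw [← MvPolynomial.sum_homogeneousComponent f]
  refine Submodule.sum_mem _ fun j hj => ?_
  refine Submodule.span_mono ?_ (homogeneousComponent_mem_span f j)
  rintro _ ⟨r, a, i, hr, hi, rfl⟩
  have := mem_polyLT_succ.1 hf
  have := Finset.mem_range.1 hj
  exact ⟨r, a, i, hr, by omega, rfl⟩

theorem rename_mem_polyLT (σ : Equiv.Perm (Fin L)) {k : ℕ} {f : PolyTheta L}
    (hf : f ∈ polyLT L k) : MvPolynomial.rename σ f ∈ polyLT L k := by
  obtain _ | k := k
  · rw [eq_zero_of_mem_polyLT_zero hf, map_zero]; exact Submodule.zero_mem _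
  · rw [mem_polyLT_succ] at hf ⊢
    exact (MvPolynomial.totalDegree_rename_le _ _).trans hf

/-- The symmetrization of `artinProj` under permutations of the variables. -/
noncomputable def symProj (L : ℕ) : PolyTheta L →ₗ[ℂ] PolyTheta L :=
  ∑ σ : Equiv.Perm (Fin L), (MvPolynomial.rename σ : PolyTheta L →ₐ[ℂ] PolyTheta L).toLinearMap ∘ₗ
    artinProj L ∘ₗ (MvPolynomial.rename ⇑σ⁻¹ : PolyTheta L →ₐ[ℂ] PolyTheta L).toLinearMap

theorem symProj_apply (f : PolyTheta L) : symProj L f = ∑ σ : Equiv.Perm (Fin L),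
    MvPolynomial.rename σ (artinProj L (MvPolynomial.rename ⇑σ⁻¹ f)) := by
  simp [symProj]

theorem symProj_smul (r : PolyChi L) (f : PolyTheta L) :
    symProj L (r • f) = chiConst L r • symProj L f := by
  simp only [symProj_apply, rename_chi_smul, artinProj_smul, map_smul, Finset.smul_sum]

theorem rename_symProj (τ : Equiv.Perm (Fin L)) (f : PolyTheta L) :
    MvPolynomial.rename τ (symProj L f) = symProj L (MvPolynomial.rename τ f) := by
  rw [symProj_apply, symProj_apply, map_sum]
  refine Fintype.sum_equiv (Equiv.mulLeft τ) _ _ fun σ => ?_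
  rw [MvPolynomial.rename_rename, MvPolynomial.rename_rename, Equiv.coe_mulLeft, mul_inv_rev]
  have : ⇑(σ⁻¹ * τ⁻¹) ∘ ⇑τ = ⇑σ⁻¹ := by funext i; simp
  rw [this]
  rfl

theorem rename_rename_inv (σ : Equiv.Perm (Fin L)) (f : PolyTheta L) :
    MvPolynomial.rename σ (MvPolynomial.rename ⇑σ⁻¹ f) = f := by
  rw [MvPolynomial.rename_rename]
  have : ⇑σ ∘ ⇑σ⁻¹ = id := by funext i; simp
  rw [this, MvPolynomial.rename_id_apply]

theorem rename_mem_span_polyLT (σ : Equiv.Perm (Fin L)) {k : ℕ} {f : PolyTheta L}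
    (hf : f ∈ Submodule.span (PolyChi L) (polyLT L k : Set (PolyTheta L))) :
    MvPolynomial.rename σ f ∈ Submodule.span (PolyChi L) (polyLT L k : Set (PolyTheta L)) := by
  induction hf using Submodule.span_induction with
  | mem f hf => exact Submodule.subset_span (rename_mem_polyLT σ hf)
  | zero => rw [map_zero]; exact Submodule.zero_mem _
  | add f g _ _ hf hg => rw [map_add]; exact Submodule.add_mem _ hf hg
  | smul r f _ hf => rw [rename_chi_smul]; exact Submodule.smul_mem _ _ hf

theorem sub_symProj_mem {k : ℕ} {f : PolyTheta L} (hf : f ∈ polyLT L (k + 1)) :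
    (L.factorial : ℂ) • f - symProj L f ∈
      Submodule.span (PolyChi L) (polyLT L k : Set (PolyTheta L)) := by
  have h : (L.factorial : ℂ) • f - symProj L f = ∑ σ : Equiv.Perm (Fin L), MvPolynomial.rename σ
      (MvPolynomial.rename ⇑σ⁻¹ f - artinProj L (MvPolynomial.rename ⇑σ⁻¹ f)) := by
    simp only [map_sub, rename_rename_inv, Finset.sum_sub_distrib, symProj_apply, Finset.sum_const,
      Finset.card_univ, Fintype.card_perm, Fintype.card_fin, Nat.cast_smul_eq_nsmul]
  rw [h]
  exact Submodule.sum_mem _ fun σ _ =>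
    rename_mem_span_polyLT σ (sub_artinProj_mem (rename_mem_polyLT _ hf))

theorem symProj_mem_span (f : PolyTheta L) :
    symProj L f ∈ Submodule.span ℂ (Set.range fun a => symProj L (artinMonomial (L := L) a)) := by
  rw [← (artinBasis L).sum_repr f, map_sum]
  refine Submodule.sum_mem _ fun a _ => ?_
  rw [symProj_smul, artinBasis_apply]
  exact Submodule.smul_mem _ _ (Submodule.subset_span ⟨a, rfl⟩)

theorem span_symProj_artinMonomial : Submodule.span (PolyChi L)
    (Set.range fun a => symProj L (artinMonomial (L := L) a)) = ⊤ := by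
  set W := Submodule.span (PolyChi L)
    (Set.range fun a => symProj L (artinMonomial (L := L) a)) with hW
  have key : ∀ k, ∀ f ∈ polyLT L k, f ∈ W := by
    intro k
    induction k with
    | zero => intro f hf; rw [eq_zero_of_mem_polyLT_zero hf]; exact Submodule.zero_mem _
    | succ k ih =>
      intro f hf
      have h1 : (L.factorial : ℂ) • f - symProj L f ∈ W :=
        (Submodule.span_le.2 ih) (sub_symProj_mem hf)
      have h2 : symProj L f ∈ W :=
        (Submodule.span_le_restrictScalars ℂ (PolyChi L) _) (symProj_mem_span f)
      have h3 := complex_smul_mem (Submodule.add_mem _ h1 h2) (L.factorial : ℂ)⁻¹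
      rwa [sub_add_cancel, smul_smul,
        inv_mul_cancel₀ (Nat.cast_ne_zero.2 L.factorial_ne_zero), one_smul] at h3
  refine eq_top_iff.2 fun f _ => ?_
  obtain ⟨k, hk⟩ := exists_mem_polyLT f
  exact key k f hk

/-- A basis of `ℂ[θ]` over `ℂ[χ]` whose complex span is stable under permutations. -/
noncomputable def stableBasis (L : ℕ) : Module.Basis (ArtinIdx L) (PolyChi L) (PolyTheta L) :=
  Module.Basis.mk (linearIndependent_of_span (card_artinIdx L) span_symProj_artinMonomial)
    span_symProj_artinMonomial.ge

theorem stableBasis_apply (a : ArtinIdx L) : stableBasis L a = symProj L (artinMonomial a) :=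
  Module.Basis.mk_apply _ _ _

theorem rename_stableBasis_mem (σ : Equiv.Perm (Fin L)) (a : ArtinIdx L) :
    MvPolynomial.rename σ (stableBasis L a) ∈ Submodule.span ℂ (Set.range (stableBasis L)) := by
  have h : ⇑(stableBasis L) = fun a => symProj L (artinMonomial a) := funext stableBasis_apply
  rw [h, rename_symProj]
  exact symProj_mem_span _

end StableBasis

section ExtendTheta

variable {m n L : ℕ} {U : Submodule ℂ (Chain m n L)}

theorem mem_extendTheta_iff_coeff {v : ThetaChain m n L} :
    v ∈ extendTheta U ↔ ∀ d, (fun J => (v J).coeff d) ∈ U := by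
  constructor
  · intro hv
    induction hv using Submodule.span_induction with
    | mem w hw =>
      obtain ⟨u, hu, rfl⟩ := hw
      intro d
      by_cases hd : d = 0
      · subst hd
        convert hu using 1
        funext J
        simp
      · convert U.zero_mem using 1
        funext J
        rw [MvPolynomial.coeff_C, if_neg (Ne.symm hd)]; rfl
    | zero =>
      intro d
      convert U.zero_mem using 1
      funext J
      simp
    | add v w _ _ hv hw =>
      intro d
      convert U.add_mem (hv d) (hw d) using 1
      funext J
      simp
    | smul p v _ hv =>
      intro d
      have : (fun J => ((p • v) J).coeff d) = ∑ x ∈ Finset.HasAntidiagonal.antidiagonal d,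
          p.coeff x.1 • fun J => (v J).coeff x.2 := by
        funext J
        rw [Pi.smul_apply, smul_eq_mul, MvPolynomial.coeff_mul, Finset.sum_apply]
        rfl
      rw [this]
      exact U.sum_mem fun x _ => U.smul_mem _ (hv _)
  · intro hv
    classical
    have : v = ∑ d ∈ Finset.univ.biUnion fun J => (v J).support,
        (MvPolynomial.monomial d 1 : PolyTheta L) • fun J => MvPolynomial.C ((v J).coeff d) := by
      funext J
      rw [Finset.sum_apply]
      conv_lhs => rw [← MvPolynomial.support_sum_monomial_coeff (v J)]
      refine Finset.sum_subset_zero_on_sdiff ?_ ?_ ?_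
      · exact fun d hd => Finset.mem_biUnion.2 ⟨J, Finset.mem_univ _, hd⟩
      · intro d hd
        rw [Pi.smul_apply, MvPolynomial.notMem_support_iff.1 (Finset.mem_sdiff.1 hd).2, map_zero,
          smul_zero]
      · intro d _
        rw [Pi.smul_apply, smul_eq_mul, mul_comm, MvPolynomial.C_mul_monomial, mul_one]
    rw [this]
    exact Submodule.sum_mem _ fun d _ => Submodule.smul_mem _ _
      (Submodule.subset_span ⟨_, hv d, rfl⟩)

theorem mem_extendTheta_iff {v : ThetaChain m n L} :
    v ∈ extendTheta U ↔ ∀ s : PolyTheta L →ₗ[ℂ] ℂ, (fun J => s (v J)) ∈ U := by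
  constructor
  · intro hv s
    rw [mem_extendTheta_iff_coeff] at hv
    classical
    have : (fun J => s (v J)) = ∑ d ∈ Finset.univ.biUnion fun J => (v J).support,
        s (MvPolynomial.monomial d 1) • fun J => (v J).coeff d := by
      funext J
      rw [Finset.sum_apply]
      conv_lhs => rw [← MvPolynomial.support_sum_monomial_coeff (v J)]
      rw [map_sum]
      refine Finset.sum_subset_zero_on_sdiff ?_ ?_ ?_
      · exact fun d hd => Finset.mem_biUnion.2 ⟨J, Finset.mem_univ _, hd⟩
      · intro d hd
        rw [Pi.smul_apply, MvPolynomial.notMem_support_iff.1 (Finset.mem_sdiff.1 hd).2, smul_zero]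
      · intro d _
        rw [Pi.smul_apply, smul_eq_mul, mul_comm, ← smul_eq_mul, ← map_smul,
          MvPolynomial.smul_monomial, smul_eq_mul, mul_one]
    rw [this]
    exact U.sum_mem fun d _ => U.smul_mem _ (hv d)
  · intro h
    rw [mem_extendTheta_iff_coeff]
    exact fun d => h (MvPolynomial.lcoeff ℂ d)

theorem comp_mem_extendTheta {v : ThetaChain m n L} (hv : v ∈ extendTheta U)
    (F : PolyTheta L →ₗ[ℂ] PolyTheta L) : (fun J => F (v J)) ∈ extendTheta U := by
  rw [mem_extendTheta_iff] at hv ⊢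
  exact fun s => hv (s ∘ₗ F)

theorem mem_symSubmodule {hbar : ℂ} {v : ThetaChain m n L} : v ∈ symSubmodule hbar U ↔
    (∀ l h J, swapSign parity l h J • v (J ∘ siteSwap l h) = heckeOp hbar l h (v J)) ∧
      v ∈ extendTheta U := by
  refine and_congr ?_ Iff.rfl
  exact forall_congr' fun l => forall_congr' fun h => symOp_eq_self_iff hbar

theorem mem_symSubmodule_zero {v : ThetaChain m n L} : v ∈ symSubmodule 0 U ↔
    (∀ l h J, swapSign parity l h J • v (J ∘ siteSwap l h) = varSwap l h (v J)) ∧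
      v ∈ extendTheta U := by
  simp only [mem_symSubmodule, heckeOp_zero_apply]

end ExtendTheta

section StableSpan

variable {L : ℕ}

/-- The complex span of the stable basis. -/
noncomputable def stableSpan (L : ℕ) : Submodule ℂ (PolyTheta L) :=
  Submodule.span ℂ (Set.range (stableBasis L))

theorem rename_mem_stableSpan (σ : Equiv.Perm (Fin L)) {f : PolyTheta L}
    (hf : f ∈ stableSpan L) : MvPolynomial.rename σ f ∈ stableSpan L := by
  refine (Submodule.span_le (p := (stableSpan L).comap
    (MvPolynomial.rename σ : PolyTheta L →ₐ[ℂ] PolyTheta L).toLinearMap)).2 ?_ hf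
  rintro _ ⟨a, rfl⟩
  exact rename_stableBasis_mem σ a

theorem eq_zero_of_mem_stableSpan {x : Fin L → ℂ} (hx : Function.Injective x) {f : PolyTheta L}
    (hf : f ∈ stableSpan L)
    (h : ∀ σ : Equiv.Perm (Fin L), MvPolynomial.eval (x ∘ σ) f = 0) : f = 0 := by
  obtain ⟨z, rfl⟩ := (Submodule.mem_span_range_iff_exists_fun _).1 hf
  have h1 : orbitEval (stableBasis L) x z = 0 := funext h
  have h2 := (orbitEval_bijective (card_artinIdx L) (stableBasis L).span_eq hx).1
    (h1.trans (map_zero _).symm)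
  rw [h2]
  simp

theorem exists_interpolation {x : Fin L → ℂ} (hx : Function.Injective x) :
    ∃ F : (Equiv.Perm (Fin L) → ℂ) →ₗ[ℂ] PolyTheta L, (∀ c, F c ∈ stableSpan L) ∧
      ∀ c (σ : Equiv.Perm (Fin L)), MvPolynomial.eval (x ∘ σ) (F c) = c σ := by
  let e := LinearEquiv.ofBijective (orbitEval (stableBasis L) x)
    (orbitEval_bijective (card_artinIdx L) (stableBasis L).span_eq hx)
  refine ⟨Fintype.linearCombination ℂ (stableBasis L) ∘ₗ e.symm.toLinearMap, fun c => ?_,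
    fun c σ => ?_⟩
  · exact Submodule.sum_mem _ fun a _ => Submodule.smul_mem _ _ (Submodule.subset_span ⟨a, rfl⟩)
  · exact congrFun (e.apply_symm_apply c) σ

end StableSpan

section Harmonic

variable {m n L : ℕ}

/-- Subspaces stable under the graded exchange of neighbouring sites. -/
def SwapStable (U : Submodule ℂ (Chain m n L)) : Prop :=
  ∀ u ∈ U, ∀ l h, (fun J => swapSign parity l h J * u (J ∘ siteSwap l h)) ∈ U

/-- The sign of the graded action of a permutation of the sites on a word. -/
noncomputable def permSign (σ : Equiv.Perm (Fin L)) (J : Word m n L) : ℂ :=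
  sortSign (fun z : Idx m n × Fin L => parity z.1) (fun z => (z.2 : ℕ)) fun i => (J i, σ i)

theorem permSign_one (J : Word m n L) : permSign 1 J = 1 := by
  refine Finset.prod_eq_one fun q hq => ?_
  have : q.1 < q.2 := by simpa [ltPairs] using hq
  exact if_neg (not_lt.2 (Fin.le_def.1 this.le))

theorem permSign_mul_siteSwap (σ : Equiv.Perm (Fin L)) (l : ℕ) (h : l + 1 < L) (J : Word m n L) :
    permSign (σ * siteSwap l h) J = swapSign parity l h J * permSign σ (J ∘ siteSwap l h) := by
  have h1 := sortSign_comp_siteSwap (fun z : Idx m n × Fin L => parity z.1) (fun z => (z.2 : ℕ))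
    (fun i => (J i, (σ * siteSwap l h) i)) l h (fun _ he => by
      have := (σ * siteSwap l h).injective (Fin.ext he)
      exact siteL_ne_siteR l h this)
  have h2 : (fun i => (J i, (σ * siteSwap l h) i)) ∘ siteSwap l h =
      fun i => ((J ∘ siteSwap l h) i, σ i) := by
    funext i; simp
  rw [h2] at h1
  have h3 := swapSign_mul_self parity l h J
  rw [permSign, permSign, h1]
  change _ = swapSign parity l h J * (swapSign parity l h J * _)
  rw [← mul_assoc, h3, one_mul]

theorem perm_mem_of_swapStable {U : Submodule ℂ (Chain m n L)} (hU : SwapStable U)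
    {u : Chain m n L} (hu : u ∈ U) (σ : Equiv.Perm (Fin L)) :
    (fun J => permSign σ J * u (J ∘ ⇑σ⁻¹)) ∈ U := by
  refine perm_induction_siteSwap (P := fun σ => (fun J => permSign σ J * u (J ∘ ⇑σ⁻¹)) ∈ U) ?_ ?_ σ
  · convert hu using 1
    funext J
    rw [permSign_one, one_mul]
    rfl
  · intro σ l h ih
    convert hU _ ih l h using 1
    funext J
    rw [permSign_mul_siteSwap, mul_assoc, mul_inv_rev]
    have : (siteSwap l h)⁻¹ = siteSwap l h := Equiv.swap_inv _ _
    rw [this]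
    rfl

/-- The vectors of the undeformed symmetric module whose components lie in `stableSpan`. -/
noncomputable def harmonic (U : Submodule ℂ (Chain m n L)) : Submodule ℂ (ThetaChain m n L) :=
  (symSubmodule 0 U).restrictScalars ℂ ⊓ Submodule.pi Set.univ fun _ => stableSpan L

theorem mem_harmonic {U : Submodule ℂ (Chain m n L)} {v : ThetaChain m n L} :
    v ∈ harmonic U ↔ v ∈ symSubmodule 0 U ∧ ∀ J, v J ∈ stableSpan L := by
  refine and_congr Iff.rfl ?_
  simp

theorem harmonic_eq_zero {U : Submodule ℂ (Chain m n L)} {v : ThetaChain m n L}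
    (hv : v ∈ harmonic U) {x : Fin L → ℂ} (hx : Function.Injective x)
    (h0 : ∀ J, MvPolynomial.eval x (v J) = 0) : v = 0 := by
  obtain ⟨h1, h2⟩ := mem_harmonic.1 hv
  obtain ⟨h1, -⟩ := mem_symSubmodule_zero.1 h1
  have key : ∀ σ : Equiv.Perm (Fin L), ∀ J, MvPolynomial.eval (x ∘ σ) (v J) = 0 := by
    refine perm_induction_siteSwap h0 fun σ l h ih J => ?_
    have : x ∘ ⇑(σ * siteSwap l h) = (x ∘ σ) ∘ siteSwap l h := rfl
    rw [this, eval_comp_perm]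
    change MvPolynomial.eval (x ∘ σ) (varSwap l h (v J)) = 0
    rw [← h1, MvPolynomial.smul_eval, ih, mul_zero]
  exact funext fun J => eq_zero_of_mem_stableSpan hx (h2 J) fun σ => key σ J

theorem exists_harmonic {U : Submodule ℂ (Chain m n L)} (hU : SwapStable U) {u : Chain m n L}
    (hu : u ∈ U) {x : Fin L → ℂ} (hx : Function.Injective x) :
    ∃ v ∈ harmonic U, ∀ J, MvPolynomial.eval x (v J) = u J := by
  obtain ⟨F, hF1, hF2⟩ := exists_interpolation hx
  refine ⟨fun J => F fun σ => permSign σ J * u (J ∘ ⇑σ⁻¹), mem_harmonic.2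
    ⟨mem_symSubmodule_zero.2 ⟨fun l h J => ?_, ?_⟩, fun J => hF1 _⟩, fun J => ?_⟩
  · rw [← sub_eq_zero]
    refine eq_zero_of_mem_stableSpan hx (Submodule.sub_mem _ (Submodule.smul_mem _ _ (hF1 _))
      (rename_mem_stableSpan (siteSwap l h) (hF1 _))) fun σ => ?_
    have hc : (x ∘ σ) ∘ siteSwap l h = x ∘ ⇑(σ * siteSwap l h) := rfl
    have : (siteSwap l h)⁻¹ = siteSwap l h := Equiv.swap_inv _ _
    rw [map_sub, MvPolynomial.smul_eval, hF2, varSwap, ← eval_comp_perm, hc, hF2,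
      permSign_mul_siteSwap, mul_inv_rev, this, mul_assoc]
    exact sub_self _
  · rw [mem_extendTheta_iff]
    intro s
    have : (fun J => s (F fun σ => permSign σ J * u (J ∘ ⇑σ⁻¹))) =
        ∑ σ : Equiv.Perm (Fin L), s (F fun τ => if σ = τ then 1 else 0) •
          fun J => permSign σ J * u (J ∘ ⇑σ⁻¹) := by
      funext J
      have h1 := LinearMap.pi_apply_eq_sum_univ (s ∘ₗ F) fun σ => permSign σ J * u (J ∘ ⇑σ⁻¹)
      rw [LinearMap.comp_apply] at h1
      rw [h1, Finset.sum_apply]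
      refine Finset.sum_congr rfl fun σ _ => ?_
      rw [Pi.smul_apply, smul_eq_mul, smul_eq_mul, mul_comm]
      rfl
    rw [this]
    exact U.sum_mem fun σ _ => U.smul_mem _ (perm_mem_of_swapStable hU hu σ)
  · have := hF2 (fun σ => permSign σ J * u (J ∘ ⇑σ⁻¹)) 1
    rw [permSign_one, one_mul] at this
    exact this

/-- Evaluation at a point with distinct coordinates identifies `harmonic U` with `U`. -/
theorem exists_harmonic_equiv {U : Submodule ℂ (Chain m n L)} (hU : SwapStable U) :
    Nonempty (harmonic U ≃ₗ[ℂ] U) := by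
  let x : Fin L → ℂ := fun i => ((i : ℕ) : ℂ)
  have hx : Function.Injective x := fun i j h => Fin.ext (Nat.cast_injective (R := ℂ) h)
  let ev : ThetaChain m n L →ₗ[ℂ] Chain m n L :=
    (MvPolynomial.aeval x : PolyTheta L →ₐ[ℂ] ℂ).toLinearMap.compLeft (Word m n L)
  have hev : ∀ v J, ev v J = MvPolynomial.eval x (v J) := fun v J => by
    change MvPolynomial.aeval x (v J) = _
    rw [MvPolynomial.aeval_eq_eval]
  have hmem : ∀ v ∈ harmonic U, ev v ∈ U := fun v hv =>
    mem_extendTheta_iff.1 (mem_symSubmodule_zero.1 (mem_harmonic.1 hv).1).2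
      (MvPolynomial.aeval x : PolyTheta L →ₐ[ℂ] ℂ).toLinearMap
  refine ⟨LinearEquiv.ofBijective (ev.restrict hmem) ⟨?_, ?_⟩⟩
  · rw [← LinearMap.ker_eq_bot, LinearMap.ker_eq_bot']
    rintro ⟨v, hv⟩ h0
    refine Subtype.ext (harmonic_eq_zero hv hx fun J => ?_)
    rw [← hev]
    exact congrFun (congrArg Subtype.val h0) J
  · rintro ⟨u, hu⟩
    obtain ⟨v, hv, h⟩ := exists_harmonic hU hu hx
    exact ⟨⟨v, hv⟩, Subtype.ext (funext fun J => (hev v J).trans (h J))⟩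

end Harmonic

section Freeness

variable {m n L : ℕ} {U : Submodule ℂ (Chain m n L)}

theorem harmonic_le {v : ThetaChain m n L} (hv : v ∈ harmonic U) : v ∈ symSubmodule 0 U :=
  (mem_harmonic.1 hv).1

theorem specialize_mem_harmonic {v : ThetaChain m n L} (hv : v ∈ symSubmodule 0 U)
    (s : PolyChi L →ₗ[ℂ] ℂ) : (fun J => specialize (stableBasis L) s (v J)) ∈ harmonic U := by
  obtain ⟨h1, h2⟩ := mem_symSubmodule_zero.1 hv
  refine mem_harmonic.2 ⟨mem_symSubmodule_zero.2 ⟨fun l h J => ?_, comp_mem_extendTheta h2 _⟩,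
    fun J => specialize_mem _ _ _⟩
  rw [varSwap, ← specialize_rename s (rename_stableBasis_mem (siteSwap l h)), ← map_smul, h1,
    varSwap]

/-- Every invariant vector is a combination of harmonic ones with symmetric coefficients. -/
theorem mem_span_harmonic {v : ThetaChain m n L} (hv : v ∈ symSubmodule 0 U) :
    v ∈ Submodule.span (PolyChi L) (harmonic U : Set (ThetaChain m n L)) := by
  classical
  let B := Module.Basis.ofVectorSpace ℂ (PolyChi L)
  let S := Finset.univ.biUnion fun J => Finset.univ.biUnion fun a =>
    (B.repr ((stableBasis L).repr (v J) a)).support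
  have hr : ∀ J a, ∑ i ∈ S, B.repr ((stableBasis L).repr (v J) a) i • B i =
      (stableBasis L).repr (v J) a := by
    intro J a
    conv_rhs => rw [← B.linearCombination_repr ((stableBasis L).repr (v J) a)]
    rw [Finsupp.linearCombination_apply, Finsupp.sum]
    refine (Finset.sum_subset ?_ ?_).symm
    · exact fun i hi => Finset.mem_biUnion.2 ⟨J, Finset.mem_univ _,
        Finset.mem_biUnion.2 ⟨a, Finset.mem_univ _, hi⟩⟩
    · intro i _ hi
      rw [Finsupp.notMem_support_iff.1 hi, zero_smul]
  have hv' : v = ∑ i ∈ S, B i • fun J => specialize (stableBasis L) (B.coord i) (v J) := by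
    funext J
    rw [Finset.sum_apply]
    conv_lhs => rw [← (stableBasis L).sum_repr (v J)]
    simp only [Pi.smul_apply, specialize_apply, Finset.smul_sum]
    rw [Finset.sum_comm]
    refine Finset.sum_congr rfl fun a _ => ?_
    conv_lhs => rw [← hr J a]
    rw [Finset.sum_smul]
    refine Finset.sum_congr rfl fun i _ => ?_
    rw [smul_assoc, smul_comm]
    rfl
  rw [hv']
  exact Submodule.sum_mem _ fun i _ => Submodule.smul_mem _ _
    (Submodule.subset_span (specialize_mem_harmonic hv _))

theorem linearIndependent_harmonic {κ : Type*} [Fintype κ] {g : κ → ThetaChain m n L}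
    (hg : ∀ k, g k ∈ harmonic U) (hli : LinearIndependent ℂ g) :
    LinearIndependent (PolyChi L) g := by
  rw [Fintype.linearIndependent_iff] at hli ⊢
  intro r hr k
  refine Subtype.ext (eq_zero_of_eval_injective fun x hx => ?_)
  refine hli (fun k => MvPolynomial.eval x (r k : PolyTheta L)) ?_ k
  refine harmonic_eq_zero (U := U) (Submodule.sum_mem _ fun k _ => Submodule.smul_mem _ _ (hg k)) hx
    fun J => ?_
  have := congrArg (MvPolynomial.eval x) (congrFun hr J)
  rw [Finset.sum_apply, map_sum, Pi.zero_apply, map_zero] at this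
  rw [Finset.sum_apply, map_sum, ← this]
  refine Finset.sum_congr rfl fun k _ => ?_
  rw [Pi.smul_apply, Pi.smul_apply, MvPolynomial.smul_eval, eval_chi_smul]

theorem exists_basis_symSubmodule_zero (hU : SwapStable U) :
    Nonempty (Module.Basis (Fin (Module.finrank ℂ U)) (PolyChi L)
      (symSubmodule (m := m) (n := n) (L := L) 0 U)) := by
  obtain ⟨e⟩ := exists_harmonic_equiv hU
  let g := (Module.finBasis ℂ U).map e.symm
  have hli : LinearIndependent ℂ fun k => (g k : ThetaChain m n L) :=
    g.linearIndependent.map' (harmonic U).subtype (Submodule.ker_subtype _)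
  have hli' := linearIndependent_harmonic (fun k => (g k).2) hli
  have hspan : Submodule.span (PolyChi L) (Set.range fun k => (g k : ThetaChain m n L)) =
      symSubmodule 0 U := by
    refine le_antisymm (Submodule.span_le.2 ?_) fun v hv => ?_
    · rintro _ ⟨k, rfl⟩
      exact harmonic_le (g k).2
    · refine (Submodule.span_le.2 ?_) (mem_span_harmonic hv)
      intro w hw
      have h1 : (⟨w, hw⟩ : harmonic U) ∈ Submodule.span ℂ (Set.range g) :=
        g.span_eq ▸ Submodule.mem_top
      obtain ⟨c, hc⟩ := (Submodule.mem_span_range_iff_exists_fun _).1 h1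
      have h2 := congrArg Subtype.val hc
      rw [AddSubmonoidClass.coe_finsetSum] at h2
      change _ = w at h2
      rw [← h2]
      refine Submodule.sum_mem _ fun k _ => ?_
      have h3 : (g k : ThetaChain m n L) ∈
          Submodule.span (PolyChi L) (Set.range fun k => (g k : ThetaChain m n L)) :=
        Submodule.subset_span ⟨k, rfl⟩
      have h4 := Submodule.smul_mem _ (algebraMap ℂ (PolyChi L) (c k)) h3
      rwa [algebraMap_smul] at h4
  exact ⟨(Module.Basis.span hli').map (LinearEquiv.ofEq _ _ hspan)⟩

/-- The deformed and the undeformed symmetric modules are isomorphic. -/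
theorem exists_symSubmodule_equiv (U : Submodule ℂ (Chain m n L)) (hbar : ℂ) :
    Nonempty ((symSubmodule (m := m) (n := n) (L := L) 0 U) ≃ₗ[PolyChi L]
      (symSubmodule (m := m) (n := n) (L := L) hbar U)) := by
  obtain ⟨a, ha, φ, hφ, hint⟩ := exists_intertwiner L hbar
  have hbij := hφ.bijective ha
  let e := LinearEquiv.ofBijective φ hbij
  let F : ThetaChain m n L →ₗ[PolyChi L] ThetaChain m n L := φ.compLeft (Word m n L)
  have hF : ∀ v ∈ symSubmodule 0 U, F v ∈ symSubmodule hbar U := by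
    intro v hv
    obtain ⟨h1, h2⟩ := mem_symSubmodule_zero.1 hv
    refine mem_symSubmodule.2 ⟨fun l h J => ?_, comp_mem_extendTheta h2 (φ.restrictScalars ℂ)⟩
    change swapSign parity l h J • φ (v _) = heckeOp hbar l h (φ (v J))
    rw [← hint, ← h1]
    exact ((φ.restrictScalars ℂ).map_smul _ _).symm
  refine ⟨LinearEquiv.ofBijective (F.restrict hF) ⟨?_, ?_⟩⟩
  · intro v w h
    refine Subtype.ext (funext fun J => hbij.1 ?_)
    exact congrFun (congrArg Subtype.val h) J
  · rintro ⟨w, hw⟩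
    obtain ⟨h1, h2⟩ := mem_symSubmodule.1 hw
    have he : ∀ f, φ (e.symm f) = f := e.apply_symm_apply
    have hv : (fun J => e.symm (w J)) ∈ symSubmodule 0 U := by
      refine mem_symSubmodule_zero.2 ⟨fun l h J => hbij.1 ?_,
        comp_mem_extendTheta h2 (e.symm.toLinearMap.restrictScalars ℂ)⟩
      rw [hint, he, ← h1]
      refine ((φ.restrictScalars ℂ).map_smul _ _).trans ?_
      exact congrArg _ (he _)
    exact ⟨⟨_, hv⟩, Subtype.ext (funext fun J => he (w J))⟩

theorem exists_basis_symSubmodule (hU : SwapStable U) (hbar : ℂ) :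
    Nonempty (Module.Basis (Fin (Module.finrank ℂ U)) (PolyChi L)
      (symSubmodule (m := m) (n := n) (L := L) hbar U)) := by
  obtain ⟨b⟩ := exists_basis_symSubmodule_zero hU
  obtain ⟨e⟩ := exists_symSubmodule_equiv U hbar
  exact ⟨b.map e⟩

theorem free_symSubmodule (hU : SwapStable U) (hbar : ℂ) :
    Module.Free (PolyChi L) (symSubmodule hbar U) ∧
      Module.Finite (PolyChi L) (symSubmodule hbar U) ∧
      Module.finrank (PolyChi L) (symSubmodule hbar U) = Module.finrank ℂ U := by
  obtain ⟨b⟩ := exists_basis_symSubmodule hU hbar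
  refine ⟨Module.Free.of_basis b, Module.Finite.of_basis b, ?_⟩
  rw [Module.finrank_eq_card_basis b, Fintype.card_fin]

end Freeness

section Character

variable {m n L : ℕ}

/-- Graded symmetric vectors, homogeneous of degree `k` in `θ`, with coefficients in `U`. -/
noncomputable def levelSpace (U : Submodule ℂ (Chain m n L)) (k : ℕ) :
    Submodule ℂ (Word m n L → Homog L k) where
  carrier := {t | t ∈ superInv parity (homogOps L k) ∧ ∀ d, (fun J => (t J).1.coeff d) ∈ U}
  zero_mem' := ⟨Submodule.zero_mem _, fun d => by
    convert U.zero_mem using 1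
    funext J
    simp⟩
  add_mem' := fun {v w} hv hw => ⟨Submodule.add_mem _ hv.1 hw.1, fun d => by
    convert U.add_mem (hv.2 d) (hw.2 d) using 1
    funext J
    simp⟩
  smul_mem' := fun c v hv => ⟨Submodule.smul_mem _ c hv.1, fun d => by
    convert U.smul_mem c (hv.2 d) using 1
    funext J
    simp⟩

theorem mem_degreeLE {v : ThetaChain m n L} {k : ℕ} :
    v ∈ degreeLE m n L k ↔ ∀ J, v J ∈ polyLT L (k + 1) := by
  have : {d : Fin L →₀ ℕ | (d.degree : ℤ) ≤ k} = {d | d.degree < k + 1} := by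
    ext d
    rw [Set.mem_ofPred_eq, Set.mem_ofPred_eq]
    omega
  rw [degreeLE, this]
  simp [polyLT]

theorem mem_degreeLE_sub_one {v : ThetaChain m n L} {k : ℕ} :
    v ∈ degreeLE m n L ((k : ℤ) - 1) ↔ ∀ J, v J ∈ polyLT L k := by
  have : {d : Fin L →₀ ℕ | (d.degree : ℤ) ≤ (k : ℤ) - 1} = {d | d.degree < k} := by
    ext d
    rw [Set.mem_ofPred_eq, Set.mem_ofPred_eq]
    omega
  rw [degreeLE, this]
  simp [polyLT]

theorem homogeneousComponent_eq_zero_iff {k : ℕ} {f : PolyTheta L} (hf : f ∈ polyLT L (k + 1)) :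
    MvPolynomial.homogeneousComponent k f = 0 ↔ f ∈ polyLT L k := by
  rw [mem_polyLT] at hf ⊢
  constructor
  · intro h d hd
    refine lt_of_le_of_ne (Nat.lt_succ_iff.1 (hf d hd)) fun he => hd ?_
    have := congrArg (fun g : PolyTheta L => g.coeff d) h
    simpa [MvPolynomial.coeff_homogeneousComponent, he] using this
  · intro h
    refine MvPolynomial.ext _ _ fun d => ?_
    rw [MvPolynomial.coeff_homogeneousComponent]
    split_ifs with he
    · by_contra hc
      have := h d hc
      omega
    · simp

theorem homogeneousComponent_varSwap (l : ℕ) (h : l + 1 < L) (k : ℕ) (f : PolyTheta L) :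
    MvPolynomial.homogeneousComponent k (varSwap l h f) =
      varSwap l h (MvPolynomial.homogeneousComponent k f) := by
  refine MvPolynomial.ext _ _ fun d => ?_
  rw [coeff_varSwap, MvPolynomial.coeff_homogeneousComponent,
    MvPolynomial.coeff_homogeneousComponent, coeff_varSwap, Finsupp.equivMapDomain_eq_mapDomain,
    Finsupp.degree_mapDomain]

/-- The leading homogeneous part of a vector. -/
noncomputable def leadingPart (m n L k : ℕ) : ThetaChain m n L →ₗ[ℂ] (Word m n L → Homog L k) :=
  ((MvPolynomial.homogeneousComponent k : PolyTheta L →ₗ[ℂ] PolyTheta L).codRestrict (Homog L k)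
    fun f => MvPolynomial.homogeneousComponent_isHomogeneous k f).compLeft (Word m n L)

theorem leadingPart_apply (k : ℕ) (v : ThetaChain m n L) (J : Word m n L) :
    (leadingPart m n L k v J : PolyTheta L) = MvPolynomial.homogeneousComponent k (v J) := rfl

variable {U : Submodule ℂ (Chain m n L)} {hbar : ℂ} {k : ℕ}

theorem leadingPart_mem {v : ThetaChain m n L} (hv : v ∈ filtration (symSubmodule hbar U) k) :
    leadingPart m n L k v ∈ levelSpace U k := by
  obtain ⟨hv1, hv2⟩ := hv
  obtain ⟨h1, h2⟩ := mem_symSubmodule.1 hv1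
  have h3 := mem_degreeLE.1 hv2
  refine ⟨?_, fun d => mem_extendTheta_iff.1 h2
    (MvPolynomial.lcoeff ℂ d ∘ₗ MvPolynomial.homogeneousComponent k)⟩
  rintro l h t rfl J
  refine Subtype.ext ?_
  rw [Submodule.coe_smul, leadingPart_apply, ← map_smul, h1, heckeOp_apply, map_add, map_smul,
    (homogeneousComponent_eq_zero_iff (polyLT_mono (Nat.le_succ k) (divDiff_mem_polyLT (h3 J)))).2
      (divDiff_mem_polyLT (h3 J)), smul_zero, add_zero, homogeneousComponent_varSwap]
  rfl

theorem leadingPart_eq_zero_iff {v : ThetaChain m n L}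
    (hv : v ∈ filtration (symSubmodule hbar U) k) :
    leadingPart m n L k v = 0 ↔ v ∈ filtration (symSubmodule hbar U) ((k : ℤ) - 1) := by
  have h3 := mem_degreeLE.1 hv.2
  constructor
  · intro h
    refine ⟨hv.1, mem_degreeLE_sub_one.2 fun J => (homogeneousComponent_eq_zero_iff (h3 J)).1 ?_⟩
    exact congrArg Subtype.val (congrFun h J)
  · intro h
    exact funext fun J => Subtype.ext
      ((homogeneousComponent_eq_zero_iff (h3 J)).2 (mem_degreeLE_sub_one.1 h.2 J))

theorem exists_leadingPart_eq {t : Word m n L → Homog L k} (ht : t ∈ levelSpace U k) :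
    ∃ v ∈ filtration (symSubmodule hbar U) k, leadingPart m n L k v = t := by
  obtain ⟨a, ha, φ, hφ, hint⟩ := exists_intertwiner L hbar
  have ha' : (a : ℂ) ≠ 0 := Nat.cast_ne_zero.2 ha.ne'
  let F : PolyTheta L →ₗ[ℂ] PolyTheta L := (a : ℂ)⁻¹ • φ.restrictScalars ℂ
  have hFapp : ∀ f, F f = (a : ℂ)⁻¹ • φ f := fun f => rfl
  have hF : ∀ l h f, F (varSwap l h f) = heckeOp hbar l h (F f) := by
    intro l h f
    rw [hFapp, hFapp, hint]
    exact (((heckeOp hbar l h).restrictScalars ℂ).map_smul _ _).symm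
  have hdeg : ∀ J, (t J).1 ∈ polyLT L (k + 1) := fun J =>
    mem_polyLT_succ.2 (MvPolynomial.IsHomogeneous.totalDegree_le (t J).2)
  refine ⟨fun J => F (t J).1, ⟨mem_symSubmodule.2 ⟨fun l h J => ?_, ?_⟩,
    mem_degreeLE.2 fun J => ?_⟩, funext fun J => Subtype.ext ?_⟩
  · have h1 := congrArg Subtype.val (ht.1 l h _ rfl J)
    rw [Submodule.coe_smul] at h1
    rw [← map_smul, h1, ← hF]
    rfl
  · exact comp_mem_extendTheta (v := fun J => (t J).1) (mem_extendTheta_iff_coeff.2 ht.2) F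
  · exact Submodule.smul_mem _ _ (hφ.mem (hdeg J))
  · have h1 := hφ k _ (hdeg J)
    have h2 := (homogeneousComponent_eq_zero_iff (polyLT_mono (Nat.le_succ k) h1)).2 h1
    rw [map_sub, map_nsmul, sub_eq_zero, ← Nat.cast_smul_eq_nsmul ℂ] at h2
    rw [leadingPart_apply, hFapp, map_smul, h2, smul_smul, inv_mul_cancel₀ ha', one_smul]
    exact MvPolynomial.homogeneousComponent_eq_self (t J).2

theorem finrank_quotient_submoduleOf {K E E' : Type*} [Field K] [AddCommGroup E] [Module K E]
    [AddCommGroup E'] [Module K E'] (f : E →ₗ[K] E') (F F' : Submodule K E) (T : Submodule K E')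
    (hmem : ∀ v ∈ F, f v ∈ T) (hker : ∀ v ∈ F, f v = 0 ↔ v ∈ F')
    (hsurj : ∀ t ∈ T, ∃ v ∈ F, f v = t) :
    Module.finrank K (F ⧸ F'.submoduleOf F) = Module.finrank K T := by
  let g : F →ₗ[K] T := f.restrict hmem
  have hg : F'.submoduleOf F = LinearMap.ker g := by
    ext ⟨v, hv⟩
    rw [LinearMap.mem_ker]
    change v ∈ F' ↔ _
    rw [← hker v hv]
    exact ⟨fun h => Subtype.ext h, fun h => congrArg Subtype.val h⟩
  rw [hg]
  refine (g.quotKerEquivOfSurjective ?_).finrank_eq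
  rintro ⟨t, ht⟩
  obtain ⟨v, hv, h⟩ := hsurj t ht
  exact ⟨⟨v, hv⟩, Subtype.ext h⟩

/-- The coefficients of the character count homogeneous vectors. -/
theorem character_symSubmodule (U : Submodule ℂ (Chain m n L)) (hbar : ℂ) :
    character (symSubmodule hbar U) =
      PowerSeries.mk fun k => (Module.finrank ℂ (levelSpace U k) : ℚ) := by
  refine congrArg PowerSeries.mk (funext fun k => congrArg Nat.cast ?_)
  exact finrank_quotient_submoduleOf (leadingPart m n L k) _ _ _ (fun v hv => leadingPart_mem hv)
    (fun v hv => leadingPart_eq_zero_iff hv) fun t ht => exists_leadingPart_eq ht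

end Character

section Link

variable {m n L : ℕ}

theorem glAction_eq_rootOp (A B : Idx m n) :
    glAction (L := L) A B = rootOp (M := ℂ) parity A B := by
  refine (spinBasis m n L).ext fun I => ?_
  rw [glAction, Module.Basis.constr_basis]
  funext J
  rw [rootOp_apply, Finset.sum_apply]
  refine Finset.sum_congr rfl fun l _ => ?_
  have hs : ∀ c : ℂ, (c • spinBasis m n L (Function.update I l A)) J =
      c * if J = Function.update I l A then 1 else 0 := fun c => by
    simp [Pi.single_apply]
  have hs' : spinBasis m n L I (Function.update J l B) =
      if Function.update J l B = I then 1 else 0 := by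
    simp [Pi.single_apply]
  have hiff : (I l = B ∧ J = Function.update I l A) ↔ (J l = A ∧ Function.update J l B = I) := by
    constructor
    · rintro ⟨rfl, rfl⟩; simp
    · rintro ⟨rfl, rfl⟩; simp
  rw [hs', smul_eq_mul]
  by_cases hc : I l = B ∧ J = Function.update I l A
  · obtain ⟨h1, h2⟩ := hiff.1 hc
    rw [if_pos hc.1, hs, if_pos hc.2, if_pos h1, if_pos h2, mul_one, mul_one, stringSign,
      Finset.mul_sum, ← Finset.prod_pow_eq_pow_sum]
    refine Finset.prod_congr rfl fun k hk => ?_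
    have : k ≠ l := ne_of_lt (Finset.mem_filter.1 hk).2
    rw [crossSign, hc.2, Function.update_of_ne this]
  · have h1 : (if I l = B then ((-1 : ℂ) ^ ((parity A + parity B) *
        ∑ k ∈ Finset.univ.filter (· < l), parity (I k))) •
          spinBasis m n L (Function.update I l A) else 0) J = 0 := by
      split_ifs with h
      · rw [hs, if_neg fun h' => hc ⟨h, h'⟩, mul_zero]
      · rfl
    rw [h1]
    split_ifs with h h'
    · exact absurd (hiff.2 ⟨h, h'⟩) hc
    · rw [mul_zero]
    · rfl

theorem weightSpace_eq (lam : Fin m → ℕ) (nu : Fin n → ℕ) :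
    weightSpace L lam nu = wtSpace ℂ L (Sum.elim lam nu) := by
  ext v
  rw [mem_wtSpace_iff_rootOp parity, weightSpace, Submodule.mem_iInf]
  refine forall_congr' fun A => ?_
  rw [LinearMap.mem_ker, glAction_eq_rootOp, LinearMap.sub_apply, sub_eq_zero]
  rfl

theorem singularSpace_eq : singularSpace m n L =
    singSpace parity ℂ L fun A B : Idx m n => toLex A < toLex B := by
  ext v
  simp only [singularSpace, Submodule.mem_iInf, LinearMap.mem_ker, glAction_eq_rootOp]
  rfl

theorem content_comp_siteSwap {ι : Type*} [DecidableEq ι] (J : Fin L → ι) (l : ℕ) (h : l + 1 < L) :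
    content (J ∘ siteSwap l h) = content J := by
  funext A
  rw [content, content]
  refine Finset.card_bij' (fun k _ => siteSwap l h k) (fun k _ => siteSwap l h k) ?_ ?_ ?_ ?_
  · intro k hk; simpa using hk
  · intro k hk; simpa using hk
  · intro k _; simp
  · intro k _; simp

theorem swapStable_weightSpace (lam : Fin m → ℕ) (nu : Fin n → ℕ) :
    SwapStable (weightSpace L lam nu) := by
  intro u hu l h
  rw [weightSpace_eq] at hu ⊢
  intro J hJ
  rw [← content_comp_siteSwap J l h]
  exact hu _ (right_ne_zero_of_mul hJ)

theorem swapStable_highestWeightSpace (μ : YoungDiagram) :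
    SwapStable (highestWeightSpace m n L μ) := by
  intro u hu l h
  refine ⟨swapStable_weightSpace _ _ u hu.1 l h, ?_⟩
  have h1 := hu.2
  rw [SetLike.mem_coe, singularSpace_eq] at h1 ⊢
  intro A B hAB
  funext J
  have h2 := rootOp_swap parity A B l h u J
  rw [h1 A B hAB] at h2
  simpa using h2.symm

theorem levelSpace_weightSpace (lam : Fin m → ℕ) (nu : Fin n → ℕ) (k : ℕ) :
    levelSpace (weightSpace L lam nu) k =
      superInv parity (homogOps L k) ⊓ wtSpace (Homog L k) L (Sum.elim lam nu) := by
  ext t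
  refine and_congr Iff.rfl ?_
  rw [weightSpace_eq]
  constructor
  · intro h J hJ
    have : (t J).1 ≠ 0 := fun h0 => hJ (Subtype.ext h0)
    obtain ⟨d, hd⟩ := MvPolynomial.ne_zero_iff.1 this
    exact h d J hd
  · intro h d J hJ
    exact h J fun h0 => hJ (by simp [h0])

theorem levelSpace_highestWeightSpace (μ : YoungDiagram) (k : ℕ) :
    levelSpace (highestWeightSpace m n L μ) k =
      hwSpace parity (homogOps L k) (fun A B => toLex A < toLex B)
        (Sum.elim (weightBos m μ) (weightFer m n μ)) := by
  have h1 : levelSpace (highestWeightSpace m n L μ) k =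
      levelSpace (weightSpace L (weightBos m μ) (weightFer m n μ)) k ⊓
        singSpace parity (Homog L k) L fun A B => toLex A < toLex B := by
    ext t
    have key : (∀ d, (fun J => (t J).1.coeff d) ∈ singularSpace m n L) ↔
        t ∈ singSpace parity (Homog L k) L fun A B => toLex A < toLex B := by
      rw [singularSpace_eq]
      have hc : ∀ d A B J, rootOp parity A B (fun J => (t J).1.coeff d) J =
          (rootOp parity A B t J).1.coeff d := fun d A B J =>
        rootOp_comp_linearMap parity (MvPolynomial.lcoeff ℂ d ∘ₗ (Homog L k).subtype) A B t J
      constructor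
      · intro h A B hAB
        refine funext fun J => Subtype.ext (MvPolynomial.ext _ _ fun d => ?_)
        rw [← hc, h d A B hAB]
        simp
      · intro h d A B hAB
        funext J
        rw [hc, h A B hAB]
        simp
    rw [Submodule.mem_inf, ← key]
    constructor
    · rintro ⟨h2, h3⟩
      exact ⟨⟨h2, fun d => (h3 d).1⟩, fun d => (h3 d).2⟩
    · rintro ⟨⟨h2, h3⟩, h4⟩
      exact ⟨h2, fun d => ⟨h3 d, h4 d⟩⟩
  rw [h1, levelSpace_weightSpace, hwSpace]

theorem highestWeightSpace_eq (μ : YoungDiagram) : highestWeightSpace m n L μ =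
    hwSpace (M := ℂ) parity (fun _ _ => ∅) (fun A B => toLex A < toLex B)
      (Sum.elim (weightBos m μ) (weightFer m n μ)) := by
  rw [highestWeightSpace, weightSpace_eq, singularSpace_eq, hwSpace, superInv_empty, top_inf_eq]

end Link

section Conclusion

variable {m n L : ℕ}

theorem finrank_weightSpace {lam : Fin m → ℕ} {nu : Fin n → ℕ}
    (hw : ∑ a, lam a + ∑ i, nu i = L) :
    (Module.finrank ℂ (weightSpace L lam nu) : ℚ) =
      (L.factorial : ℚ) / ((∏ a, ((lam a).factorial : ℚ)) * ∏ i, ((nu i).factorial : ℚ)) := by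
  have hw' : ∑ A, Sum.elim lam nu A = L := by simpa [Fintype.sum_sum_type] using hw
  rw [weightSpace_eq, finrank_wtSpace_complex_eq_div _ hw', Fintype.prod_sum_type]
  rfl

theorem character_symWeightModule {lam : Fin m → ℕ} {nu : Fin n → ℕ}
    (hw : ∑ a, lam a + ∑ i, nu i = L) (hbar : ℂ) :
    character (symWeightModule L hbar lam nu) =
      PowerSeries.X ^ (∑ i, nu i * (nu i - 1) / 2) *
        (∏ a, ∏ k ∈ Finset.Icc 1 (lam a), (1 - PowerSeries.X ^ k)⁻¹) *
        (∏ i, ∏ k ∈ Finset.Icc 1 (nu i), (1 - PowerSeries.X ^ k)⁻¹) := by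
  have hw' : ∑ A, Sum.elim lam nu A = L := by simpa [Fintype.sum_sum_type] using hw
  have h1 : ∏ A : Idx m n, sumSeries (Odd (parity A)) (Sum.elim lam nu A) =
      PowerSeries.X ^ (∑ i, nu i * (nu i - 1) / 2) *
        (∏ a, ∏ k ∈ Finset.Icc 1 (lam a), (1 - PowerSeries.X ^ k)⁻¹) *
        (∏ i, ∏ k ∈ Finset.Icc 1 (nu i), (1 - PowerSeries.X ^ k)⁻¹) := by
    have hB : ∀ a : Fin m, Odd (parity (Sum.inl a : Idx m n)) = False := fun a => by simp [parity]
    have hF : ∀ i : Fin n, Odd (parity (Sum.inr i : Idx m n)) = True := fun i => by simp [parity]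
    rw [Fintype.prod_sum_type]
    simp only [hB, hF, Sum.elim_inl, Sum.elim_inr, sumSeries_false, sumSeries_true]
    rw [Finset.prod_mul_distrib, Finset.prod_pow_eq_pow_sum, mul_assoc, mul_left_comm]
  rw [symWeightModule, character_symSubmodule, ← h1]
  refine PowerSeries.ext fun k => ?_
  rw [PowerSeries.coeff_mk, levelSpace_weightSpace, finrank_superInv_homogOps _ _ _ hw',
    ncard_multisetFamilies]

theorem finrank_highestWeightSpace {μ : YoungDiagram} (hL : μ.card = L) (hn : μ.rowLen m ≤ n) :
    (Module.finrank ℂ (highestWeightSpace m n L μ) : ℚ) =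
      (L.factorial : ℚ) / ∏ c ∈ μ.cells, (hookLength μ c : ℚ) := by
  rw [highestWeightSpace_eq, finrank_hwSpace_super _ _ (le_max_left m (μ.colLen 0))
    (le_max_right _ _) hn, finrank_hwSpace_complex _ (le_max_right _ _) hL]

theorem character_symHighestWeightModule {μ : YoungDiagram} (hL : μ.card = L)
    (hn : μ.rowLen m ≤ n) (hbar : ℂ) :
    character (symHighestWeightModule m n L hbar μ) =
      PowerSeries.X ^ (∑ s ∈ Finset.range (μ.rowLen 0), μ.colLen s * (μ.colLen s - 1) / 2) *
        ∏ c ∈ μ.cells, (1 - PowerSeries.X ^ hookLength μ c)⁻¹ := by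
  rw [symHighestWeightModule, character_symSubmodule,
    ← mk_finrank_hwSpace_homogOps μ (le_max_right m _) hL]
  refine PowerSeries.ext fun k => ?_
  rw [PowerSeries.coeff_mk, PowerSeries.coeff_mk, levelSpace_highestWeightSpace,
    finrank_hwSpace_super _ _ (le_max_left m (μ.colLen 0)) (le_max_right _ _) hn]

end Conclusion

end SuperSpinChain

theorem mainTheorem10 (m n L : ℕ) (hbar : ℂ) :
    (∀ (lam : Fin m → ℕ) (nu : Fin n → ℕ), ∑ a, lam a + ∑ i, nu i = L →
      Module.Free (SuperSpinChain.PolyChi L) (SuperSpinChain.symWeightModule L hbar lam nu) ∧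
      Module.Finite (SuperSpinChain.PolyChi L) (SuperSpinChain.symWeightModule L hbar lam nu) ∧
      (Module.finrank (SuperSpinChain.PolyChi L)
          (SuperSpinChain.symWeightModule L hbar lam nu) : ℚ) =
        (L.factorial : ℚ) / ((∏ a, ((lam a).factorial : ℚ)) * ∏ i, ((nu i).factorial : ℚ)) ∧
      SuperSpinChain.character (SuperSpinChain.symWeightModule L hbar lam nu) =
        PowerSeries.X ^ (∑ i, nu i * (nu i - 1) / 2) *
          (∏ a, ∏ k ∈ Finset.Icc 1 (lam a), (1 - PowerSeries.X ^ k)⁻¹) *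
          (∏ i, ∏ k ∈ Finset.Icc 1 (nu i), (1 - PowerSeries.X ^ k)⁻¹)) ∧
    (∀ μ : YoungDiagram, μ.card = L → μ.rowLen m ≤ n →
      Module.Free (SuperSpinChain.PolyChi L)
        (SuperSpinChain.symHighestWeightModule m n L hbar μ) ∧
      Module.Finite (SuperSpinChain.PolyChi L)
        (SuperSpinChain.symHighestWeightModule m n L hbar μ) ∧
      (Module.finrank (SuperSpinChain.PolyChi L)
          (SuperSpinChain.symHighestWeightModule m n L hbar μ) : ℚ) =
        (L.factorial : ℚ) / ∏ c ∈ μ.cells, (SuperSpinChain.hookLength μ c : ℚ) ∧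
      Module.finrank (SuperSpinChain.PolyChi L)
          (SuperSpinChain.symHighestWeightModule m n L hbar μ) =
        Module.finrank ℂ (SuperSpinChain.highestWeightSpace m n L μ) ∧
      SuperSpinChain.character (SuperSpinChain.symHighestWeightModule m n L hbar μ) =
        PowerSeries.X ^
            (∑ s ∈ Finset.range (μ.rowLen 0), μ.colLen s * (μ.colLen s - 1) / 2) *
          ∏ c ∈ μ.cells, (1 - PowerSeries.X ^ SuperSpinChain.hookLength μ c)⁻¹) := by
  constructor
  · intro lam nu hw
    obtain ⟨h1, h2, h3⟩ := SuperSpinChain.free_symSubmodule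
      (SuperSpinChain.swapStable_weightSpace (L := L) lam nu) hbar
    refine ⟨h1, h2, ?_, SuperSpinChain.character_symWeightModule hw hbar⟩
    rw [SuperSpinChain.symWeightModule, h3, SuperSpinChain.finrank_weightSpace hw]
  · intro μ hL hn
    obtain ⟨h1, h2, h3⟩ := SuperSpinChain.free_symSubmodule
      (SuperSpinChain.swapStable_highestWeightSpace (m := m) (n := n) (L := L) μ) hbar
    refine ⟨h1, h2, ?_, h3, SuperSpinChain.character_symHighestWeightModule hL hn hbar⟩
    rw [SuperSpinChain.symHighestWeightModule, h3, SuperSpinChain.finrank_highestWeightSpace hL hn]
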